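/- Let $1\le k\le n$ be integers and $\theta\in(0,\pi)$. Let $E_1,\dots,E_{n+1}$ be the standard basis of $\mathbb R^{n+1}$, $e=-E_{n+1}$, and let $$\mathcal C_\theta=\{\xi\in\mathbb R^{n+1}:\ \langle\xi,E_{n+1}\rangle\ge 0,\ |\xi-\cos\theta\, e|=1\}$$ be the spherical cap with its round metric $\sigma$, Levi-Civita connection $\nabla$, and outward unit conormal $\mu$ of $\partial\mathcal C_\theta\subset\mathcal C_\theta$. Let $$W^{m,2}_N(\mathcal C_\theta)=\{u\in W^{m,2}(\mathcal C_\theta):\ \nabla_\mu u=\cot\theta\,u\ \text{on}\ \partial\mathcal C_\theta\},\qquad C^4_N(\mathcal C_\theta)=\{u\in C^4(\mathcal C_\theta):\ \nabla_\mu u=\cot\theta\,u\ \text{on}\ \partial\mathcal C_\theta\},$$ where $m\in\mathbb N$ is so large that $W^{m,2}_N(\mathcal C_\theta)\subset C^4_N(\mathcal C_\theta)$ (elements being identified with their continuous representatives). For a symmetric $n\times n$ matrix $A$ let $\sigma_k(A)$ be the $k$-th elementary symmetric function of its eigenvalues, i.e. the sum of its $k\times k$ principal minors. For $h,v\in W^{m,2}_N(\mathcal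 C_\theta)$ put $W=\nabla^2h+h\sigma$ and, in a local orthonormal frame, $$L_h(v)=\sum_{i,j=1}^n\frac{\partial\sigma_k(W)}{\partial W_{ij}}\,(v_{ij}+v\,\delta_{ij}),$$ the linearization at $h$ of $h\mapsto\sigma_k(\nabla^2h+h\sigma)$. Let $h,v\in W^{m,2}_N(\mathcal C_\theta)$ be such that $W=\nabla^2h+h\sigma$ is positive definite on $\mathcal C_\theta$ and $L_h(v)=0$ on $\mathcal C_\theta$. Then there are constants $a_1,\dots,a_n\in\mathbb R$ with $$v(\xi)=\sum_{\alpha=1}^n a_\alpha\langle\xi,E_\alpha\rangle\qquad\text{for all }\xi\in\mathcal C_\theta .$$ -/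

import Mathlib

noncomputable section

namespace Capillary

open MeasureTheory
open scoped ContDiff

/-- The ambient Euclidean space `ℝ^{n+1}`. -/
abbrev Amb (n : ℕ) : Type := EuclideanSpace ℝ (Fin (n + 1))

/-- The coordinate unit vectors of `ℝ^{n+1}`. -/
def stdVec {n : ℕ} (i : Fin (n + 1)) : Amb n := EuclideanSpace.single i 1

/-- `e = -E_{n+1}`, the unit outward normal of the boundary of the half-space `{x_{n+1} ≥ 0}`. -/
def downVec (n : ℕ) : Amb n := -stdVec (Fin.last n)

/-- The spherical cap `C_θ = {ξ : ξ_{n+1} ≥ 0, |ξ - cos θ e| = 1}`. -/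
def cap (n : ℕ) (θ : ℝ) : Set (Amb n) :=
  {ξ | 0 ≤ ξ (Fin.last n) ∧ ‖ξ - Real.cos θ • downVec n‖ = 1}

/-- The boundary `∂C_θ`, i.e. the part of the cap in the hyperplane `{x_{n+1} = 0}`. -/
def capBoundary (n : ℕ) (θ : ℝ) : Set (Amb n) :=
  {ξ | ξ ∈ cap n θ ∧ ξ (Fin.last n) = 0}

/-- The outward unit normal `ν(ξ) = ξ - cos θ e` of the cap at `ξ`. -/
def normal {n : ℕ} (θ : ℝ) (ξ : Amb n) : Amb n := ξ - Real.cos θ • downVec n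

/-- The outward unit co-normal `μ` of `∂C_θ` in `C_θ`, given by `e = sin θ μ - cos θ ν`. -/
def conormal {n : ℕ} (θ : ℝ) (ξ : Amb n) : Amb n :=
  (Real.sin θ)⁻¹ • (downVec n + Real.cos θ • normal θ ξ)

/-! ### Differential calculus on the cap

A function on the cap is represented by `u : Amb n → ℝ`; only its values on the cap matter.
Since the unit sphere is totally geodesic for functions that are constant along rays, the
covariant derivatives `∇u` and `∇²u` with respect to the round metric are the restrictions to
tangent vectors of the first two Euclidean derivatives of the extension of `u` which is constant
along the rays issuing from the centre of the sphere. Coordinates are moved so that this centre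
is the origin. -/

/-- The point of the sphere that contains the cap on the ray through `x`. -/
def radialProj {n : ℕ} (θ : ℝ) (x : Amb n) : Amb n := ‖x‖⁻¹ • x + Real.cos θ • downVec n

/-- The union of the open rays through the points of the (translated, closed) cap. -/
def cone (n : ℕ) (θ : ℝ) : Set (Amb n) := {x | x ≠ 0 ∧ radialProj θ x ∈ cap n θ}

/-- The extension of a function on the cap that is constant along rays. -/
def radialExt {n : ℕ} (θ : ℝ) (u : Amb n → ℝ) (x : Amb n) : ℝ := u (radialProj θ x)

/-- `u ∈ C^r(C_θ)`, with regularity up to the boundary. -/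
def CapContDiff {n : ℕ} (θ : ℝ) (r : ℕ) (u : Amb n → ℝ) : Prop :=
  ContDiffOn ℝ r (radialExt θ u) (cone n θ)

/-- The differential of `u` on the cap: `capDeriv θ u ξ X = ∇_X u` for `X` tangent at `ξ`. -/
def capDeriv {n : ℕ} (θ : ℝ) (u : Amb n → ℝ) (ξ : Amb n) : Amb n →L[ℝ] ℝ :=
  fderivWithin ℝ (radialExt θ u) (cone n θ) (normal θ ξ)

/-- The covariant Hessian on the cap: `capHess θ u ξ X Y = ∇²u(X, Y)` for `X, Y` tangent
at `ξ`. -/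
def capHess {n : ℕ} (θ : ℝ) (u : Amb n → ℝ) (ξ : Amb n) : Amb n →L[ℝ] Amb n →L[ℝ] ℝ :=
  fderivWithin ℝ (fderivWithin ℝ (radialExt θ u) (cone n θ)) (cone n θ) (normal θ ξ)

/-- The bilinear form `∇²u + u σ` at `ξ`, where `σ` is the round metric. -/
def capW {n : ℕ} (θ : ℝ) (u : Amb n → ℝ) (ξ X Y : Amb n) : ℝ :=
  capHess θ u ξ X Y + u ξ * inner ℝ X Y

/-- `∇²u + u σ > 0` on the cap: it is positive definite on every tangent space. -/
def StrictlyConvex {n : ℕ} (θ : ℝ) (u : Amb n → ℝ) : Prop :=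
  ∀ ξ ∈ cap n θ, ∀ X : Amb n, inner ℝ X (normal θ ξ) = 0 → X ≠ 0 → 0 < capW θ u ξ X X

/-- The Robin condition `∇_μ u = cot θ u` on `∂C_θ`. -/
def Robin {n : ℕ} (θ : ℝ) (u : Amb n → ℝ) : Prop :=
  ∀ ξ ∈ capBoundary n θ, capDeriv θ u ξ (conormal θ ξ) = Real.cot θ * u ξ

/-- `b` is an orthonormal frame of the tangent space of the cap at `ξ`. -/
def IsTangentFrame {n : ℕ} (θ : ℝ) (ξ : Amb n) (b : Fin n → Amb n) : Prop :=
  Orthonormal ℝ b ∧ ∀ i, inner ℝ (b i) (normal θ ξ) = 0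

/-- The matrix `u_{ij} + u δ_{ij}` of `∇²u + u σ` at `ξ` in the frame `b`. -/
def capWMatrix {n : ℕ} (θ : ℝ) (u : Amb n → ℝ) (ξ : Amb n) (b : Fin n → Amb n) :
    Matrix (Fin n) (Fin n) ℝ :=
  Matrix.of fun i j => capW θ u ξ (b i) (b j)

/-! ### The Hessian operator and its linearization -/

/-- `σ_k(A)`, the sum of the `k × k` principal minors of `A`; for symmetric `A` this is the
`k`-th elementary symmetric function of the eigenvalues. -/
def sigmaK {n : ℕ} (k : ℕ) (A : Matrix (Fin n) (Fin n) ℝ) : ℝ :=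
  ∑ s ∈ (Finset.univ : Finset (Fin n)).powersetCard k,
    (A.submatrix (fun i : s => (i : Fin n)) (fun i : s => (i : Fin n))).det

/-- The partial derivative `∂σ_k / ∂A_{ij}` at `A`. -/
def sigmaKPartial {n : ℕ} (k : ℕ) (A : Matrix (Fin n) (Fin n) ℝ) (i j : Fin n) : ℝ :=
  deriv (fun t : ℝ => sigmaK k (A + Matrix.single i j t)) 0

/-- The linearization `L_h v = (∂σ_k(W) / ∂W_{ij}) (v_{ij} + v δ_{ij})` at the point `ξ`, where
`W = ∇²h + h σ` and components are taken in the frame `b` at `ξ`. -/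
def linearized {n : ℕ} (θ : ℝ) (k : ℕ) (h v : Amb n → ℝ) (ξ : Amb n) (b : Fin n → Amb n) : ℝ :=
  ∑ i, ∑ j, sigmaKPartial k (capWMatrix θ h ξ b) i j * capWMatrix θ v ξ b i j

/-! ### Sobolev spaces on the cap -/

/-- `f ∈ W^{m,2}(Ω)` for `Ω` an open subset of `ℝ^n`: `f` and all its weak partial derivatives of
order at most `m` are in `L²(Ω)`. The list `I` gives the directions of differentiation. -/
def MemSobolevOn {n : ℕ} (m : ℕ) (f : EuclideanSpace ℝ (Fin n) → ℝ)
    (Ω : Set (EuclideanSpace ℝ (Fin n))) : Prop :=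
  MemLp f 2 (volume.restrict Ω) ∧
    ∀ j ≤ m, ∀ I : Fin j → Fin n, ∃ g : EuclideanSpace ℝ (Fin n) → ℝ,
      MemLp g 2 (volume.restrict Ω) ∧
        ∀ φ : EuclideanSpace ℝ (Fin n) → ℝ,
          ContDiff ℝ ∞ φ → HasCompactSupport φ → tsupport φ ⊆ Ω →
            ∫ y in Ω, f y * iteratedFDeriv ℝ j φ y (fun a => EuclideanSpace.single (I a) 1) =
              (-1) ^ j * ∫ y in Ω, g y * φ y

/-- Inverse stereographic projection (from the south pole) onto the sphere that contains the cap,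
`y ↦ (2 y, 1 - |y|²) / (1 + |y|²) + cos θ e`. -/
def stereo {n : ℕ} (θ : ℝ) (y : EuclideanSpace ℝ (Fin n)) : Amb n :=
  (1 + ‖y‖ ^ 2)⁻¹ • WithLp.toLp 2 (Fin.snoc (α := fun _ => ℝ) (fun i => 2 * y i) (1 - ‖y‖ ^ 2)) +
    Real.cos θ • downVec n

/-- The coordinate domain of the interior of the cap; for `0 < θ < π` it is the open ball of
radius `tan (θ / 2)`. -/
def chartDomain (n : ℕ) (θ : ℝ) : Set (EuclideanSpace ℝ (Fin n)) :=
  {y | 0 < stereo θ y (Fin.last n)}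

/-- `u ∈ W^{m,2}(C_θ)`. For `0 < θ < π` stereographic coordinates form a single chart of the
closed cap, smooth up to the boundary, so membership can be tested in this chart. -/
def MemSobolevCap {n : ℕ} (θ : ℝ) (m : ℕ) (u : Amb n → ℝ) : Prop :=
  MemSobolevOn m (fun y => u (stereo θ y)) (chartDomain n θ)

/-- `W^{m,2}_N(C_θ)`, the functions in `W^{m,2}(C_θ)` with `∇_μ u = cot θ u` on `∂C_θ`. It is only
used for large `m`, where elements are identified with their continuous representatives, these
are `C^1` up to the boundary, and the boundary condition holds pointwise. -/
def SobolevRobin (n : ℕ) (θ : ℝ) (m : ℕ) : Set (Amb n → ℝ) :=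
  {u | MemSobolevCap θ m u ∧ CapContDiff θ 1 u ∧ Robin θ u}

/-- `C^4_N(C_θ)`, the functions in `C^4(C_θ)` with `∇_μ u = cot θ u` on `∂C_θ`. -/
def C4Robin (n : ℕ) (θ : ℝ) : Set (Amb n → ℝ) :=
  {u | CapContDiff θ 4 u ∧ Robin θ u}

end Capillary

end

namespace Capillary

/-- The `k`-th elementary symmetric function of the family `a` restricted to `S`. -/
noncomputable def elemSymm {ι : Type*} (S : Finset ι) (k : ℕ) (a : ι → ℝ) : ℝ :=
  (∏ i ∈ S, (1 + Polynomial.C (a i) * Polynomial.X)).coeff k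

section Det
open Polynomial
variable {ι R : Type*} [Fintype ι] [DecidableEq ι] [CommRing R]

lemma det_diagonal_add (a : ι → R) (M : Matrix ι ι R) :
    (Matrix.diagonal a + M).det =
      ∑ s : Finset ι, (∏ i ∈ sᶜ, a i) * (M.submatrix (fun i : s => (i : ι)) (fun i : s => (i : ι))).det := by
  let D := (Matrix.detRowAlternating : (ι → R) [⋀^ι]→ₗ[R] R)
  have h0 : (Matrix.diagonal a + M).det =
      D ((fun i => M i) + (fun i => (Matrix.diagonal a) i)) := by
    rw [add_comm]; rfl
  rw [h0, D.map_add_univ]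
  refine Finset.sum_congr rfl fun s _ => ?_
  have h1 : s.piecewise (fun i => M i) (fun i => (Matrix.diagonal a) i) =
      fun i => (if i ∈ s then (1 : R) else a i) •
        s.piecewise M.row (1 : Matrix ι ι R).row i := by
    funext i j
    by_cases hi : i ∈ s
    · simp [Finset.piecewise, hi, Matrix.row]
    · simp [Finset.piecewise, hi, Matrix.row, Matrix.diagonal_apply, Matrix.one_apply]
  rw [h1, D.map_smul_univ, smul_eq_mul]
  congr 1
  · rw [← Finset.prod_mul_prod_compl s (fun i => if i ∈ s then (1 : R) else a i)]
    rw [Finset.prod_congr rfl (fun i hi => if_pos hi)]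
    rw [Finset.prod_congr (s₁ := sᶜ) rfl (fun i hi => if_neg (Finset.mem_compl.1 hi))]
    simp
  · exact Matrix.det_piecewise_one_eq_submatrix_det M s

end Det

section SigmaK
open Polynomial
variable {n m : ℕ}

lemma sigmaK_eq_coeff (k : ℕ) (A : Matrix (Fin n) (Fin n) ℝ) :
    sigmaK k A = (Matrix.det (1 + (X : ℝ[X]) • A.map C)).coeff k := by
  rw [Matrix.coeff_det_one_add_X_smul_eq_sum_minors]; rfl

lemma eval_det_one_add (A : Matrix (Fin n) (Fin n) ℝ) (t : ℝ) :
    (Matrix.det (1 + (X : ℝ[X]) • A.map C)).eval t = Matrix.det (1 + t • A) := by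
  rw [← coe_evalRingHom, RingHom.map_det]
  congr 1
  ext i j
  by_cases h : i = j <;> simp [h] <;> exact mul_comm _ _

lemma sigmaK_congr_of_det {A : Matrix (Fin n) (Fin n) ℝ} {B : Matrix (Fin m) (Fin m) ℝ}
    (h : ∀ t : ℝ, Matrix.det (1 + t • A) = Matrix.det (1 + t • B)) (k : ℕ) :
    sigmaK k A = sigmaK k B := by
  rw [sigmaK_eq_coeff, sigmaK_eq_coeff]
  congr 1
  refine Polynomial.funext fun t => ?_
  rw [eval_det_one_add, eval_det_one_add, h]

lemma sigmaK_smul (k : ℕ) (c : ℝ) (A : Matrix (Fin n) (Fin n) ℝ) :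
    sigmaK k (c • A) = c ^ k * sigmaK k A := by
  rw [sigmaK, sigmaK, Finset.mul_sum]
  refine Finset.sum_congr rfl fun s hs => ?_
  have : (c • A).submatrix (fun i : s => (i : Fin n)) (fun i : s => (i : Fin n)) =
    c • A.submatrix (fun i : s => (i : Fin n)) (fun i : s => (i : Fin n)) := rfl
  rw [this, Matrix.det_smul, Fintype.card_coe, (Finset.mem_powersetCard.1 hs).2]

lemma det_one_add_smul_eq_sum (A : Matrix (Fin n) (Fin n) ℝ) (t : ℝ) :
    Matrix.det (1 + t • A) = ∑ k ∈ Finset.range (n + 1), sigmaK k A * t ^ k := by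
  have hd : (Matrix.det (1 + (X : ℝ[X]) • A.map C)).natDegree < n + 1 := by
    have := Polynomial.natDegree_det_X_add_C_le A (1 : Matrix (Fin n) (Fin n) ℝ)
    simp only [Fintype.card_fin] at this
    have h1 : (1 : Matrix (Fin n) (Fin n) ℝ).map (C : ℝ →+* ℝ[X]) = 1 := by
      simp
    rw [h1, add_comm] at this
    lia
  rw [← eval_det_one_add, Polynomial.eval_eq_sum_range' hd]
  simp_rw [sigmaK_eq_coeff]

/-- The polynomial `s ↦ σ_k (A + s B)`. -/
noncomputable def sigmaPoly (k : ℕ) (A B : Matrix (Fin n) (Fin n) ℝ) : ℝ[X] :=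
  ∑ s ∈ (Finset.univ : Finset (Fin n)).powersetCard k,
    ((X : ℝ[X]) • (B.submatrix (fun i : s => (i : Fin n)) (fun i : s => (i : Fin n))).map C +
      (A.submatrix (fun i : s => (i : Fin n)) (fun i : s => (i : Fin n))).map C).det

lemma eval_sigmaPoly (k : ℕ) (A B : Matrix (Fin n) (Fin n) ℝ) (s : ℝ) :
    (sigmaPoly k A B).eval s = sigmaK k (A + s • B) := by
  rw [sigmaPoly, Polynomial.eval_finsetSum, sigmaK]
  refine Finset.sum_congr rfl fun S _ => ?_
  rw [← coe_evalRingHom, RingHom.map_det]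
  congr 1
  ext i j
  simp only [Polynomial.coe_evalRingHom, RingHom.mapMatrix_apply, Matrix.map_apply, Matrix.add_apply,
    Matrix.smul_apply, Matrix.submatrix_apply, smul_eq_mul, Polynomial.eval_add,
    Polynomial.eval_mul, Polynomial.eval_X, Polynomial.eval_C]
  exact add_comm _ _

lemma natDegree_sigmaPoly_le (k : ℕ) (A B : Matrix (Fin n) (Fin n) ℝ) :
    (sigmaPoly k A B).natDegree ≤ k := by
  refine Polynomial.natDegree_sum_le_of_forall_le _ _ fun s hs => ?_
  refine (Polynomial.natDegree_det_X_add_C_le _ _).trans ?_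
  rw [Fintype.card_coe, (Finset.mem_powersetCard.1 hs).2]

lemma eq_sigmaPoly {k : ℕ} {A B : Matrix (Fin n) (Fin n) ℝ} {P : ℝ[X]}
    (h : ∀ s, P.eval s = sigmaK k (A + s • B)) : P = sigmaPoly k A B :=
  Polynomial.funext fun s => by rw [h, eval_sigmaPoly]

lemma sigmaK_diagonal_add (k : ℕ) (a : Fin n → ℝ) (M : Matrix (Fin n) (Fin n) ℝ) :
    sigmaK k (Matrix.diagonal a + M) =
      ∑ s : Finset (Fin n), if s.card ≤ k then
        elemSymm sᶜ (k - s.card) a * (M.submatrix (fun i : s => (i : Fin n)) (fun i : s => (i : Fin n))).det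
        else 0 := by
  rw [sigmaK_eq_coeff]
  have h1 : (1 : Matrix (Fin n) (Fin n) ℝ[X]) + (X : ℝ[X]) • (Matrix.diagonal a + M).map C =
      Matrix.diagonal (fun i => 1 + C (a i) * X) + (X : ℝ[X]) • M.map C := by
    ext i j : 2
    by_cases h : i = j
    · subst h
      simp only [Matrix.add_apply, Matrix.one_apply_eq, Matrix.smul_apply, Matrix.map_apply,
        Matrix.diagonal_apply_eq, map_add, smul_eq_mul]
      ring_nf
    · simp [h]
  rw [h1, det_diagonal_add, Polynomial.finsetSum_coeff]
  refine Finset.sum_congr rfl fun s _ => ?_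
  have h2 : ((X : ℝ[X]) • M.map C).submatrix (fun i : s => (i : Fin n)) (fun i : s => (i : Fin n)) =
      (X : ℝ[X]) • (M.submatrix (fun i : s => (i : Fin n)) (fun i : s => (i : Fin n))).map C := rfl
  rw [h2, Matrix.det_smul, Fintype.card_coe]
  have h3 : ((M.submatrix (fun i : s => (i : Fin n)) (fun i : s => (i : Fin n))).map (C : ℝ →+* ℝ[X])).det =
      C (M.submatrix (fun i : s => (i : Fin n)) (fun i : s => (i : Fin n))).det := by
    rw [RingHom.map_det]; rfl
  rw [h3, show (∏ i ∈ sᶜ, (1 + C (a i) * X)) * (X ^ s.card *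
      C (M.submatrix (fun i : s => (i : Fin n)) (fun i : s => (i : Fin n))).det) =
      ((∏ i ∈ sᶜ, (1 + C (a i) * X)) * C (M.submatrix (fun i : s => (i : Fin n)) (fun i : s => (i : Fin n))).det) *
        X ^ s.card by ring, Polynomial.coeff_mul_X_pow', Polynomial.coeff_mul_C]
  rfl

lemma sigmaPoly_diagonal (k : ℕ) (a : Fin n → ℝ) (M : Matrix (Fin n) (Fin n) ℝ) :
    sigmaPoly k (Matrix.diagonal a) M =
      ∑ s : Finset (Fin n), C (if s.card ≤ k then
        elemSymm sᶜ (k - s.card) a * (M.submatrix (fun i : s => (i : Fin n)) (fun i : s => (i : Fin n))).det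
        else 0) * X ^ s.card := by
  symm
  refine eq_sigmaPoly fun r => ?_
  rw [sigmaK_diagonal_add, Polynomial.eval_finsetSum]
  refine Finset.sum_congr rfl fun s _ => ?_
  have h2 : (r • M).submatrix (fun i : s => (i : Fin n)) (fun i : s => (i : Fin n)) =
      r • (M.submatrix (fun i : s => (i : Fin n)) (fun i : s => (i : Fin n))) := rfl
  rw [h2, Matrix.det_smul, Fintype.card_coe]
  split_ifs <;> simp <;> ring

lemma coeff_sigmaPoly_diagonal {k j : ℕ} (hj : j ≤ k) (a : Fin n → ℝ)
    (M : Matrix (Fin n) (Fin n) ℝ) :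
    (sigmaPoly k (Matrix.diagonal a) M).coeff j =
      ∑ s ∈ (Finset.univ : Finset (Fin n)).powersetCard j,
        elemSymm sᶜ (k - j) a * (M.submatrix (fun i : s => (i : Fin n)) (fun i : s => (i : Fin n))).det := by
  rw [sigmaPoly_diagonal, Polynomial.finsetSum_coeff]
  simp_rw [Polynomial.coeff_C_mul_X_pow]
  rw [← Finset.sum_filter]
  have : Finset.univ.filter (fun s : Finset (Fin n) => j = s.card) =
      Finset.univ.powersetCard j := by
    ext s; simp [Finset.mem_powersetCard, eq_comm]
  rw [this]
  refine Finset.sum_congr rfl fun s hs => ?_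
  rw [(Finset.mem_powersetCard.1 hs).2, if_pos hj]

end SigmaK
end Capillary

namespace Capillary

section ElemSymm
open Polynomial
variable {ι : Type*} [DecidableEq ι]

omit [DecidableEq ι] in
lemma elemSymm_zero (S : Finset ι) (a : ι → ℝ) : elemSymm S 0 a = 1 := by
  simp [elemSymm, coeff_zero_eq_eval_zero, eval_prod]

lemma elemSymm_insert {S : Finset ι} {i : ι} (hi : i ∉ S) (k : ℕ) (a : ι → ℝ) :
    elemSymm (insert i S) (k + 1) a = elemSymm S (k + 1) a + a i * elemSymm S k a := by
  rw [elemSymm, Finset.prod_insert hi, add_mul, one_mul, mul_assoc, coeff_add, coeff_C_mul,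
    coeff_X_mul]
  rfl

lemma elemSymm_erase {S : Finset ι} {i : ι} (hi : i ∈ S) (k : ℕ) (a : ι → ℝ) :
    elemSymm S (k + 1) a = elemSymm (S.erase i) (k + 1) a + a i * elemSymm (S.erase i) k a := by
  conv_lhs => rw [← Finset.insert_erase hi]
  exact elemSymm_insert (Finset.notMem_erase i S) k a

omit [DecidableEq ι] in
lemma elemSymm_empty (k : ℕ) (a : ι → ℝ) : elemSymm ∅ (k + 1) a = 0 := by
  simp [elemSymm, coeff_one]

lemma elemSymm_nonneg {S : Finset ι} {a : ι → ℝ} (ha : ∀ i ∈ S, 0 < a i) (k : ℕ) :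
    0 ≤ elemSymm S k a := by
  induction S using Finset.induction_on generalizing k with
  | empty => cases k with
    | zero => rw [elemSymm_zero]; exact zero_le_one
    | succ k => rw [elemSymm_empty]
  | insert i S hi ih => cases k with
    | zero => rw [elemSymm_zero]; exact zero_le_one
    | succ k =>
      rw [elemSymm_insert hi]
      have h := fun k => ih (fun j hj => ha j (Finset.mem_insert_of_mem hj)) k
      have := (ha i (Finset.mem_insert_self i S)).le
      have := h k; have := h (k + 1)
      positivity

lemma elemSymm_pos {S : Finset ι} {a : ι → ℝ} (ha : ∀ i ∈ S, 0 < a i) {k : ℕ}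
    (hk : k ≤ S.card) : 0 < elemSymm S k a := by
  induction S using Finset.induction_on generalizing k with
  | empty => cases k with
    | zero => rw [elemSymm_zero]; exact zero_lt_one
    | succ k => simp at hk
  | insert i S hi ih => cases k with
    | zero => rw [elemSymm_zero]; exact zero_lt_one
    | succ k =>
      rw [elemSymm_insert hi]
      have ha' : ∀ j ∈ S, 0 < a j := fun j hj => ha j (Finset.mem_insert_of_mem hj)
      have h0 := ha i (Finset.mem_insert_self i S)
      rw [Finset.card_insert_of_notMem hi] at hk
      have h1 := ih ha' (k := k) (by lia)
      have h2 := elemSymm_nonneg ha' (k + 1)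
      positivity

lemma elemSymm_euler (S : Finset ι) (k : ℕ) (a : ι → ℝ) :
    (k + 1) * elemSymm S (k + 1) a = ∑ i ∈ S, a i * elemSymm (S.erase i) k a := by
  have h := congrArg (fun p : ℝ[X] => p.coeff k)
    (derivative_prod_finset (s := S) (f := fun i => 1 + C (a i) * X))
  simp only [coeff_derivative, finsetSum_coeff] at h
  rw [elemSymm, mul_comm, h]
  refine Finset.sum_congr rfl fun i _ => ?_
  rw [derivative_add, derivative_one, zero_add, derivative_C_mul, derivative_X, mul_one, coeff_mul_C,
    mul_comm]
  rfl

lemma elemSymm_smul (S : Finset ι) (k : ℕ) (c : ℝ) (a : ι → ℝ) :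
    elemSymm S k (fun i => c * a i) = c ^ k * elemSymm S k a := by
  induction S using Finset.induction_on generalizing k with
  | empty => cases k with
    | zero => simp [elemSymm_zero]
    | succ k => simp [elemSymm_empty]
  | insert i S hi ih => cases k with
    | zero => simp [elemSymm_zero]
    | succ k => rw [elemSymm_insert hi, elemSymm_insert hi, ih, ih]; ring

lemma elemSymm_one (S : Finset ι) (a : ι → ℝ) : elemSymm S 1 a = ∑ i ∈ S, a i := by
  induction S using Finset.induction_on with
  | empty => exact elemSymm_empty 0 a
  | insert i S hi ih => rw [elemSymm_insert hi, zero_add, ih, elemSymm_zero, Finset.sum_insert hi]; ring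

lemma elemSymm_two (S : Finset ι) (a : ι → ℝ) :
    2 * elemSymm S 2 a = (∑ i ∈ S, a i) ^ 2 - ∑ i ∈ S, a i ^ 2 := by
  induction S using Finset.induction_on with
  | empty => simp [elemSymm_empty 1 a]
  | insert i S hi ih =>
    rw [elemSymm_insert hi, Finset.sum_insert hi, Finset.sum_insert hi, mul_add, ih, elemSymm_one]
    ring

lemma parallel_add_le {x y g h G : ℝ} (hx : 0 < x) (hy : 0 < y) (hg : 0 < g) (hh : 0 < h)
    (hG : g + h ≤ G) :
    x * g / (g + x) + y * h / (h + y) ≤ (x + y) * G / (G + (x + y)) := by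
  have h1 : x * g / (g + x) + y * h / (h + y) ≤ (x + y) * (g + h) / ((g + h) + (x + y)) := by
    rw [div_add_div _ _ (by positivity) (by positivity), div_le_div_iff₀ (by positivity)
      (by positivity)]
    nlinarith [mul_nonneg (by positivity : 0 ≤ (1 : ℝ)) (sq_nonneg (x * h - y * g))]
  refine h1.trans ?_
  rw [div_le_div_iff₀ (by positivity) (by linarith)]
  nlinarith [mul_nonneg (mul_pos (add_pos hx hy) (add_pos hx hy)).le (sub_nonneg.2 hG)]

lemma elemSymm_ratio_eq {S : Finset ι} {a : ι → ℝ} (ha : ∀ i ∈ S, 0 < a i) {k : ℕ}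
    (hk : k + 2 ≤ S.card) :
    (k + 2) * (elemSymm S (k + 2) a / elemSymm S (k + 1) a) =
      ∑ i ∈ S, a i * (elemSymm (S.erase i) (k + 1) a / elemSymm (S.erase i) k a) /
        (elemSymm (S.erase i) (k + 1) a / elemSymm (S.erase i) k a + a i) := by
  have h := elemSymm_euler S (k + 1) a
  rw [mul_div_assoc', show ((k : ℝ) + 2) = ((k + 1 : ℕ) : ℝ) + 1 by push_cast; ring, h,
    Finset.sum_div]
  refine Finset.sum_congr rfl fun i hi => ?_
  have hc := Finset.card_erase_of_mem hi
  have ha' : ∀ j ∈ S.erase i, 0 < a j := fun j hj => ha j (Finset.mem_of_mem_erase hj)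
  have h0 : 0 < elemSymm (S.erase i) k a := elemSymm_pos ha' (by lia)
  have h1 : 0 < elemSymm (S.erase i) (k + 1) a := elemSymm_pos ha' (by lia)
  have h2 := ha i hi
  rw [elemSymm_erase hi]
  field_simp

lemma elemSymm_ratio_superadditive (k : ℕ) {S : Finset ι} {x y : ι → ℝ} (hx : ∀ i ∈ S, 0 < x i)
    (hy : ∀ i ∈ S, 0 < y i) (hk : k + 1 ≤ S.card) :
    elemSymm S (k + 1) x / elemSymm S k x + elemSymm S (k + 1) y / elemSymm S k y ≤
      elemSymm S (k + 1) (x + y) / elemSymm S k (x + y) := by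
  induction k generalizing S with
  | zero => simp [elemSymm_zero, elemSymm_one, Finset.sum_add_distrib]
  | succ k ih =>
    have hxy : ∀ i ∈ S, 0 < (x + y) i := fun i hi => add_pos (hx i hi) (hy i hi)
    have hp : (0 : ℝ) < k + 2 := by positivity
    refine le_of_mul_le_mul_left ?_ hp
    rw [mul_add, elemSymm_ratio_eq hx hk, elemSymm_ratio_eq hy hk, elemSymm_ratio_eq hxy hk,
      ← Finset.sum_add_distrib]
    refine Finset.sum_le_sum fun i hi => ?_
    have hc := Finset.card_erase_of_mem hi
    have hx' : ∀ j ∈ S.erase i, 0 < x j := fun j hj => hx j (Finset.mem_of_mem_erase hj)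
    have hy' : ∀ j ∈ S.erase i, 0 < y j := fun j hj => hy j (Finset.mem_of_mem_erase hj)
    exact parallel_add_le (hx i hi) (hy i hi)
      (div_pos (elemSymm_pos hx' (by lia)) (elemSymm_pos hx' (by lia)))
      (div_pos (elemSymm_pos hy' (by lia)) (elemSymm_pos hy' (by lia))) (ih hx' hy' (by lia))

lemma elemSymm_ratio_midpoint (k : ℕ) {S : Finset ι} {a b : ι → ℝ}
    (hp : ∀ i ∈ S, 0 < a i + b i) (hm : ∀ i ∈ S, 0 < a i - b i) (hk : k + 1 ≤ S.card) :
    elemSymm S (k + 1) (a + b) * elemSymm S (k + 1) (a - b) * elemSymm S k a ^ 2 ≤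
      elemSymm S k (a + b) * elemSymm S k (a - b) * elemSymm S (k + 1) a ^ 2 := by
  have ha : ∀ i ∈ S, 0 < a i := fun i hi => by linarith [hp i hi, hm i hi]
  have h := elemSymm_ratio_superadditive k (x := a + b) (y := a - b) hp hm hk
  have h2 : (a + b) + (a - b) = fun i => 2 * a i := by ext i; simp; ring
  have p1 := elemSymm_pos (a := a + b) hp (k := k) (by lia)
  have p2 := elemSymm_pos (a := a + b) hp hk
  have m1 := elemSymm_pos (a := a - b) hm (k := k) (by lia)
  have m2 := elemSymm_pos (a := a - b) hm hk
  have a1 := elemSymm_pos ha (k := k) (by lia)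
  have a2 := elemSymm_pos ha hk
  rw [h2, elemSymm_smul, elemSymm_smul] at h
  generalize elemSymm S (k + 1) (a + b) = P2 at *
  generalize elemSymm S k (a + b) = P1 at *
  generalize elemSymm S (k + 1) (a - b) = M2 at *
  generalize elemSymm S k (a - b) = M1 at *
  generalize elemSymm S (k + 1) a = A2 at *
  generalize elemSymm S k a = A1 at *
  have h3 : 2 ^ (k + 1) * A2 / (2 ^ k * A1) = 2 * (A2 / A1) := by
    rw [pow_succ]; field_simp
  rw [h3] at h
  have h4 : (P2 / P1) * (M2 / M1) ≤ (A2 / A1) ^ 2 := by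
    have := div_pos p2 p1; have := div_pos m2 m1
    nlinarith [sq_nonneg (P2 / P1 - M2 / M1)]
  rw [div_mul_div_comm, div_pow, div_le_div_iff₀ (by positivity) (by positivity)] at h4
  linarith

lemma elemSymm_midpoint (k : ℕ) {S : Finset ι} {a b : ι → ℝ}
    (hp : ∀ i ∈ S, 0 < a i + b i) (hm : ∀ i ∈ S, 0 < a i - b i) (hk : k + 2 ≤ S.card) :
    elemSymm S (k + 2) (a + b) * elemSymm S (k + 2) (a - b) * elemSymm S 2 a ^ 2 ≤
      elemSymm S 2 (a + b) * elemSymm S 2 (a - b) * elemSymm S (k + 2) a ^ 2 := by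
  induction k with
  | zero => exact le_of_eq (by ring)
  | succ k ih =>
    have ha : ∀ i ∈ S, 0 < a i := fun i hi => by linarith [hp i hi, hm i hi]
    have h1 := elemSymm_ratio_midpoint (k + 2) hp hm hk
    have h2 := ih (by lia)
    have a1 := elemSymm_pos ha (k := k + 2) (by lia)
    have a2 := elemSymm_pos ha (k := 2) (by lia)
    have a3 := elemSymm_pos ha hk
    have : 0 < elemSymm S (k + 2) a ^ 2 := by positivity
    refine le_of_mul_le_mul_right ?_ this
    have h3 := mul_le_mul_of_nonneg_right h1 (sq_nonneg (elemSymm S 2 a))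
    have h4 := mul_le_mul_of_nonneg_right h2 (sq_nonneg (elemSymm S (k + 2 + 1) a))
    rw [show k + 1 + 2 = k + 2 + 1 by ring]
    linarith

end ElemSymm
end Capillary

namespace Capillary

section SecondOrder
open Polynomial Filter Topology

lemma eval_eq_third_order (P : ℝ[X]) (s : ℝ) :
    P.eval s = P.coeff 0 + P.coeff 1 * s + P.coeff 2 * s ^ 2 +
      P.divX.divX.divX.eval s * s ^ 3 := by
  conv_lhs => rw [← divX_mul_X_add P, ← divX_mul_X_add P.divX, ← divX_mul_X_add P.divX.divX]
  simp only [eval_add, eval_mul, eval_X, eval_C, coeff_divX]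
  ring

lemma second_coeff_le_of_eventually_le {P : ℝ[X]} {q₀ q₁ q₂ : ℝ}
    (h : ∀ᶠ s in 𝓝 (0 : ℝ), P.eval s * P.eval (-s) * q₀ ^ 2 ≤
      ((q₀ + q₂ * s ^ 2) ^ 2 - q₁ ^ 2 * s ^ 2) * P.coeff 0 ^ 2) :
    (2 * P.coeff 0 * P.coeff 2 - P.coeff 1 ^ 2) * q₀ ^ 2 ≤
      (2 * q₀ * q₂ - q₁ ^ 2) * P.coeff 0 ^ 2 := by
  set p₀ := P.coeff 0
  set p₁ := P.coeff 1
  set p₂ := P.coeff 2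
  set R := P.divX.divX.divX
  let F : ℝ → ℝ := fun s => (2 * q₀ * q₂ - q₁ ^ 2) * p₀ ^ 2 - (2 * p₀ * p₂ - p₁ ^ 2) * q₀ ^ 2 +
    s * (q₂ ^ 2 * s * p₀ ^ 2 - (p₂ ^ 2 * s + R.eval s * (p₀ + p₂ * s ^ 2 - s * p₁) -
      R.eval (-s) * (p₀ + p₂ * s ^ 2 + s * p₁) - s ^ 3 * R.eval s * R.eval (-s)) * q₀ ^ 2)
  have hF : Continuous F := by
    have h1 : Continuous fun s : ℝ => R.eval s := R.continuous
    have h2 : Continuous fun s : ℝ => R.eval (-s) := R.continuous.comp continuous_neg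
    fun_prop
  have h1 : ∀ᶠ s in 𝓝[≠] (0 : ℝ), 0 ≤ F s := by
    filter_upwards [h.filter_mono nhdsWithin_le_nhds, self_mem_nhdsWithin] with s hs hs0
    rw [eval_eq_third_order P s, eval_eq_third_order P (-s)] at hs
    have h2 : s ^ 2 * F s = ((q₀ + q₂ * s ^ 2) ^ 2 - q₁ ^ 2 * s ^ 2) * p₀ ^ 2 -
      (p₀ + p₁ * s + p₂ * s ^ 2 + R.eval s * s ^ 3) *
        (p₀ + p₁ * (-s) + p₂ * (-s) ^ 2 + R.eval (-s) * (-s) ^ 3) * q₀ ^ 2 := by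
      simp only [F]; ring
    have h3 : 0 < s ^ 2 := by have : s ≠ 0 := hs0; positivity
    exact nonneg_of_mul_nonneg_right (by rw [h2]; linarith) h3
  have h2 : Tendsto F (𝓝[≠] 0) (𝓝 (F 0)) := hF.continuousAt.tendsto.mono_left nhdsWithin_le_nhds
  have h3 : 0 ≤ F 0 := ge_of_tendsto h2 h1
  simp only [F, zero_mul, add_zero] at h3
  linarith

variable {n : ℕ}

lemma sigmaK_diagonal (k : ℕ) (a : Fin n → ℝ) :
    sigmaK k (Matrix.diagonal a) = elemSymm Finset.univ k a := by
  rw [sigmaK_eq_coeff, elemSymm, ← Matrix.det_diagonal]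
  congr 2
  ext i j : 2
  by_cases h : i = j
  · subst h
    simp only [Matrix.add_apply, Matrix.one_apply_eq, Matrix.smul_apply, Matrix.map_apply,
      Matrix.diagonal_apply_eq, smul_eq_mul]
    ring_nf
  · simp [h]

lemma eval_sigmaPoly_diagonal (k : ℕ) (a b : Fin n → ℝ) (s : ℝ) :
    (sigmaPoly k (Matrix.diagonal a) (Matrix.diagonal b)).eval s =
      elemSymm Finset.univ k (a + s • b) := by
  rw [eval_sigmaPoly, ← sigmaK_diagonal]
  congr 1
  ext i j
  by_cases h : i = j
  · subst h; simp
  · simp [h]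

lemma lorentz_cauchySchwarz {ι : Type*} (S : Finset ι) {a b : ι → ℝ} (hA : 0 < ∑ i ∈ S, a i)
    (hq : 0 < (∑ i ∈ S, a i) ^ 2 - ∑ i ∈ S, a i ^ 2) :
    ((∑ i ∈ S, a i) ^ 2 - ∑ i ∈ S, a i ^ 2) * ((∑ i ∈ S, b i) ^ 2 - ∑ i ∈ S, b i ^ 2) ≤
      ((∑ i ∈ S, a i) * (∑ i ∈ S, b i) - ∑ i ∈ S, a i * b i) ^ 2 ∧
    (((∑ i ∈ S, a i) ^ 2 - ∑ i ∈ S, a i ^ 2) * ((∑ i ∈ S, b i) ^ 2 - ∑ i ∈ S, b i ^ 2) =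
      ((∑ i ∈ S, a i) * (∑ i ∈ S, b i) - ∑ i ∈ S, a i * b i) ^ 2 →
      ∃ c : ℝ, ∀ i ∈ S, b i = c * a i) := by
  set A := ∑ i ∈ S, a i
  set B := ∑ i ∈ S, b i
  set AA := ∑ i ∈ S, a i ^ 2
  set BB := ∑ i ∈ S, b i ^ 2
  set AB := ∑ i ∈ S, a i * b i
  let c := B / A
  have hB : B = c * A := by simp only [c]; field_simp
  have hN : ∑ i ∈ S, (b i - c * a i) ^ 2 = BB - 2 * c * AB + c ^ 2 * AA := by
    simp only [AA, BB, AB, Finset.mul_sum, ← Finset.sum_sub_distrib, ← Finset.sum_add_distrib]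
    exact Finset.sum_congr rfl fun i _ => by ring
  have hnn : 0 ≤ ∑ i ∈ S, (b i - c * a i) ^ 2 := Finset.sum_nonneg fun i _ => sq_nonneg _
  have key : (A * B - AB) ^ 2 - (A ^ 2 - AA) * (B ^ 2 - BB) =
      (A ^ 2 - AA) * ∑ i ∈ S, (b i - c * a i) ^ 2 + (AB - c * AA) ^ 2 := by
    rw [hN, hB]; ring
  have h1 := mul_nonneg hq.le hnn
  refine ⟨by nlinarith [sq_nonneg (AB - c * AA)], fun h => ⟨c, fun i hi => ?_⟩⟩
  have h2 : (A ^ 2 - AA) * ∑ i ∈ S, (b i - c * a i) ^ 2 = 0 := by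
    nlinarith [sq_nonneg (AB - c * AA)]
  have h3 := (mul_eq_zero.1 h2).resolve_left hq.ne'
  have h4 := (Finset.sum_eq_zero_iff_of_nonneg fun i _ => sq_nonneg (b i - c * a i)).1 h3 i hi
  linarith [pow_eq_zero_iff (two_ne_zero) |>.1 h4]

lemma coeff_two_sigmaPoly_diagonal_diagonal {k : ℕ} (hk : 2 ≤ k) (hkn : k ≤ n) {a b : Fin n → ℝ}
    (ha : ∀ i, 0 < a i)
    (h1 : (sigmaPoly k (Matrix.diagonal a) (Matrix.diagonal b)).coeff 1 = 0) :
    (sigmaPoly k (Matrix.diagonal a) (Matrix.diagonal b)).coeff 2 ≤ 0 ∧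
    ((sigmaPoly k (Matrix.diagonal a) (Matrix.diagonal b)).coeff 2 = 0 → b = 0) := by
  obtain ⟨k, rfl⟩ : ∃ l, k = l + 2 := ⟨k - 2, by lia⟩
  set P := sigmaPoly (k + 2) (Matrix.diagonal a) (Matrix.diagonal b) with hP
  have hn : 0 < n := by lia
  have : Nonempty (Fin n) := ⟨⟨0, hn⟩⟩
  have hcard : (Finset.univ : Finset (Fin n)).card = n := Finset.card_fin n
  have hp0 : P.coeff 0 = elemSymm Finset.univ (k + 2) a := by
    rw [coeff_zero_eq_eval_zero, hP, eval_sigmaPoly_diagonal]; simp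
  have hp0' : 0 < P.coeff 0 := by rw [hp0]; exact elemSymm_pos (fun i _ => ha i) (by lia)
  have hA : 0 < ∑ i, a i := Finset.sum_pos (fun i _ => ha i) Finset.univ_nonempty
  have hq0 : 0 < elemSymm Finset.univ 2 a := elemSymm_pos (fun i _ => ha i) (by lia)
  have e2a := elemSymm_two Finset.univ a
  have e2b := elemSymm_two Finset.univ b
  let q₁ := (∑ i, a i) * (∑ i, b i) - ∑ i, a i * b i
  have e2 : ∀ s : ℝ, elemSymm Finset.univ 2 (a + s • b) =
      elemSymm Finset.univ 2 a + q₁ * s + elemSymm Finset.univ 2 b * s ^ 2 := by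
    intro s
    have h := elemSymm_two Finset.univ (a + s • b)
    have e : ∑ i, (a + s • b) i ^ 2 = ∑ i, a i ^ 2 + 2 * s * ∑ i, a i * b i +
        s ^ 2 * ∑ i, b i ^ 2 := by
      simp only [Finset.mul_sum, ← Finset.sum_add_distrib]
      exact Finset.sum_congr rfl fun i _ => by simp; ring
    have e' : ∑ i, (a + s • b) i = ∑ i, a i + s * ∑ i, b i := by
      simp [Finset.mul_sum, Finset.sum_add_distrib]
    rw [e, e'] at h
    refine mul_left_cancel₀ (two_ne_zero (α := ℝ)) ?_
    rw [h]; simp only [q₁]; linear_combination -e2a - s ^ 2 * e2b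
  have hev : ∀ᶠ s in 𝓝 (0 : ℝ), ∀ i, 0 < a i + s * b i ∧ 0 < a i - s * b i := by
    refine Filter.eventually_all.2 fun i => ?_
    have c1 : Tendsto (fun s : ℝ => a i + s * b i) (𝓝 0) (𝓝 (a i + 0 * b i)) :=
      (by fun_prop : Continuous fun s : ℝ => a i + s * b i).tendsto 0
    have c2 : Tendsto (fun s : ℝ => a i - s * b i) (𝓝 0) (𝓝 (a i - 0 * b i)) :=
      (by fun_prop : Continuous fun s : ℝ => a i - s * b i).tendsto 0
    exact (c1.eventually (lt_mem_nhds (by simpa using ha i))).and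
      (c2.eventually (lt_mem_nhds (by simpa using ha i)))
  have hmain := second_coeff_le_of_eventually_le (P := P) (q₀ := elemSymm Finset.univ 2 a)
    (q₁ := q₁) (q₂ := elemSymm Finset.univ 2 b) (by
      filter_upwards [hev] with s hs
      have h := elemSymm_midpoint k (S := Finset.univ) (a := a) (b := s • b)
        (fun i _ => by simpa using (hs i).1) (fun i _ => by simpa using (hs i).2) (by lia)
      have e3 := e2 s
      have e4 := e2 (-s)
      rw [hp0, hP, eval_sigmaPoly_diagonal, eval_sigmaPoly_diagonal]
      rw [neg_smul, ← sub_eq_add_neg] at *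
      rw [e3, e4] at h
      refine h.trans (le_of_eq ?_)
      ring)
  obtain ⟨hL, hL'⟩ := lorentz_cauchySchwarz Finset.univ (a := a) (b := b) hA
    (by rw [← e2a]; positivity)
  rw [← e2a, ← e2b] at hL hL'
  change _ ≤ q₁ ^ 2 at hL
  change _ = q₁ ^ 2 → _ at hL'
  rw [h1] at hmain
  have hD : 2 * elemSymm Finset.univ 2 a * elemSymm Finset.univ 2 b - q₁ ^ 2 ≤ 0 := by
    nlinarith [sq_nonneg q₁]
  have hq2 : 0 < elemSymm Finset.univ 2 a ^ 2 := by positivity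
  have hp2 : 0 < P.coeff 0 ^ 2 := by positivity
  constructor
  · by_contra hcon
    push Not at hcon
    have : 0 < (2 * P.coeff 0 * P.coeff 2 - 0 ^ 2) * elemSymm Finset.univ 2 a ^ 2 := by
      simp; positivity
    nlinarith
  · intro h2
    have hD0 : 2 * elemSymm Finset.univ 2 a * elemSymm Finset.univ 2 b - q₁ ^ 2 = 0 := by
      rw [h2] at hmain
      refine le_antisymm hD ?_
      by_contra hcon
      push Not at hcon
      nlinarith [mul_pos (neg_pos.2 hcon) hp2]
    obtain ⟨c, hc⟩ := hL' (by linarith [sq_nonneg q₁, hL, hD0])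
    have hPc : P = C (P.coeff 0) * (1 + C c * X) ^ (k + 2) := by
      refine Polynomial.funext fun s => ?_
      have h3 : a + s • b = fun i => (1 + c * s) * a i := by
        ext i; simp [hc i (Finset.mem_univ i)]; ring
      conv_lhs => rw [hP]
      rw [eval_sigmaPoly_diagonal, h3, elemSymm_smul, hp0]
      simp
      ring
    have h4 : P.coeff 1 = P.derivative.eval 0 := by
      rw [← coeff_zero_eq_eval_zero, coeff_derivative]; simp
    have h5 : P.derivative.eval 0 = P.coeff 0 * ((k + 2) * c) := by
      conv_lhs => rw [hPc]
      simp [derivative_pow]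
    rw [h1, h5] at h4
    have hk0 : (0 : ℝ) < k + 2 := by positivity
    have hc0 : c = 0 := by
      rcases mul_eq_zero.1 h4.symm with h | h
      · exact absurd h hp0'.ne'
      · exact (mul_eq_zero.1 h).resolve_left hk0.ne'
    ext i
    simp [hc i (Finset.mem_univ i), hc0]

lemma det_submatrix_pair {ι : Type*} [DecidableEq ι] (M : Matrix ι ι ℝ) {i j : ι} (hij : i ≠ j) :
    (M.submatrix (fun x : ({i, j} : Finset ι) => (x : ι))
      (fun x : ({i, j} : Finset ι) => (x : ι))).det = M i i * M j j - M i j * M j i := by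
  let e : Fin 2 ≃ ({i, j} : Finset ι) := Equiv.ofBijective
    ![⟨i, by simp⟩, ⟨j, by simp⟩] (by
      constructor
      · intro x y h
        fin_cases x <;> fin_cases y <;> simp_all [Subtype.ext_iff, eq_comm]
      · rintro ⟨x, hx⟩
        rcases Finset.mem_insert.1 hx with h | h
        · exact ⟨0, by simp [h]⟩
        · exact ⟨1, by simp [Finset.mem_singleton.1 h]⟩)
  rw [← Matrix.det_submatrix_equiv_self e, Matrix.det_fin_two]
  rfl

lemma det_submatrix_singleton {ι : Type*} [DecidableEq ι] (M : Matrix ι ι ℝ) (i : ι) :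
    (M.submatrix (fun x : ({i} : Finset ι) => (x : ι))
      (fun x : ({i} : Finset ι) => (x : ι))).det = M i i := by
  rw [Matrix.det_unique]; rfl

lemma coeff_one_sigmaPoly_diagonal {k : ℕ} (hk : 1 ≤ k) (a : Fin n → ℝ)
    (V : Matrix (Fin n) (Fin n) ℝ) :
    (sigmaPoly k (Matrix.diagonal a) V).coeff 1 =
      ∑ i, elemSymm {i}ᶜ (k - 1) a * V i i := by
  rw [coeff_sigmaPoly_diagonal hk, Finset.powersetCard_one, Finset.sum_map]
  exact Finset.sum_congr rfl fun i _ => congrArg _ (det_submatrix_singleton V i)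

lemma coeff_two_sigmaPoly_diagonal {k : ℕ} (hk : 2 ≤ k) (hkn : k ≤ n) {a : Fin n → ℝ}
    (ha : ∀ i, 0 < a i) {V : Matrix (Fin n) (Fin n) ℝ} (hV : V.IsHermitian)
    (h1 : (sigmaPoly k (Matrix.diagonal a) V).coeff 1 = 0) :
    (sigmaPoly k (Matrix.diagonal a) V).coeff 2 ≤ 0 ∧
    ((sigmaPoly k (Matrix.diagonal a) V).coeff 2 = 0 → V = 0) := by
  have hsym : ∀ i j, V i j = V j i := fun i j => by simpa using (hV.apply i j).symm
  let b : Fin n → ℝ := fun i => V i i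
  have h1' : (sigmaPoly k (Matrix.diagonal a) (Matrix.diagonal b)).coeff 1 = 0 := by
    rw [coeff_one_sigmaPoly_diagonal (by lia)] at h1 ⊢
    simpa [b] using h1
  obtain ⟨hle, heq⟩ := coeff_two_sigmaPoly_diagonal_diagonal hk hkn ha h1'
  have hterm : ∀ s ∈ (Finset.univ : Finset (Fin n)).powersetCard 2,
      elemSymm sᶜ (k - 2) a * (V.submatrix (fun i : s => (i : Fin n)) (fun i : s => (i : Fin n))).det
        ≤ elemSymm sᶜ (k - 2) a * ((Matrix.diagonal b).submatrix (fun i : s => (i : Fin n))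
          (fun i : s => (i : Fin n))).det := by
    intro s hs
    refine mul_le_mul_of_nonneg_left ?_ (elemSymm_nonneg (fun i _ => ha i) _)
    obtain ⟨i, j, hij, rfl⟩ := Finset.card_eq_two.1 (Finset.mem_powersetCard.1 hs).2
    rw [det_submatrix_pair _ hij, det_submatrix_pair _ hij, hsym j i]
    simp only [Matrix.diagonal_apply_eq, Matrix.diagonal_apply_ne _ hij, b]
    nlinarith [sq_nonneg (V i j)]
  have hle2 : (sigmaPoly k (Matrix.diagonal a) V).coeff 2 ≤
      (sigmaPoly k (Matrix.diagonal a) (Matrix.diagonal b)).coeff 2 := by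
    rw [coeff_sigmaPoly_diagonal hk, coeff_sigmaPoly_diagonal hk]
    exact Finset.sum_le_sum hterm
  refine ⟨hle2.trans hle, fun h2 => ?_⟩
  have hD : (sigmaPoly k (Matrix.diagonal a) (Matrix.diagonal b)).coeff 2 = 0 := by linarith
  have hb := heq hD
  have hoff : ∀ i j, i ≠ j → V i j = 0 := by
    intro i j hij
    have h3 : (sigmaPoly k (Matrix.diagonal a) V).coeff 2 =
      (sigmaPoly k (Matrix.diagonal a) (Matrix.diagonal b)).coeff 2 := by rw [h2, hD]
    rw [coeff_sigmaPoly_diagonal hk, coeff_sigmaPoly_diagonal hk] at h3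
    have h4 := (Finset.sum_eq_sum_iff_of_le hterm).1 h3 {i, j}
      (Finset.mem_powersetCard.2 ⟨Finset.subset_univ _, Finset.card_pair hij⟩)
    rw [det_submatrix_pair _ hij, det_submatrix_pair _ hij, hsym j i] at h4
    simp only [Matrix.diagonal_apply_eq, Matrix.diagonal_apply_ne _ hij, b] at h4
    have hc : ({i, j} : Finset (Fin n))ᶜ.card = n - 2 := by
      rw [Finset.card_compl, Finset.card_pair hij, Fintype.card_fin]
    have h5 := mul_left_cancel₀ (elemSymm_pos (S := ({i, j} : Finset (Fin n))ᶜ)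
      (fun i _ => ha i) (k := k - 2) (by lia)).ne' h4
    nlinarith
  ext i j
  by_cases hij : i = j
  · subst hij; exact congrFun hb i
  · exact hoff i j hij

lemma det_one_add_smul_conj {ι : Type*} [Fintype ι] [DecidableEq ι] {U : Matrix ι ι ℝ}
    (hU : U.transpose * U = 1) (A : Matrix ι ι ℝ) (t : ℝ) :
    Matrix.det (1 + t • (U.transpose * A * U)) = Matrix.det (1 + t • A) := by
  have h : 1 + t • (U.transpose * A * U) = U.transpose * (1 + t • A) * U := by
    rw [mul_add, add_mul, mul_one, hU]; simp
  have hd := congrArg Matrix.det hU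
  rw [Matrix.det_mul, Matrix.det_one] at hd
  rw [h, Matrix.det_mul, Matrix.det_mul]
  linear_combination (1 + t • A).det * hd

lemma sigmaPoly_conj {U : Matrix (Fin n) (Fin n) ℝ} (hU : U.transpose * U = 1) (k : ℕ)
    (A B : Matrix (Fin n) (Fin n) ℝ) :
    sigmaPoly k (U.transpose * A * U) (U.transpose * B * U) = sigmaPoly k A B := by
  refine eq_sigmaPoly fun s => ?_
  rw [eval_sigmaPoly]
  refine sigmaK_congr_of_det (fun t => ?_) k
  rw [← det_one_add_smul_conj hU (A + s • B)]
  congr 3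
  simp [mul_add, add_mul]

/-- The second variation of `σ_k` at a positive definite matrix is negative definite on the kernel
of the first variation. -/
theorem coeff_two_sigmaPoly_posDef {k : ℕ} (hk : 2 ≤ k) (hkn : k ≤ n)
    {W V : Matrix (Fin n) (Fin n) ℝ} (hW : W.PosDef) (hV : V.IsHermitian)
    (h1 : (sigmaPoly k W V).coeff 1 = 0) :
    (sigmaPoly k W V).coeff 2 ≤ 0 ∧ ((sigmaPoly k W V).coeff 2 = 0 → V = 0) := by
  let U : Matrix (Fin n) (Fin n) ℝ := hW.isHermitian.eigenvectorUnitary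
  have hU : U.transpose * U = 1 := by
    have := Unitary.coe_star_mul_self hW.isHermitian.eigenvectorUnitary
    rwa [Matrix.star_eq_conjTranspose, Matrix.conjTranspose_eq_transpose_of_trivial] at this
  have hU' : U * U.transpose = 1 := mul_eq_one_comm.1 hU
  have hWd : U.transpose * W * U = Matrix.diagonal hW.isHermitian.eigenvalues := by
    have h := hW.isHermitian.conjStarAlgAut_star_eigenvectorUnitary
    rw [Unitary.conjStarAlgAut_star_apply, Matrix.star_eq_conjTranspose,
      Matrix.conjTranspose_eq_transpose_of_trivial] at h
    exact h
  have hp := sigmaPoly_conj hU k W V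
  rw [hWd] at hp
  rw [← hp] at h1 ⊢
  have hV' : (U.transpose * V * U).IsHermitian := by
    have := Matrix.isHermitian_conjTranspose_mul_mul U hV
    rwa [Matrix.conjTranspose_eq_transpose_of_trivial] at this
  obtain ⟨h2, h3⟩ := coeff_two_sigmaPoly_diagonal hk hkn hW.eigenvalues_pos hV' h1
  refine ⟨h2, fun h => ?_⟩
  have h4 := h3 h
  calc V = (U * U.transpose) * V * (U * U.transpose) := by rw [hU']; simp
    _ = U * (U.transpose * V * U) * U.transpose := by simp only [Matrix.mul_assoc]
    _ = 0 := by rw [h4]; simp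

end SecondOrder
end Capillary

namespace Capillary

section Jacobi
variable {E ι : Type*} [NormedAddCommGroup E] [NormedSpace ℝ E] [Fintype ι] [DecidableEq ι]

/-- Jacobi's formula for the derivative of a determinant. -/
theorem hasFDerivAt_det {M : E → Matrix ι ι ℝ} {M' : ι → ι → E →L[ℝ] ℝ} {x : E}
    (h : ∀ i j, HasFDerivAt (fun y => M y i j) (M' i j) x) :
    HasFDerivAt (fun y => (M y).det) (∑ i, ∑ j, (M x).adjugate i j • M' j i) x := by
  have h1 : HasFDerivAt (fun y => (M y).det)
      (∑ σ : Equiv.Perm ι, ((σ.sign : ℤ) : ℝ) •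
        ∑ i, (∏ j ∈ Finset.univ.erase i, M x (σ j) j) • M' (σ i) i) x := by
    simp_rw [Matrix.det_apply']
    exact HasFDerivAt.fun_sum fun σ _ =>
      (HasFDerivAt.finsetProd fun i _ => h (σ i) i).const_mul _
  refine h1.congr_fderiv ?_
  ext v
  have h2 : ∀ i, ∑ j, (M x).adjugate i j * M' j i v =
      ((M x).updateCol i (fun j => M' j i v)).det := by
    intro i
    rw [← Matrix.cramer_apply, Matrix.cramer_eq_adjugate_mulVec]
    rfl
  simp only [sum_apply, smul_apply, smul_eq_mul, h2,
    Matrix.det_apply', Finset.mul_sum]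
  rw [Finset.sum_comm]
  refine Finset.sum_congr rfl fun i _ => Finset.sum_congr rfl fun σ _ => ?_
  rw [← Finset.mul_prod_erase Finset.univ _ (Finset.mem_univ i)]
  have h3 : ∏ j ∈ Finset.univ.erase i, (M x).updateCol i (fun j => M' j i v) (σ j) j =
      ∏ j ∈ Finset.univ.erase i, M x (σ j) j :=
    Finset.prod_congr rfl fun j hj => by
      rw [Matrix.updateCol_ne (Finset.ne_of_mem_erase hj)]
  rw [h3, Matrix.updateCol_self]
  ring

lemma contDiffOn_det {M : E → Matrix ι ι ℝ} {s : Set E} {r : WithTop ℕ∞}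
    (h : ∀ i j, ContDiffOn ℝ r (fun y => M y i j) s) :
    ContDiffOn ℝ r (fun y => (M y).det) s := by
  simp_rw [Matrix.det_apply']
  exact ContDiffOn.sum fun σ _ => contDiffOn_const.mul (contDiffOn_prod fun i _ => h (σ i) i)

lemma contDiffOn_adjugate {M : E → Matrix ι ι ℝ} {s : Set E} {r : WithTop ℕ∞}
    (h : ∀ i j, ContDiffOn ℝ r (fun y => M y i j) s) (i j : ι) :
    ContDiffOn ℝ r (fun y => (M y).adjugate i j) s := by
  simp_rw [Matrix.adjugate_apply]
  refine contDiffOn_det fun a b => ?_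
  by_cases ha : a = j
  · subst ha; simp only [Matrix.updateRow_self]; exact contDiffOn_const
  · simp only [Matrix.updateRow_ne ha]; exact h a b

/-- The cofactor matrix of a matrix field with totally symmetric derivative is divergence free. -/
theorem sum_fderiv_adjugate_eq_zero {M : E → Matrix ι ι ℝ} {x : E} (e : ι → E)
    (hd : ∀ i j, DifferentiableAt ℝ (fun y => M y i j) x)
    (hadj : ∀ i j, DifferentiableAt ℝ (fun y => (M y).adjugate i j) x)
    (h1 : ∀ i j k, fderiv ℝ (fun y => M y j k) x (e i) = fderiv ℝ (fun y => M y i k) x (e j))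
    (h2 : ∀ i j k, fderiv ℝ (fun y => M y j k) x (e i) = fderiv ℝ (fun y => M y k j) x (e i))
    (hM : (M x).det ≠ 0) (j : ι) :
    ∑ i, fderiv ℝ (fun y => (M y).adjugate i j) x (e i) = 0 := by
  let w : ι → ℝ := fun a => ∑ i, fderiv ℝ (fun y => (M y).adjugate i a) x (e i)
  suffices hw : Matrix.vecMul w (M x) = 0 from
    congrFun (Matrix.eq_zero_of_vecMul_eq_zero hM hw) j
  have hdet := hasFDerivAt_det (M := M) (x := x) fun i j => (hd i j).hasFDerivAt
  have key : ∀ i b, ∑ a, (fderiv ℝ (fun y => (M y).adjugate i a) x (e i) * M x a b +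
      (M x).adjugate i a * fderiv ℝ (fun y => M y a b) x (e i)) =
      if i = b then fderiv ℝ (fun y => (M y).det) x (e i) else 0 := by
    intro i b
    have hf : (fun y => ∑ a, (M y).adjugate i a * M y a b) =
        fun y => (M y).det * (if i = b then 1 else 0) := by
      funext y
      have := congrFun (congrFun (Matrix.adjugate_mul (M y)) i) b
      rw [Matrix.mul_apply] at this
      rw [this]
      simp [Matrix.one_apply]
    have hL : HasFDerivAt (fun y => ∑ a, (M y).adjugate i a * M y a b)
        (∑ a, ((M x).adjugate i a • fderiv ℝ (fun y => M y a b) x +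
          M x a b • fderiv ℝ (fun y => (M y).adjugate i a) x)) x :=
      HasFDerivAt.fun_sum fun a _ => (hadj i a).hasFDerivAt.mul (hd a b).hasFDerivAt
    rw [hf] at hL
    have hR := hdet.mul_const (if i = b then (1 : ℝ) else 0)
    have h := congrArg (fun L : E →L[ℝ] ℝ => L (e i)) (hL.unique hR)
    simp only [sum_apply, add_apply,
      smul_apply, smul_eq_mul] at h
    rw [hdet.fderiv]
    simp only [sum_apply, smul_apply, smul_eq_mul]
    rw [Finset.sum_congr rfl (fun a _ => by rw [add_comm, mul_comm (fderiv ℝ _ x (e i))]), h]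
    split_ifs <;> simp
  ext b
  simp only [Matrix.vecMul, dotProduct, w, Pi.zero_apply, Finset.sum_mul]
  rw [Finset.sum_comm]
  have h3 := Finset.sum_congr (s₁ := Finset.univ) rfl fun i (_ : i ∈ Finset.univ) => key i b
  rw [Finset.sum_ite_eq' Finset.univ b, if_pos (Finset.mem_univ b), hdet.fderiv] at h3
  simp only [Finset.sum_add_distrib, sum_apply,
    smul_apply, smul_eq_mul] at h3
  have h4 : ∀ i a, fderiv ℝ (fun y => M y a b) x (e i) = fderiv ℝ (fun y => M y a i) x (e b) := by
    intro i a
    rw [h2 i a b, h1 i b a, h2 b i a]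
  simp only [h4] at h3
  linarith

end Jacobi

section Linearization
open Polynomial
variable {n : ℕ}

lemma differentiable_sigmaK (k : ℕ) :
    Differentiable ℝ (fun M : Fin n → Fin n → ℝ => sigmaK k (Matrix.of M)) := by
  unfold sigmaK
  refine Differentiable.fun_sum fun s _ => ?_
  intro M
  refine (hasFDerivAt_det (E := Fin n → Fin n → ℝ)
    (M := fun M : Fin n → Fin n → ℝ => (Matrix.of M).submatrix (fun i : s => (i : Fin n))
      (fun i : s => (i : Fin n)))
    (M' := fun i j => fderiv ℝ (fun N : Fin n → Fin n → ℝ => N i j) M) ?_).differentiableAt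
  intro i j
  exact (show DifferentiableAt ℝ (fun N : Fin n → Fin n → ℝ => N i j) M by fun_prop).hasFDerivAt

lemma deriv_sigmaK_line (k : ℕ) (A B : Fin n → Fin n → ℝ) :
    deriv (fun t : ℝ => sigmaK k (Matrix.of (A + t • B))) 0 =
      fderiv ℝ (fun M : Fin n → Fin n → ℝ => sigmaK k (Matrix.of M)) A B := by
  have h1 : HasDerivAt (fun t : ℝ => A + t • B) B 0 := by
    simpa using ((hasDerivAt_id (0 : ℝ)).smul_const B).const_add A
  have h2 : HasFDerivAt (fun M : Fin n → Fin n → ℝ => sigmaK k (Matrix.of M))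
      (fderiv ℝ (fun M : Fin n → Fin n → ℝ => sigmaK k (Matrix.of M)) A) (A + (0 : ℝ) • B) := by
    rw [zero_smul, add_zero]
    exact (differentiable_sigmaK k A).hasFDerivAt
  exact (h2.comp_hasDerivAt (0 : ℝ) h1).deriv

lemma coeff_one_sigmaPoly (k : ℕ) (A B : Matrix (Fin n) (Fin n) ℝ) :
    (sigmaPoly k A B).coeff 1 = ∑ i, ∑ j, sigmaKPartial k A i j * B i j := by
  let L : Matrix (Fin n) (Fin n) ℝ →ₗ[ℝ] ℝ :=
    (fderiv ℝ (fun M : Fin n → Fin n → ℝ => sigmaK k (Matrix.of M))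
      ((Matrix.ofLinearEquiv ℝ).symm A)).toLinearMap ∘ₗ (Matrix.ofLinearEquiv ℝ).symm.toLinearMap
  have hL : ∀ B : Matrix (Fin n) (Fin n) ℝ,
      deriv (fun t : ℝ => sigmaK k (A + t • B)) 0 = L B := fun B =>
    deriv_sigmaK_line k ((Matrix.ofLinearEquiv ℝ).symm A) ((Matrix.ofLinearEquiv ℝ).symm B)
  have h1 : (sigmaPoly k A B).coeff 1 = deriv (fun t : ℝ => sigmaK k (A + t • B)) 0 := by
    simp_rw [← eval_sigmaPoly]
    rw [Polynomial.deriv, ← coeff_zero_eq_eval_zero, coeff_derivative]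
    simp
  have h2 : ∀ i j, sigmaKPartial k A i j = L (Matrix.single i j 1) := by
    intro i j
    rw [sigmaKPartial, ← hL]
    simp
  rw [h1, hL]
  conv_lhs => rw [Matrix.matrix_eq_sum_single B]
  simp only [map_sum]
  refine Finset.sum_congr rfl fun i _ => Finset.sum_congr rfl fun j _ => ?_
  have := Matrix.smul_single (B i j) i j (1 : ℝ)
  rw [smul_eq_mul, mul_one] at this
  rw [← this, map_smul, h2, smul_eq_mul, mul_comm]

end Linearization
end Capillary

namespace Capillary
open Filter Topology MeasureTheory

section ConeGeometry
variable {n : ℕ} {θ : ℝ}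

/-- The defining function `x_{n+1} - cos θ |x|` of the cone over the translated cap. -/
noncomputable def height {n : ℕ} (θ : ℝ) (x : Amb n) : ℝ := x (Fin.last n) - Real.cos θ * ‖x‖

/-- The open cone over the interior of the translated cap. -/
def openCone (n : ℕ) (θ : ℝ) : Set (Amb n) := {x | 0 < height θ x}

lemma mem_openCone {x : Amb n} : x ∈ openCone n θ ↔ 0 < height θ x := Iff.rfl

/-- The upward unit vector `E_{n+1}`. -/
noncomputable def upVec (n : ℕ) : Amb n := stdVec (Fin.last n)

lemma norm_stdVec (i : Fin (n + 1)) : ‖(stdVec i : Amb n)‖ = 1 := by simp [stdVec]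

lemma norm_upVec : ‖upVec n‖ = 1 := norm_stdVec _

lemma inner_stdVec (x : Amb n) (i : Fin (n + 1)) : inner ℝ x (stdVec i) = x i := by
  simp [stdVec, EuclideanSpace.inner_single_right]

lemma inner_upVec (x : Amb n) : inner ℝ x (upVec n) = x (Fin.last n) := inner_stdVec x _

lemma upVec_apply_last : (upVec n) (Fin.last n) = 1 := by simp [upVec, stdVec]

lemma sum_smul_stdVec (x : Amb n) : ∑ i, x i • (stdVec i : Amb n) = x := by
  ext j
  simp [stdVec, Finset.sum_apply, Pi.single_apply]

lemma downVec_eq : downVec n = -upVec n := rfl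

lemma mem_cone_iff {x : Amb n} : x ∈ cone n θ ↔ x ≠ 0 ∧ 0 ≤ height θ x := by
  refine and_congr_right fun hx => ?_
  have hx0 : 0 < ‖x‖ := norm_pos_iff.2 hx
  have h1 : ‖radialProj θ x - Real.cos θ • downVec n‖ = 1 := by
    rw [radialProj, add_sub_cancel_right, norm_smul, norm_inv, norm_norm]
    exact inv_mul_cancel₀ hx0.ne'
  have h2 : radialProj θ x (Fin.last n) = ‖x‖⁻¹ * height θ x := by
    simp only [radialProj, downVec_eq, height, PiLp.add_apply, PiLp.smul_apply, PiLp.neg_apply,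
      upVec_apply_last, smul_eq_mul]
    field_simp
    ring
  simp only [cap, Set.mem_ofPred_eq, h1, and_true, h2]
  exact mul_nonneg_iff_of_pos_left (by positivity)

lemma continuous_height : Continuous (height θ : Amb n → ℝ) := by
  unfold height; fun_prop

lemma height_zero : height θ (0 : Amb n) = 0 := by simp [height]

lemma isOpen_openCone : IsOpen (openCone n θ) := isOpen_lt continuous_const continuous_height

lemma ne_zero_of_mem_openCone {x : Amb n} (hx : x ∈ openCone n θ) : x ≠ 0 := by
  rintro rfl
  rw [mem_openCone, height_zero] at hx
  exact lt_irrefl _ hx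

lemma openCone_subset_cone : openCone n θ ⊆ cone n θ := fun _ hx =>
  mem_cone_iff.2 ⟨ne_zero_of_mem_openCone hx, le_of_lt hx⟩

lemma cone_mem_nhds {x : Amb n} (hx : x ∈ openCone n θ) : cone n θ ∈ 𝓝 x :=
  mem_of_superset (isOpen_openCone.mem_nhds hx) openCone_subset_cone

lemma height_smul {c : ℝ} (hc : 0 ≤ c) (x : Amb n) : height θ (c • x) = c * height θ x := by
  simp only [height, PiLp.smul_apply, smul_eq_mul, norm_smul, Real.norm_of_nonneg hc]; ring

lemma smul_mem_cone {c : ℝ} (hc : 0 < c) {x : Amb n} (hx : x ∈ cone n θ) : c • x ∈ cone n θ := by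
  rw [mem_cone_iff] at *
  exact ⟨smul_ne_zero hc.ne' hx.1, by rw [height_smul hc.le]; exact mul_nonneg hc.le hx.2⟩

lemma abs_cos_lt_one (h0 : 0 < θ) (hπ : θ < Real.pi) : |Real.cos θ| < 1 := by
  have h := Real.sin_pos_of_pos_of_lt_pi h0 hπ
  rw [← sq_lt_one_iff_abs_lt_one]
  nlinarith [Real.sin_sq_add_cos_sq θ]

lemma height_add_smul_upVec (x : Amb n) {t : ℝ} (ht : 0 ≤ t) :
    height θ x + t * (1 - |Real.cos θ|) ≤ height θ (x + t • upVec n) := by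
  have h1 : |‖x + t • upVec n‖ - ‖x‖| ≤ t := by
    refine (abs_norm_sub_norm_le _ _).trans (le_of_eq ?_)
    rw [add_sub_cancel_left, norm_smul, norm_upVec, mul_one, Real.norm_of_nonneg ht]
  have h2 : |Real.cos θ * (‖x + t • upVec n‖ - ‖x‖)| ≤ |Real.cos θ| * t := by
    rw [abs_mul]; exact mul_le_mul_of_nonneg_left h1 (abs_nonneg _)
  have h3 := (abs_le.1 h2).2
  simp only [height, PiLp.add_apply, PiLp.smul_apply, upVec_apply_last, smul_eq_mul, mul_one]
  linarith

lemma add_smul_upVec_mem_openCone (h0 : 0 < θ) (hπ : θ < Real.pi) {x : Amb n}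
    (hx : 0 ≤ height θ x) {t : ℝ} (ht : 0 < t) : x + t • upVec n ∈ openCone n θ := by
  have := height_add_smul_upVec (θ := θ) x ht.le
  have h1 := mul_pos ht (sub_pos.2 (abs_cos_lt_one h0 hπ))
  rw [mem_openCone]
  linarith

lemma height_lipschitz (x y : Amb n) : |height θ x - height θ y| ≤ 2 * ‖x - y‖ := by
  have h1 : |x (Fin.last n) - y (Fin.last n)| ≤ ‖x - y‖ := PiLp.norm_apply_le (x - y) (Fin.last n)
  have h2 : |Real.cos θ * (‖x‖ - ‖y‖)| ≤ ‖x - y‖ := by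
    rw [abs_mul]
    calc _ ≤ 1 * ‖x - y‖ := mul_le_mul (Real.abs_cos_le_one θ) (abs_norm_sub_norm_le x y)
          (abs_nonneg _) zero_le_one
      _ = _ := one_mul _
  have : height θ x - height θ y = (x (Fin.last n) - y (Fin.last n)) -
      Real.cos θ * (‖x‖ - ‖y‖) := by simp only [height]; ring
  rw [this]
  exact (abs_sub _ _).trans (by linarith)

lemma exists_descent (h0 : 0 < θ) (hπ : θ < Real.pi) {x : Amb n} (hx : 0 ≤ height θ x) :
    ∃ t, 0 ≤ t ∧ t * (1 - |Real.cos θ|) ≤ height θ x ∧ height θ (x - t • upVec n) = 0 := by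
  have hc : 0 < 1 - |Real.cos θ| := sub_pos.2 (abs_cos_lt_one h0 hπ)
  set T := height θ x / (1 - |Real.cos θ|)
  have hT : 0 ≤ T := by positivity
  have hTc : T * (1 - |Real.cos θ|) = height θ x := div_mul_cancel₀ _ hc.ne'
  have hcont : Continuous fun t : ℝ => height θ (x - t • upVec n) :=
    continuous_height.comp (by fun_prop)
  have hend : height θ (x - T • upVec n) ≤ 0 := by
    have := height_add_smul_upVec (θ := θ) (x - T • upVec n) hT
    rw [sub_add_cancel] at this
    linarith
  obtain ⟨t, ⟨ht0, htT⟩, ht⟩ :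
      (0 : ℝ) ∈ (fun t : ℝ => height θ (x - t • upVec n)) '' Set.Icc 0 T :=
    intermediate_value_Icc' hT hcont.continuousOn ⟨hend, by simpa using hx⟩
  exact ⟨t, ht0, by rw [← hTc]; gcongr, ht⟩

lemma mem_closure_interior_cone (h0 : 0 < θ) (hπ : θ < Real.pi) {x : Amb n} (hx : x ∈ cone n θ) :
    x ∈ closure (interior (cone n θ)) := by
  have h1 : Tendsto (fun t : ℝ => x + t • upVec n) (𝓝[>] 0) (𝓝 x) := by
    have : Continuous fun t : ℝ => x + t • upVec n := by fun_prop
    simpa using (this.tendsto 0).mono_left (nhdsWithin_le_nhds (s := Set.Ioi 0))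
  refine mem_closure_of_tendsto h1 ?_
  filter_upwards [self_mem_nhdsWithin] with t ht
  exact interior_maximal openCone_subset_cone isOpen_openCone
    (add_smul_upVec_mem_openCone h0 hπ (mem_cone_iff.1 hx).2 ht)

lemma uniqueDiffOn_cone (h0 : 0 < θ) (hπ : θ < Real.pi) : UniqueDiffOn ℝ (cone n θ) := by
  intro x hx
  set δ := (1 - |Real.cos θ|) / 4
  have hδ : 0 < δ := by have := abs_cos_lt_one h0 hπ; simp only [δ]; linarith
  have hball : Metric.ball (upVec n) δ ⊆ tangentConeAt ℝ (cone n θ) x := by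
    intro d hd
    have hd' : ‖d - upVec n‖ < δ := by simpa [dist_eq_norm] using hd
    have := mem_tangentConeAt_of_openSegment_subset (s := cone n θ) (x := x) (y := x + d) (by
      rintro y hy
      rw [openSegment_eq_image'] at hy
      obtain ⟨t, ⟨ht, -⟩, rfl⟩ := hy
      refine openCone_subset_cone ?_
      rw [mem_openCone]
      simp only [add_sub_cancel_left]
      have h1 := height_add_smul_upVec (θ := θ) x ht.le
      have h2 := height_lipschitz (θ := θ) (x + t • d) (x + t • upVec n)
      rw [add_sub_add_left_eq_sub, ← smul_sub, norm_smul, Real.norm_of_nonneg ht.le] at h2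
      have h3 := (abs_le.1 h2).1
      have h4 := (mem_cone_iff.1 hx).2
      have h5 := mul_lt_mul_of_pos_left hd' ht
      have h6 : t * δ = t * (1 - |Real.cos θ|) / 4 := by simp only [δ]; ring
      have h7 := mul_pos ht hδ
      linarith)
    simpa using this
  refine ⟨?_, subset_closure hx⟩
  have htop : Submodule.span ℝ (tangentConeAt ℝ (cone n θ) x) = ⊤ := by
    refine Submodule.eq_top_of_nonempty_interior' _ ⟨upVec n, ?_⟩
    exact mem_interior_iff_mem_nhds.2 (mem_of_superset (Metric.ball_mem_nhds _ hδ)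
      (hball.trans Submodule.subset_span))
  rw [htop]
  exact dense_univ

lemma hasFDerivAt_norm_of_ne_zero {x : Amb n} (hx : x ≠ 0) :
    HasFDerivAt (fun y : Amb n => ‖y‖) (‖x‖⁻¹ • innerSL ℝ x) x := by
  have h3 := ((hasStrictFDerivAt_norm_sq x).hasFDerivAt).sqrt (by positivity)
  simp only [Real.sqrt_sq (norm_nonneg _)] at h3
  refine h3.congr_fderiv ?_
  ext v
  simp
  field_simp

lemma hasFDerivAt_height {x : Amb n} (hx : x ≠ 0) :
    HasFDerivAt (height θ)
      (innerSL ℝ (upVec n) - (Real.cos θ * ‖x‖⁻¹) • innerSL ℝ x) x := by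
  have h1 : HasFDerivAt (fun y : Amb n => y (Fin.last n)) (innerSL ℝ (upVec n)) x := by
    have : (fun y : Amb n => y (Fin.last n)) = innerSL ℝ (upVec n) := by
      ext y; rw [innerSL_apply_apply, real_inner_comm, inner_upVec]
    rw [this]; exact ContinuousLinearMap.hasFDerivAt _
  refine (h1.sub ((hasFDerivAt_norm_of_ne_zero hx).const_mul (Real.cos θ))).congr_fderiv ?_
  rw [smul_smul]

/-- The gradient of the defining function of the cone. -/
noncomputable def heightGrad {n : ℕ} (θ : ℝ) (x : Amb n) : Amb n :=
  upVec n - (Real.cos θ * ‖x‖⁻¹) • x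

lemma fderiv_height {x : Amb n} (hx : x ≠ 0) (v : Amb n) :
    fderiv ℝ (height θ) x v = inner ℝ (heightGrad θ x) v := by
  rw [(hasFDerivAt_height hx).fderiv, heightGrad, inner_sub_left, inner_smul_left]
  simp

lemma contDiffAt_height {x : Amb n} (hx : x ≠ 0) {r : WithTop ℕ∞} :
    ContDiffAt ℝ r (height θ) x := by
  unfold height
  exact ContDiffAt.sub (by fun_prop) (contDiffAt_const.mul (contDiffAt_norm ℝ hx))

lemma isCompact_cone_inter (r R : ℝ) (hr : 0 < r) :
    IsCompact (cone n θ ∩ {x | r ≤ ‖x‖ ∧ ‖x‖ ≤ R}) := by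
  have h1 : cone n θ ∩ {x | r ≤ ‖x‖ ∧ ‖x‖ ≤ R} =
      Metric.closedBall 0 R ∩ ({x | 0 ≤ height θ x} ∩ {x | r ≤ ‖x‖}) := by
    ext x
    simp only [Set.mem_inter_iff, mem_cone_iff, Set.mem_ofPred_eq, mem_closedBall_zero_iff]
    constructor
    · rintro ⟨⟨-, h⟩, h1, h2⟩; exact ⟨h2, h, h1⟩
    · rintro ⟨h2, h, h1⟩
      exact ⟨⟨fun h0 => by simp [h0] at h1; linarith, h⟩, h1, h2⟩
  rw [h1]
  refine (isCompact_closedBall _ _).inter_right (IsClosed.inter ?_ ?_)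
  · exact isClosed_le continuous_const continuous_height
  · exact isClosed_le continuous_const continuous_norm

end ConeGeometry
end Capillary

namespace Capillary
open Filter Topology MeasureTheory

section Divergence
variable {n : ℕ} {θ : ℝ}

lemma exists_abs_le_mul_height (h0 : 0 < θ) (hπ : θ < Real.pi) {g : Amb n → ℝ} {r R : ℝ}
    (hr : 0 < r) (hg : ContDiffOn ℝ 1 g (cone n θ))
    (hbd : ∀ x ∈ cone n θ, height θ x = 0 → g x = 0) :
    ∃ L, 0 ≤ L ∧ ∀ x ∈ cone n θ, r ≤ ‖x‖ → ‖x‖ ≤ R → |g x| ≤ L * height θ x := by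
  set c := 1 - |Real.cos θ|
  have hc : 0 < c := sub_pos.2 (abs_cos_lt_one h0 hπ)
  have hK := isCompact_cone_inter (n := n) (θ := θ) (r / 2) (R + r) (by positivity)
  obtain ⟨B, hB⟩ := hK.exists_bound_of_continuousOn (hg.continuousOn.mono Set.inter_subset_left)
  obtain ⟨D, hD⟩ := hK.exists_bound_of_continuousOn
    ((hg.continuousOn_fderivWithin (uniqueDiffOn_cone h0 hπ) le_rfl).mono Set.inter_subset_left)
  have hB0 : 0 ≤ max B 0 := le_max_right _ _
  have hD0 : 0 ≤ max D 0 := le_max_right _ _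
  refine ⟨2 * max B 0 / (c * r) + max D 0 / c, by positivity, fun x hx hrx hxR => ?_⟩
  have hx' := mem_cone_iff.1 hx
  have hh := hx'.2
  rcases le_or_gt (c * r / 2) (height θ x) with hbig | hsmall
  · have h1 : |g x| ≤ max B 0 :=
      (hB x ⟨hx, by constructor <;> linarith⟩).trans (le_max_left _ _)
    have h2 : max B 0 ≤ 2 * max B 0 / (c * r) * height θ x := by
      calc max B 0 = 2 * max B 0 / (c * r) * (c * r / 2) := by field_simp
        _ ≤ _ := by gcongr
    have h3 : 0 ≤ max D 0 / c * height θ x := by positivity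
    linarith
  · obtain ⟨t, ht0, htc, ht⟩ := exists_descent h0 hπ hh
    change t * c ≤ _ at htc
    have htr : t < r / 2 := by
      by_contra hcon
      push Not at hcon
      nlinarith
    have hseg : ∀ s ∈ Set.Icc (0 : ℝ) t, x - s • upVec n ∈
        cone n θ ∩ {x | r / 2 ≤ ‖x‖ ∧ ‖x‖ ≤ R + r} := by
      rintro s ⟨hs0, hst⟩
      have h1 := height_add_smul_upVec (θ := θ) (x - t • upVec n) (sub_nonneg.2 hst)
      rw [show x - t • upVec n + (t - s) • upVec n = x - s • upVec n by module, ht] at h1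
      have h2 : 0 ≤ (t - s) * c := mul_nonneg (sub_nonneg.2 hst) hc.le
      have hns : ‖s • upVec n‖ = s := by
        rw [norm_smul, norm_upVec, mul_one, Real.norm_of_nonneg hs0]
      have h3 : r / 2 ≤ ‖x - s • upVec n‖ := by
        have := norm_sub_norm_le x (s • upVec n); linarith
      have h4 : ‖x - s • upVec n‖ ≤ R + r := by
        have := norm_sub_le x (s • upVec n); linarith
      refine ⟨mem_cone_iff.2 ⟨fun h => ?_, by linarith⟩, h3, h4⟩
      rw [h, norm_zero] at h3; linarith
    have hmem : ∀ y ∈ segment ℝ (x - t • upVec n) x,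
        y ∈ cone n θ ∩ {x | r / 2 ≤ ‖x‖ ∧ ‖x‖ ≤ R + r} := by
      intro y hy
      rw [segment_eq_image'] at hy
      obtain ⟨u, ⟨hu0, hu1⟩, rfl⟩ := hy
      have := hseg (t - u * t) ⟨by nlinarith, by nlinarith⟩
      convert this using 1
      module
    have hmv := Convex.norm_image_sub_le_of_norm_hasFDerivWithin_le (𝕜 := ℝ) (f := g)
      (f' := fun y => fderivWithin ℝ g (cone n θ) y)
      (s := segment ℝ (x - t • upVec n) x) (C := max D 0)
      (fun y hy => ((hg.differentiableOn one_ne_zero y (hmem y hy).1).hasFDerivWithinAt).mono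
        fun z hz => (hmem z hz).1)
      (fun y hy => (hD y (hmem y hy)).trans (le_max_left _ _)) (convex_segment _ _)
      (left_mem_segment ℝ _ _) (right_mem_segment ℝ _ _)
    rw [hbd _ (hmem _ (left_mem_segment ℝ _ _)).1 ht, sub_zero, sub_sub_cancel, norm_smul,
      norm_upVec, mul_one, Real.norm_of_nonneg ht0, Real.norm_eq_abs] at hmv
    have h2 : max D 0 * t ≤ max D 0 / c * height θ x := by
      rw [div_mul_eq_mul_div, le_div_iff₀ hc, mul_assoc]
      gcongr
    have h3 : 0 ≤ 2 * max B 0 / (c * r) * height θ x := by positivity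
    linarith

lemma exists_abs_deriv_smoothTransition_le :
    ∃ K, 0 ≤ K ∧ (∀ y, |deriv Real.smoothTransition y| ≤ K) ∧
      ∀ y, y < 0 ∨ 1 < y → deriv Real.smoothTransition y = 0 := by
  have hz : ∀ y, y < 0 ∨ 1 < y → deriv Real.smoothTransition y = 0 := by
    rintro y (hy | hy)
    · have : Real.smoothTransition =ᶠ[𝓝 y] fun _ => 0 := by
        filter_upwards [gt_mem_nhds hy] with z hz
        exact Real.smoothTransition.zero_of_nonpos hz.le
      rw [this.deriv_eq, deriv_const]
    · have : Real.smoothTransition =ᶠ[𝓝 y] fun _ => 1 := by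
        filter_upwards [lt_mem_nhds hy] with z hz
        exact Real.smoothTransition.one_of_one_le hz.le
      rw [this.deriv_eq, deriv_const]
  have hc : Continuous (deriv Real.smoothTransition) :=
    (Real.smoothTransition.contDiff (n := 1)).continuous_deriv le_rfl
  obtain ⟨K, hK⟩ := (isCompact_Icc (a := (0 : ℝ)) (b := 1)).exists_bound_of_continuousOn
    hc.continuousOn
  refine ⟨max K 0, le_max_right _ _, fun y => ?_, hz⟩
  by_cases hy : y ∈ Set.Icc (0 : ℝ) 1
  · exact (hK y hy).trans (le_max_left _ _)
  · rw [hz y, abs_zero]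
    · exact le_max_right _ _
    · rw [Set.mem_Icc, not_and_or, not_le, not_le] at hy; exact hy

lemma integral_fderiv_eq_zero_of_hasCompactSupport {f : Amb n → ℝ} (hf : ContDiff ℝ 1 f)
    (hs : HasCompactSupport f) (v : Amb n) : ∫ x, fderiv ℝ f x v = 0 := by
  have hc : Continuous fun x => fderiv ℝ f x v :=
    (hf.continuous_fderiv one_ne_zero).clm_apply continuous_const
  have hs' : HasCompactSupport fun x => fderiv ℝ f x v := hs.fderiv_apply (𝕜 := ℝ) v
  have h := integral_mul_fderiv_eq_neg_fderiv_mul_of_integrable (μ := volume)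
    (f := fun _ : Amb n => (1 : ℝ)) (g := f) (v := v) (by simp)
    (by simpa using hc.integrable_of_hasCompactSupport hs')
    (by simpa using hf.continuous.integrable_of_hasCompactSupport hs)
    (fun x _ => differentiableAt_const _)
    (fun x _ => hf.differentiable one_ne_zero x)
  simpa using h

/-- The cutoff that vanishes near the complement of the open cone. -/
noncomputable def heightCutoff {n : ℕ} (θ : ℝ) (j : ℕ) (x : Amb n) : ℝ :=
  Real.smoothTransition (j * height θ x - 1)

lemma heightCutoff_eventuallyEq_zero (j : ℕ) {x : Amb n} (hx : height θ x ≤ 0) :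
    heightCutoff θ j =ᶠ[𝓝 x] fun _ => 0 := by
  have hc : Continuous fun y : Amb n => j * height θ y - 1 := by
    have := continuous_height (n := n) (θ := θ); fun_prop
  have h1 : (j : ℝ) * height θ x - 1 < 0 := by
    have := mul_nonpos_of_nonneg_of_nonpos (Nat.cast_nonneg (α := ℝ) j) hx; linarith
  filter_upwards [hc.continuousAt.eventually (gt_mem_nhds h1)] with y hy
  exact Real.smoothTransition.zero_of_nonpos hy.le

lemma contDiffAt_heightCutoff (j : ℕ) {x : Amb n} (hx : x ≠ 0) {r : ℕ∞} :
    ContDiffAt ℝ r (heightCutoff θ j) x := by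
  unfold heightCutoff
  exact Real.smoothTransition.contDiff.contDiffAt.comp x
    ((contDiffAt_const.mul (contDiffAt_height hx)).sub contDiffAt_const)

lemma fderiv_heightCutoff (j : ℕ) {x : Amb n} (hx : x ≠ 0) (v : Amb n) :
    fderiv ℝ (heightCutoff θ j) x v =
      deriv Real.smoothTransition (j * height θ x - 1) * (j * inner ℝ (heightGrad θ x) v) := by
  have h1 : HasFDerivAt (fun y : Amb n => j * height θ y - 1)
      ((j : ℝ) • fderiv ℝ (height θ) x) x :=
    ((contDiffAt_height (r := 1) hx).differentiableAt one_ne_zero).hasFDerivAt.const_mul _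
      |>.sub_const 1
  have h2 : HasDerivAt Real.smoothTransition
      (deriv Real.smoothTransition (j * height θ x - 1)) (j * height θ x - 1) :=
    ((Real.smoothTransition.contDiff (n := 1)).differentiable one_ne_zero _).hasDerivAt
  have h3 := h2.comp_hasFDerivAt x h1
  have h4 : fderiv ℝ (heightCutoff θ j) x = _ := h3.fderiv
  rw [h4]
  simp [fderiv_height hx]

lemma contDiff_heightCutoff_mul (j : ℕ) {f : Amb n → ℝ} (hf : ContDiffOn ℝ 1 f (cone n θ)) :
    ContDiff ℝ 1 fun x => heightCutoff θ j x * f x := by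
  rw [contDiff_iff_contDiffAt]
  intro x
  rcases le_or_gt (height θ x) 0 with hx | hx
  · have h := heightCutoff_eventuallyEq_zero j hx
    have : (fun y => heightCutoff θ j y * f y) =ᶠ[𝓝 x] fun _ => 0 := by
      filter_upwards [h] with y hy; rw [hy, zero_mul]
    exact contDiffAt_const.congr_of_eventuallyEq this
  · have hx' : x ∈ openCone n θ := hx
    exact (contDiffAt_heightCutoff j (ne_zero_of_mem_openCone hx')).mul
      (hf.contDiffAt (cone_mem_nhds hx'))

lemma fderiv_eq_zero_of_support {f : Amb n → ℝ} {r R : ℝ}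
    (hs : ∀ x, f x ≠ 0 → r ≤ ‖x‖ ∧ ‖x‖ ≤ R) {x : Amb n} (hx : ¬ (r ≤ ‖x‖ ∧ ‖x‖ ≤ R)) :
    fderiv ℝ f x = 0 := by
  have hcl : IsClosed {x : Amb n | r ≤ ‖x‖ ∧ ‖x‖ ≤ R} :=
    (isClosed_le continuous_const continuous_norm).inter
      (isClosed_le continuous_norm continuous_const)
  have : f =ᶠ[𝓝 x] fun _ => 0 := by
    filter_upwards [hcl.isOpen_compl.mem_nhds hx] with y hy
    by_contra h
    exact hy (hs y h)
  rw [this.fderiv_eq, fderiv_const_apply]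

/-- The divergence theorem on the cone for compactly supported fields without boundary flux. -/
theorem setIntegral_divergence_eq_zero (h0 : 0 < θ) (hπ : θ < Real.pi)
    {Z : Fin (n + 1) → Amb n → ℝ} {r R : ℝ} (hr : 0 < r)
    (hZ : ∀ i, ContDiffOn ℝ 1 (Z i) (cone n θ))
    (hs : ∀ i x, Z i x ≠ 0 → r ≤ ‖x‖ ∧ ‖x‖ ≤ R)
    (hflux : ∀ x ∈ cone n θ, height θ x = 0 → ∑ i, heightGrad θ x i * Z i x = 0) :
    ∫ x in openCone n θ, ∑ i, fderiv ℝ (Z i) x (stdVec i) = 0 := by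
  set g : Amb n → ℝ := fun x => ∑ i, heightGrad θ x i * Z i x with hgdef
  have hg : ContDiffOn ℝ 1 g (cone n θ) := by
    refine ContDiffOn.sum fun i _ => ContDiffOn.mul ?_ (hZ i)
    have h1 : ContDiffOn ℝ 1 (heightGrad θ) (cone n θ) := fun x hx => by
      refine ContDiffAt.contDiffWithinAt ?_
      have hx0 := (mem_cone_iff.1 hx).1
      unfold heightGrad
      exact contDiffAt_const.sub ((contDiffAt_const.mul
        ((contDiffAt_norm ℝ hx0).inv (norm_ne_zero_iff.2 hx0))).smul contDiffAt_id)
    exact (contDiffOn_euclidean.1 h1) i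
  obtain ⟨L, hL0, hL⟩ := exists_abs_le_mul_height (R := R) h0 hπ hr hg hflux
  obtain ⟨K, hK0, hK, hKz⟩ := exists_abs_deriv_smoothTransition_le
  set A : Set (Amb n) := {x | r ≤ ‖x‖ ∧ ‖x‖ ≤ R}
  have hgA : ∀ x, x ∉ A → g x = 0 := fun x hx => by
    refine Finset.sum_eq_zero fun i _ => ?_
    by_contra h
    exact hx (hs i x (right_ne_zero_of_mul h))
  set dv : Amb n → ℝ := fun x => ∑ i, fderiv ℝ (Z i) x (stdVec i) with hdv
  have hdvA : ∀ x, x ∉ A → dv x = 0 := fun x hx => by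
    refine Finset.sum_eq_zero fun i _ => ?_
    rw [fderiv_eq_zero_of_support (hs i) hx]; rfl
  obtain ⟨B, hB⟩ : ∃ B, ∀ x ∈ openCone n θ ∩ A, |dv x| ≤ B := by
    have hcont : ContinuousOn (fun x => ∑ i, fderivWithin ℝ (Z i) (cone n θ) x (stdVec i))
        (cone n θ) := by
      refine continuousOn_finsetSum _ fun i _ => ?_
      exact ((hZ i).continuousOn_fderivWithin (uniqueDiffOn_cone h0 hπ) le_rfl).clm_apply
        continuousOn_const
    obtain ⟨B, hB⟩ := (isCompact_cone_inter (n := n) (θ := θ) r R hr).exists_bound_of_continuousOn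
      (hcont.mono Set.inter_subset_left)
    refine ⟨B, fun x hx => ?_⟩
    have h1 := hB x ⟨openCone_subset_cone hx.1, hx.2⟩
    simp only [fderivWithin_of_mem_nhds (cone_mem_nhds hx.1)] at h1
    exact h1
  set F : ℕ → Amb n → ℝ := fun j => (openCone n θ).indicator fun x =>
    heightCutoff θ j x * dv x + deriv Real.smoothTransition (j * height θ x - 1) * (j * g x)
  have hF : ∀ j x, F j x = ∑ i, fderiv ℝ (fun y => heightCutoff θ j y * Z i y) x (stdVec i) := by
    intro j x
    by_cases hx : x ∈ openCone n θ
    · have hx0 := ne_zero_of_mem_openCone hx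
      have h1 : ∀ i, fderiv ℝ (fun y => heightCutoff θ j y * Z i y) x (stdVec i) =
          heightCutoff θ j x * fderiv ℝ (Z i) x (stdVec i) +
          deriv Real.smoothTransition (j * height θ x - 1) * (j * (heightGrad θ x i * Z i x)) := by
        intro i
        rw [fderiv_fun_mul ((contDiffAt_heightCutoff (r := 1) j hx0).differentiableAt one_ne_zero)
          (((hZ i).contDiffAt (cone_mem_nhds hx)).differentiableAt one_ne_zero)]
        simp only [add_apply, smul_apply, smul_eq_mul, fderiv_heightCutoff j hx0, inner_stdVec]
        ring
      simp only [F, Set.indicator_of_mem hx, h1, Finset.sum_add_distrib, ← Finset.mul_sum, hdv,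
        hgdef]
    · have h := heightCutoff_eventuallyEq_zero (θ := θ) j (x := x) (not_lt.1 hx)
      have h1 : ∀ i, fderiv ℝ (fun y => heightCutoff θ j y * Z i y) x (stdVec i) = 0 := by
        intro i
        have : (fun y => heightCutoff θ j y * Z i y) =ᶠ[𝓝 x] fun _ => 0 := by
          filter_upwards [h] with y hy; rw [hy, zero_mul]
        rw [this.fderiv_eq, fderiv_const_apply]; rfl
      simp only [F, Set.indicator_of_notMem hx, h1, Finset.sum_const_zero]
  have hcd : ∀ j i, ContDiff ℝ 1 fun x => heightCutoff θ j x * Z i x := fun j i =>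
    contDiff_heightCutoff_mul j (hZ i)
  have hcs : ∀ j i, HasCompactSupport fun x => heightCutoff θ j x * Z i x := fun j i =>
    HasCompactSupport.intro (isCompact_closedBall (0 : Amb n) R) fun x hx => by
      by_contra h
      exact hx (mem_closedBall_zero_iff.2 (hs i x (right_ne_zero_of_mul h)).2)
  have hdc : ∀ j i, Continuous fun x =>
      fderiv ℝ (fun y => heightCutoff θ j y * Z i y) x (stdVec i) := fun j i =>
    ((hcd j i).continuous_fderiv one_ne_zero).clm_apply continuous_const
  have hFint : ∀ j, ∫ x, F j x = 0 := by
    intro j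
    simp_rw [hF j]
    rw [integral_finsetSum]
    · exact Finset.sum_eq_zero fun i _ =>
        integral_fderiv_eq_zero_of_hasCompactSupport (hcd j i) (hcs j i) _
    · exact fun i _ => (hdc j i).integrable_of_hasCompactSupport
        ((hcs j i).fderiv_apply (𝕜 := ℝ) _)
  have hlim : Tendsto (fun j => ∫ x, F j x) atTop
      (𝓝 (∫ x, (openCone n θ).indicator dv x)) := by
    refine tendsto_integral_of_dominated_convergence
      ((Metric.closedBall (0 : Amb n) R).indicator fun _ => |B| + 2 * K * L) ?_ ?_ ?_ ?_
    · intro j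
      have : F j = fun x => ∑ i, fderiv ℝ (fun y => heightCutoff θ j y * Z i y) x (stdVec i) :=
        funext (hF j)
      rw [this]
      exact (continuous_finsetSum _ fun i _ => hdc j i).aestronglyMeasurable
    · exact (integrable_indicator_iff Metric.isClosed_closedBall.measurableSet).2
        (integrableOn_const (isCompact_closedBall _ _).measure_lt_top.ne)
    · refine fun j => Eventually.of_forall fun x => ?_
      by_cases hxA : x ∈ A
      · rw [Set.indicator_of_mem (mem_closedBall_zero_iff.2 hxA.2)]
        by_cases hx : x ∈ openCone n θ
        · simp only [F, Set.indicator_of_mem hx]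
          have h1 : |heightCutoff θ j x * dv x| ≤ |B| := by
            rw [abs_mul, heightCutoff, abs_of_nonneg (Real.smoothTransition.nonneg _)]
            calc _ ≤ 1 * |dv x| := mul_le_mul_of_nonneg_right
                  (Real.smoothTransition.le_one _) (abs_nonneg _)
              _ ≤ |B| := by rw [one_mul]; exact (hB x ⟨hx, hxA⟩).trans (le_abs_self B)
          have h2 : |deriv Real.smoothTransition (j * height θ x - 1) * (j * g x)| ≤
              2 * K * L := by
            by_cases hj : 1 < j * height θ x - 1
            · rw [hKz _ (Or.inr hj), zero_mul, abs_zero]; positivity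
            · rw [abs_mul, abs_mul, Nat.abs_cast]
              have h3 := hL x (openCone_subset_cone hx) hxA.1 hxA.2
              have h4 : (j : ℝ) * |g x| ≤ 2 * L := by
                calc (j : ℝ) * |g x| ≤ j * (L * height θ x) :=
                      mul_le_mul_of_nonneg_left h3 (Nat.cast_nonneg j)
                  _ = L * (j * height θ x) := by ring
                  _ ≤ L * 2 := mul_le_mul_of_nonneg_left (by linarith) hL0
                  _ = _ := by ring
              calc _ ≤ K * (2 * L) := mul_le_mul (hK _) h4 (by positivity) hK0
                _ = _ := by ring
          exact (abs_add_le _ _).trans (add_le_add h1 h2)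
        · simp only [F, Set.indicator_of_notMem hx, norm_zero]; positivity
      · have : F j x = 0 := by
          by_cases hx : x ∈ openCone n θ
          · simp only [F, Set.indicator_of_mem hx, hgA x hxA, hdvA x hxA, mul_zero, add_zero]
          · simp only [F, Set.indicator_of_notMem hx]
        rw [this, norm_zero]
        exact Set.indicator_nonneg (fun _ _ => by positivity) _
    · refine Eventually.of_forall fun x => ?_
      by_cases hx : x ∈ openCone n θ
      · refine tendsto_const_nhds.congr' ?_
        have hpos : 0 < height θ x := hx
        obtain ⟨N, hN⟩ := exists_nat_gt (2 / height θ x)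
        filter_upwards [eventually_ge_atTop N] with j hj
        have h1 : 1 < j * height θ x - 1 := by
          have h2 : 2 / height θ x < j := hN.trans_le (Nat.cast_le.2 hj)
          rw [div_lt_iff₀ hpos] at h2
          linarith
        simp only [F, Set.indicator_of_mem hx, hKz _ (Or.inr h1), zero_mul, add_zero, heightCutoff,
          Real.smoothTransition.one_of_one_le h1.le, one_mul]
      · simp only [F, Set.indicator_of_notMem hx]
        exact tendsto_const_nhds
  rw [← integral_indicator isOpen_openCone.measurableSet]
  exact tendsto_nhds_unique hlim (by simp only [hFint]; exact tendsto_const_nhds)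

end Divergence
end Capillary

namespace Capillary
open Filter Topology

section Flat
variable {n : ℕ} {θ : ℝ}

/-- The derivative, up to the boundary, of a function on the cone. -/
noncomputable def coneDeriv {n : ℕ} (θ : ℝ) (f : Amb n → ℝ) (x : Amb n) : Amb n →L[ℝ] ℝ :=
  fderivWithin ℝ f (cone n θ) x

/-- The second derivative, up to the boundary, of a function on the cone. -/
noncomputable def coneHess {n : ℕ} (θ : ℝ) (f : Amb n → ℝ) (x : Amb n) :
    Amb n →L[ℝ] Amb n →L[ℝ] ℝ :=
  fderivWithin ℝ (coneDeriv θ f) (cone n θ) x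

/-- `C⁴` functions on the cone that are homogeneous of degree one and whose gradient is tangent to
the horizontal hyperplane along the boundary: the homogeneous extensions of functions on the cap
satisfying the Robin condition. -/
structure IsCapillaryHomogeneous {n : ℕ} (θ : ℝ) (f : Amb n → ℝ) : Prop where
  contDiffOn : ContDiffOn ℝ 4 f (cone n θ)
  hom_smul : ∀ x ∈ cone n θ, ∀ c : ℝ, 0 < c → f (c • x) = c * f x
  bdry : ∀ x ∈ cone n θ, height θ x = 0 → coneDeriv θ f x (upVec n) = 0

lemma hasDerivAt_smul_const_one (x : Amb n) : HasDerivAt (fun c : ℝ => c • x) x 1 := by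
  simpa using (hasDerivAt_id (1 : ℝ)).smul_const x

lemma hasDerivAt_comp_curve {F : Type*} [NormedAddCommGroup F] [NormedSpace ℝ F] {g : Amb n → F}
    {g' : Amb n →L[ℝ] F} {S : Set (Amb n)} {γ : ℝ → Amb n} {v x : Amb n} {s : ℝ} (hγs : γ s = x)
    (hg : HasFDerivWithinAt g g' S x) (hγ : HasDerivAt γ v s) (hS : ∀ᶠ r in 𝓝 s, γ r ∈ S) :
    HasDerivAt (fun r => g (γ r)) (g' v) s := by
  subst hγs
  exact (HasFDerivWithinAt.comp_hasDerivWithinAt (s := γ ⁻¹' S) s hg hγ.hasDerivWithinAt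
    (Set.mapsTo_preimage γ S)).hasDerivAt hS

namespace IsCapillaryHomogeneous

variable {f : Amb n → ℝ} (hf : IsCapillaryHomogeneous θ f) (h0 : 0 < θ) (hπ : θ < Real.pi)
include hf h0 hπ

lemma contDiffOn_deriv : ContDiffOn ℝ 3 (coneDeriv θ f) (cone n θ) :=
  hf.contDiffOn.fderivWithin (uniqueDiffOn_cone h0 hπ) (by norm_num)

lemma contDiffOn_hess : ContDiffOn ℝ 2 (coneHess θ f) (cone n θ) :=
  (hf.contDiffOn_deriv h0 hπ).fderivWithin (uniqueDiffOn_cone h0 hπ) (by norm_num)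

omit h0 hπ in
lemma hasFDerivWithinAt {x : Amb n} (hx : x ∈ cone n θ) :
    HasFDerivWithinAt f (coneDeriv θ f x) (cone n θ) x :=
  (hf.contDiffOn.differentiableOn (by norm_num) x hx).hasFDerivWithinAt

lemma hasFDerivWithinAt_deriv {x : Amb n} (hx : x ∈ cone n θ) :
    HasFDerivWithinAt (coneDeriv θ f) (coneHess θ f x) (cone n θ) x :=
  ((hf.contDiffOn_deriv h0 hπ).differentiableOn (by norm_num) x hx).hasFDerivWithinAt

lemma deriv_smul {x : Amb n} (hx : x ∈ cone n θ) {c : ℝ} (hc : 0 < c) :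
    coneDeriv θ f (c • x) = coneDeriv θ f x := by
  have h1 : HasFDerivWithinAt (fun y : Amb n => c • y) (c • ContinuousLinearMap.id ℝ (Amb n))
      (cone n θ) x := ((hasFDerivAt_id x).const_smul c).hasFDerivWithinAt
  have h2 := (hf.hasFDerivWithinAt (smul_mem_cone hc hx)).comp x h1
    (fun y hy => smul_mem_cone hc hy)
  have h3 := ((hf.hasFDerivWithinAt hx).const_mul c).congr
    (f₁ := f ∘ fun y : Amb n => c • y) (fun y hy => hf.hom_smul y hy c hc) (hf.hom_smul x hx c hc)
  have h4 := (uniqueDiffOn_cone h0 hπ x hx).eq h2 h3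
  ext v
  have h5 := congrArg (fun L : Amb n →L[ℝ] ℝ => L v) h4
  simp at h5
  rcases h5 with h5 | h5
  · exact h5
  · exact absurd h5 hc.ne'

lemma hess_smul {x : Amb n} (hx : x ∈ cone n θ) {c : ℝ} (hc : 0 < c) :
    c • coneHess θ f (c • x) = coneHess θ f x := by
  have h1 : HasFDerivWithinAt (fun y : Amb n => c • y) (c • ContinuousLinearMap.id ℝ (Amb n))
      (cone n θ) x := ((hasFDerivAt_id x).const_smul c).hasFDerivWithinAt
  have h2 := (hf.hasFDerivWithinAt_deriv h0 hπ (smul_mem_cone hc hx)).comp x h1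
    (fun y hy => smul_mem_cone hc hy)
  have h3 := (hf.hasFDerivWithinAt_deriv h0 hπ hx).congr
    (f₁ := coneDeriv θ f ∘ fun y : Amb n => c • y) (fun y hy => hf.deriv_smul h0 hπ hy hc)
    (hf.deriv_smul h0 hπ hx hc)
  rw [← (uniqueDiffOn_cone h0 hπ x hx).eq h2 h3]
  ext v w
  simp

omit h0 hπ in
lemma deriv_self {x : Amb n} (hx : x ∈ cone n θ) : coneDeriv θ f x x = f x := by
  have h3 := hasDerivAt_comp_curve (one_smul ℝ x) (hf.hasFDerivWithinAt hx)
    (hasDerivAt_smul_const_one x)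
    (eventually_of_mem (Ioi_mem_nhds one_pos) fun c hc => smul_mem_cone hc hx)
  have h4 : HasDerivAt (fun c : ℝ => c * f x) (f x) 1 := by
    simpa using (hasDerivAt_id (1 : ℝ)).mul_const (f x)
  refine h3.unique (h4.congr_of_eventuallyEq ?_)
  filter_upwards [Ioi_mem_nhds one_pos] with c hc
  exact hf.hom_smul x hx c hc

lemma hess_self {x : Amb n} (hx : x ∈ cone n θ) : coneHess θ f x x = 0 := by
  have h3 := hasDerivAt_comp_curve (one_smul ℝ x) (hf.hasFDerivWithinAt_deriv h0 hπ hx)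
    (hasDerivAt_smul_const_one x)
    (eventually_of_mem (Ioi_mem_nhds one_pos) fun c hc => smul_mem_cone hc hx)
  refine h3.unique ((hasDerivAt_const (1 : ℝ) (coneDeriv θ f x)).congr_of_eventuallyEq ?_)
  filter_upwards [Ioi_mem_nhds one_pos] with c hc
  exact hf.deriv_smul h0 hπ hx hc

lemma hess_symm {x : Amb n} (hx : x ∈ cone n θ) (v w : Amb n) :
    coneHess θ f x v w = coneHess θ f x w v :=
  (hf.contDiffOn x hx).isSymmSndFDerivWithinAt (by simp; norm_num)
    (uniqueDiffOn_cone h0 hπ) (mem_closure_interior_cone h0 hπ hx) hx v w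

lemma hess_right_self {x : Amb n} (hx : x ∈ cone n θ) (v : Amb n) : coneHess θ f x v x = 0 := by
  rw [hf.hess_symm h0 hπ hx, hf.hess_self h0 hπ hx]; rfl

end IsCapillaryHomogeneous

/-- The point of the boundary of the cone above the horizontal vector `y`. -/
noncomputable def bdryLift {n : ℕ} (θ : ℝ) (y : Amb n) : Amb n :=
  y + (Real.cot θ * ‖y‖) • upVec n

/-- The horizontal part of a vector. -/
noncomputable def horiz {n : ℕ} (x : Amb n) : Amb n := x - x (Fin.last n) • upVec n

lemma horiz_last (x : Amb n) : horiz x (Fin.last n) = 0 := by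
  simp [horiz, upVec_apply_last]

lemma norm_bdryLift (h0 : 0 < θ) (hπ : θ < Real.pi) {y : Amb n} (hy : y (Fin.last n) = 0) :
    ‖bdryLift θ y‖ = ‖y‖ / Real.sin θ := by
  have hs := Real.sin_pos_of_pos_of_lt_pi h0 hπ
  have h1 : ‖bdryLift θ y‖ ^ 2 = (‖y‖ / Real.sin θ) ^ 2 := by
    rw [bdryLift, norm_add_sq_real, inner_smul_right, inner_upVec, hy, norm_smul, norm_upVec,
      Real.cot_eq_cos_div_sin, Real.norm_eq_abs, mul_one, sq_abs]
    field_simp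
    linear_combination ‖y‖ ^ 2 * Real.sin_sq_add_cos_sq θ
  exact (sq_eq_sq₀ (norm_nonneg _) (by positivity)).1 h1

lemma bdryLift_last {y : Amb n} (hy : y (Fin.last n) = 0) :
    bdryLift θ y (Fin.last n) = Real.cot θ * ‖y‖ := by
  simp [bdryLift, hy, upVec_apply_last]

lemma height_bdryLift (h0 : 0 < θ) (hπ : θ < Real.pi) {y : Amb n} (hy : y (Fin.last n) = 0) :
    height θ (bdryLift θ y) = 0 := by
  rw [height, norm_bdryLift h0 hπ hy, bdryLift_last hy, Real.cot_eq_cos_div_sin]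
  ring

lemma bdryLift_mem_cone (h0 : 0 < θ) (hπ : θ < Real.pi) {y : Amb n} (hy : y (Fin.last n) = 0)
    (hy0 : y ≠ 0) : bdryLift θ y ∈ cone n θ := by
  refine mem_cone_iff.2 ⟨fun h => ?_, (height_bdryLift h0 hπ hy).ge⟩
  have h1 := norm_bdryLift h0 hπ hy
  rw [h, norm_zero, eq_comm, div_eq_zero_iff] at h1
  exact h1.elim (fun h => hy0 (norm_eq_zero.1 h))
    (Real.sin_pos_of_pos_of_lt_pi h0 hπ).ne'

lemma norm_horiz_of_height_eq_zero (h0 : 0 < θ) (hπ : θ < Real.pi) {x : Amb n}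
    (hx : height θ x = 0) : ‖horiz x‖ = Real.sin θ * ‖x‖ := by
  have hs := Real.sin_pos_of_pos_of_lt_pi h0 hπ
  have hl : x (Fin.last n) = Real.cos θ * ‖x‖ := by rw [height] at hx; linarith
  have h1 : ‖horiz x‖ ^ 2 = (Real.sin θ * ‖x‖) ^ 2 := by
    rw [horiz, norm_sub_sq_real, inner_smul_right, inner_upVec, norm_smul, norm_upVec,
      Real.norm_eq_abs, mul_one, sq_abs, hl]
    linear_combination -‖x‖ ^ 2 * Real.sin_sq_add_cos_sq θ
  exact (sq_eq_sq₀ (norm_nonneg _) (by positivity)).1 h1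

lemma bdryLift_horiz (h0 : 0 < θ) (hπ : θ < Real.pi) {x : Amb n} (hx : height θ x = 0) :
    bdryLift θ (horiz x) = x := by
  have hs := Real.sin_pos_of_pos_of_lt_pi h0 hπ
  have hl : x (Fin.last n) = Real.cos θ * ‖x‖ := by rw [height] at hx; linarith
  rw [bdryLift, norm_horiz_of_height_eq_zero h0 hπ hx, Real.cot_eq_cos_div_sin,
    show Real.cos θ / Real.sin θ * (Real.sin θ * ‖x‖) = x (Fin.last n) by rw [hl]; field_simp,
    horiz, sub_add_cancel]

/-- The velocity of `bdryLift` at `y` in the direction `w`. -/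
noncomputable def bdryVel {n : ℕ} (θ : ℝ) (y w : Amb n) : Amb n :=
  w + (Real.cot θ * (inner ℝ y w / ‖y‖)) • upVec n

lemma hasDerivAt_bdryLift (y w : Amb n) (s : ℝ) (hy : y + s • w ≠ 0) :
    HasDerivAt (fun r : ℝ => bdryLift θ (y + r • w)) (bdryVel θ (y + s • w) w) s := by
  have h1 : HasDerivAt (fun r : ℝ => y + r • w) w s := by
    simpa using ((hasDerivAt_id s).smul_const w).const_add y
  have h2 : HasDerivAt (fun r : ℝ => ‖y + r • w‖) (inner ℝ (y + s • w) w / ‖y + s • w‖) s := by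
    have h3 := h1.norm_sq.sqrt (by positivity)
    simp only [Real.sqrt_sq (norm_nonneg _)] at h3
    convert h3 using 1
    field_simp
  exact h1.add ((h2.const_mul _).smul_const _)

namespace IsCapillaryHomogeneous

variable {f : Amb n → ℝ} (hf : IsCapillaryHomogeneous θ f) (h0 : 0 < θ) (hπ : θ < Real.pi)
include hf h0 hπ

lemma hess_bdryVel {y w : Amb n} (hy : y (Fin.last n) = 0) (hw : w (Fin.last n) = 0) (hy0 : y ≠ 0) :
    coneHess θ f (bdryLift θ y) (bdryVel θ y w) (upVec n) = 0 := by
  have hev : ∀ᶠ s in 𝓝 (0 : ℝ), y + s • w ≠ 0 := by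
    have : ContinuousAt (fun s : ℝ => y + s • w) 0 := by fun_prop
    exact this.eventually_ne (by simpa using hy0)
  have hl : ∀ s : ℝ, (y + s • w) (Fin.last n) = 0 := fun s => by simp [hy, hw]
  have h1 := hasDerivAt_bdryLift (θ := θ) y w 0 (by simpa using hy0)
  rw [zero_smul, add_zero] at h1
  have h3 := hasDerivAt_comp_curve (by rw [zero_smul, add_zero])
    (hf.hasFDerivWithinAt_deriv h0 hπ (bdryLift_mem_cone h0 hπ hy hy0)) h1
    (hev.mono fun s hs => bdryLift_mem_cone h0 hπ (hl s) hs)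
  have h4 := h3.clm_apply (hasDerivAt_const (0 : ℝ) (upVec n))
  simp only [map_zero, add_zero] at h4
  refine h4.unique ((hasDerivAt_const (0 : ℝ) (0 : ℝ)).congr_of_eventuallyEq ?_)
  filter_upwards [hev] with s hs
  exact hf.bdry _ (bdryLift_mem_cone h0 hπ (hl s) hs) (height_bdryLift h0 hπ (hl s))

lemma hess_tangent_upVec {x : Amb n} (hx : x ∈ cone n θ) (hh : height θ x = 0) {w : Amb n}
    (hw : inner ℝ (heightGrad θ x) w = 0) : coneHess θ f x w (upVec n) = 0 := by
  have hs := Real.sin_pos_of_pos_of_lt_pi h0 hπ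
  have hx0 : 0 < ‖x‖ := norm_pos_iff.2 (mem_cone_iff.1 hx).1
  have hl : x (Fin.last n) = Real.cos θ * ‖x‖ := by rw [height] at hh; linarith
  have hn := norm_horiz_of_height_eq_zero h0 hπ hh
  have hne : horiz x ≠ 0 := norm_pos_iff.1 (by rw [hn]; positivity)
  have h1 : inner ℝ (horiz x) (horiz w) = inner ℝ x w - x (Fin.last n) * w (Fin.last n) := by
    simp only [horiz, inner_sub_left, inner_sub_right, inner_smul_left, inner_smul_right,
      inner_upVec, real_inner_comm w (upVec n), conj_trivial, upVec_apply_last]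
    ring
  have h2 : w (Fin.last n) = Real.cos θ * ‖x‖⁻¹ * inner ℝ x w := by
    rw [heightGrad, inner_sub_left, inner_smul_left, real_inner_comm, inner_upVec] at hw
    simp only [conj_trivial] at hw
    linarith
  have h3 : bdryVel θ (horiz x) (horiz w) = w := by
    have h4 : Real.cot θ * (inner ℝ (horiz x) (horiz w) / ‖horiz x‖) = w (Fin.last n) := by
      rw [h1, hn, hl, Real.cot_eq_cos_div_sin]
      have h5 : inner ℝ x w = inner ℝ x w * (Real.sin θ ^ 2 + Real.cos θ ^ 2) := by
        rw [Real.sin_sq_add_cos_sq, mul_one]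
      rw [h2]
      field_simp
      linear_combination Real.cos θ * h5
    rw [bdryVel, h4, horiz, sub_add_cancel]
  have := hf.hess_bdryVel h0 hπ (horiz_last x) (horiz_last w) hne
  rwa [h3, bdryLift_horiz h0 hπ hh] at this

lemma hess_heightGrad {x : Amb n} (hx : x ∈ cone n θ) (hh : height θ x = 0) :
    ∃ l : ℝ, ∀ w, coneHess θ f x w (heightGrad θ x) = l * inner ℝ (heightGrad θ x) w := by
  have key : ∀ w, inner ℝ (heightGrad θ x) w = 0 → coneHess θ f x w (heightGrad θ x) = 0 := by
    intro w hw
    conv_lhs => rw [heightGrad]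
    rw [map_sub, map_smul, hf.hess_right_self h0 hπ hx, hf.hess_tangent_upVec h0 hπ hx hh hw]
    simp
  set N := heightGrad θ x
  by_cases hN : inner ℝ N N = (0 : ℝ)
  · have : N = 0 := inner_self_eq_zero.1 hN
    exact ⟨0, fun w => by rw [this]; simp⟩
  · refine ⟨coneHess θ f x N N / inner ℝ N N, fun w => ?_⟩
    have h1 := key (w - (inner ℝ N w / inner ℝ N N) • N) (by
      rw [inner_sub_right, inner_smul_right]; field_simp; ring)
    rw [map_sub, map_smul, sub_apply, smul_apply, smul_eq_mul] at h1
    linear_combination h1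

omit h0 hπ in
lemma deriv_heightGrad {x : Amb n} (hx : x ∈ cone n θ) (hh : height θ x = 0) :
    coneDeriv θ f x (heightGrad θ x) = -(Real.cos θ * ‖x‖⁻¹) * f x := by
  rw [heightGrad, map_sub, map_smul, hf.bdry x hx hh, hf.deriv_self hx, smul_eq_mul]; ring

end IsCapillaryHomogeneous
end Flat
end Capillary

namespace Capillary
open Filter Topology

section Positivity
variable {n : ℕ} {θ : ℝ}

/-- The second derivative is positive definite on the orthogonal complement of the ray. -/
def HessPos {n : ℕ} (θ : ℝ) (f : Amb n → ℝ) : Prop :=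
  ∀ x ∈ cone n θ, ∀ X : Amb n, inner ℝ X x = 0 → X ≠ 0 → 0 < coneHess θ f x X X

lemma upVec_mem_openCone (h0 : 0 < θ) (hπ : θ < Real.pi) : upVec n ∈ openCone n θ := by
  have := add_smul_upVec_mem_openCone (n := n) h0 hπ (x := 0) (height_zero).ge one_pos
  simpa using this

namespace IsCapillaryHomogeneous

variable {f : Amb n → ℝ} (hf : IsCapillaryHomogeneous θ f) (h0 : 0 < θ) (hπ : θ < Real.pi)
include hf h0 hπ

lemma hess_pos (hpos : HessPos θ f) {x : Amb n} (hx : x ∈ cone n θ) {X : Amb n}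
    (hX : ∀ a : ℝ, X ≠ a • x) : 0 < coneHess θ f x X X := by
  have hx0 : inner ℝ x x ≠ (0 : ℝ) := fun h => (mem_cone_iff.1 hx).1 (inner_self_eq_zero.1 h)
  set a : ℝ := inner ℝ X x / inner ℝ x x
  have h1 := hpos x hx (X - a • x) (by
    rw [inner_sub_left, inner_smul_left]; simp only [a, conj_trivial]; field_simp; ring)
    (sub_ne_zero.2 (hX a))
  simpa [hf.hess_right_self h0 hπ hx, hf.hess_self h0 hπ hx] using h1

lemma hess_nonneg (hpos : HessPos θ f) {x : Amb n} (hx : x ∈ cone n θ) (X : Amb n) :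
    0 ≤ coneHess θ f x X X := by
  by_cases hX : ∃ a : ℝ, X = a • x
  · obtain ⟨a, rfl⟩ := hX
    simp [hf.hess_self h0 hπ hx]
  · push Not at hX
    exact (hf.hess_pos h0 hπ hpos hx hX).le

lemma coneDeriv_sub_inner (p : Amb n) {x : Amb n} (hx : x ∈ cone n θ) :
    coneDeriv θ (fun y => f y - inner ℝ p y) x = coneDeriv θ f x - innerSL ℝ p :=
  ((hf.hasFDerivWithinAt hx).sub (innerSL ℝ p).hasFDerivWithinAt).fderivWithin
    (uniqueDiffOn_cone h0 hπ x hx)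

lemma coneHess_sub_inner (p : Amb n) {x : Amb n} (hx : x ∈ cone n θ) :
    coneHess θ (fun y => f y - inner ℝ p y) x = coneHess θ f x := by
  have h1 := ((hf.hasFDerivWithinAt_deriv h0 hπ hx).sub_const (innerSL ℝ p)).congr
    (f₁ := coneDeriv θ (fun y => f y - inner ℝ p y))
    (fun y hy => hf.coneDeriv_sub_inner h0 hπ p hy) (hf.coneDeriv_sub_inner h0 hπ p hx)
  exact h1.fderivWithin (uniqueDiffOn_cone h0 hπ x hx)

lemma sub_inner {p : Amb n} (hp : p (Fin.last n) = 0) :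
    IsCapillaryHomogeneous θ (fun y => f y - inner ℝ p y) where
  contDiffOn := hf.contDiffOn.sub (contDiff_const.inner ℝ contDiff_id).contDiffOn
  hom_smul x hx c hc := by
    rw [hf.hom_smul x hx c hc, inner_smul_right]; ring
  bdry x hx hh := by
    rw [hf.coneDeriv_sub_inner h0 hπ p hx, sub_apply, hf.bdry x hx hh, innerSL_apply_apply,
      inner_upVec, hp, sub_zero]

lemma hessPos_sub_inner (hpos : HessPos θ f) (p : Amb n) :
    HessPos θ (fun y => f y - inner ℝ p y) := fun x hx X h1 h2 => by
  rw [hf.coneHess_sub_inner h0 hπ p hx]; exact hpos x hx X h1 h2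

lemma pos_bdryLift_add (hpos : HessPos θ f) {y w : Amb n} (hy : y (Fin.last n) = 0)
    (hw : w (Fin.last n) = 0) (hind : ∀ a b : ℝ, a • y + b • w = 0 → a = 0 ∧ b = 0)
    (hzero : f (bdryLift θ y) = 0) (hD : coneDeriv θ f (bdryLift θ y) = 0) :
    0 < f (bdryLift θ (y + w)) := by
  have hne : ∀ s : ℝ, y + s • w ≠ 0 := fun s h => by
    have := (hind 1 s (by rwa [one_smul])).1; norm_num at this
  have hl : ∀ s : ℝ, (y + s • w) (Fin.last n) = 0 := fun s => by simp [hy, hw]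
  have hmem : ∀ s : ℝ, bdryLift θ (y + s • w) ∈ cone n θ := fun s =>
    bdryLift_mem_cone h0 hπ (hl s) (hne s)
  have hbd : ∀ s : ℝ, coneDeriv θ f (bdryLift θ (y + s • w)) (upVec n) = 0 := fun s =>
    hf.bdry _ (hmem s) (height_bdryLift h0 hπ (hl s))
  have hu : ∀ s : ℝ, HasDerivAt (fun r : ℝ => f (bdryLift θ (y + r • w)))
      (coneDeriv θ f (bdryLift θ (y + s • w)) w) s := by
    intro s
    have h1 := hasDerivAt_comp_curve rfl (hf.hasFDerivWithinAt (hmem s))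
      (hasDerivAt_bdryLift (θ := θ) y w s (hne s)) (Eventually.of_forall hmem)
    rwa [bdryVel, map_add, map_smul, hbd, smul_zero, add_zero] at h1
  have hu' : ∀ s : ℝ, ∃ d, 0 < d ∧ HasDerivAt
      (fun r : ℝ => coneDeriv θ f (bdryLift θ (y + r • w)) w) d s := by
    intro s
    have h1 := hasDerivAt_comp_curve rfl (hf.hasFDerivWithinAt_deriv h0 hπ (hmem s))
      (hasDerivAt_bdryLift (θ := θ) y w s (hne s)) (Eventually.of_forall hmem)
    have h2 := h1.clm_apply (hasDerivAt_const s w)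
    simp only [map_zero, add_zero] at h2
    refine ⟨_, ?_, h2⟩
    set V := bdryVel θ (y + s • w) w with hV
    have h3 : coneHess θ f (bdryLift θ (y + s • w)) V w =
        coneHess θ f (bdryLift θ (y + s • w)) V V := by
      conv_rhs => rw [hV, bdryVel, map_add, map_smul, ← bdryVel, ← hV,
        hf.hess_bdryVel h0 hπ (hl s) hw (hne s), smul_zero, add_zero]
    rw [h3]
    refine hf.hess_pos h0 hπ hpos (hmem s) fun a ha => ?_
    have h4 : horiz V = horiz (a • bdryLift θ (y + s • w)) := by rw [ha]
    have h5 : horiz V = w := by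
      simp [horiz, hV, bdryVel, hw, upVec_apply_last]
    have h6 : horiz (a • bdryLift θ (y + s • w)) = a • (y + s • w) := by
      rw [horiz, PiLp.smul_apply, bdryLift_last (hl s), bdryLift]
      simp only [smul_eq_mul]
      module
    rw [h5, h6] at h4
    have h7 := hind a (a * s - 1) (by
      have : a • y + (a * s - 1) • w = a • (y + s • w) - w := by module
      rw [this, ← h4, sub_self])
    rw [h7.1] at h7
    norm_num at h7
  have hmono : StrictMono fun r : ℝ => coneDeriv θ f (bdryLift θ (y + r • w)) w :=
    strictMono_of_deriv_pos fun s => by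
      obtain ⟨d, hd, h⟩ := hu' s
      rwa [h.deriv]
  have hpos' : ∀ s : ℝ, 0 < s → 0 < coneDeriv θ f (bdryLift θ (y + s • w)) w := by
    intro s hs
    have := hmono hs
    simp only [zero_smul, add_zero, hD] at this
    exact this
  have hmono2 : StrictMonoOn (fun r : ℝ => f (bdryLift θ (y + r • w))) (Set.Ici 0) :=
    strictMonoOn_of_deriv_pos (convex_Ici 0)
      (fun s _ => (hu s).continuousAt.continuousWithinAt) fun s hs => by
        rw [interior_Ici] at hs
        rw [(hu s).deriv]
        exact hpos' s hs
  have := hmono2 (Set.mem_Ici.2 le_rfl) (Set.mem_Ici.2 zero_le_one) one_pos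
  simpa [hzero] using this

lemma pos_bdryLift_of_not_smul (hpos : HessPos θ f) {y z : Amb n} (hy : y (Fin.last n) = 0)
    (hy0 : y ≠ 0) (hz : z (Fin.last n) = 0) (hzy : ∀ a : ℝ, z ≠ a • y)
    (hzero : f (bdryLift θ y) = 0) (hD : coneDeriv θ f (bdryLift θ y) = 0) :
    0 < f (bdryLift θ z) := by
  have := hf.pos_bdryLift_add h0 hπ hpos (w := z - y) hy (by simp [hy, hz]) (fun a b hab => by
    by_cases hb : b = 0
    · subst hb
      simp only [zero_smul, add_zero] at hab
      exact ⟨(smul_eq_zero.1 hab).resolve_right hy0, rfl⟩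
    · refine absurd ?_ (hzy (b⁻¹ * (b - a)))
      have h1 : b • z = (b - a) • y := by
        have h2 : a • y + b • (z - y) = b • z - (b - a) • y := by module
        rw [h2] at hab
        exact sub_eq_zero.1 hab
      rw [mul_smul, ← h1, smul_smul, inv_mul_cancel₀ hb, one_smul]) hzero hD
  rwa [add_sub_cancel] at this

lemma nonneg_bdryLift (hpos : HessPos θ f) {y z w : Amb n} (hy : y (Fin.last n) = 0)
    (hy0 : y ≠ 0) (hz : z (Fin.last n) = 0) (hz0 : z ≠ 0) (hw : w (Fin.last n) = 0)
    (hwy : ∀ a : ℝ, w ≠ a • y)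
    (hzero : f (bdryLift θ y) = 0) (hD : coneDeriv θ f (bdryLift θ y) = 0) :
    0 ≤ f (bdryLift θ z) := by
  by_cases hzy : ∃ a : ℝ, z = a • y
  · obtain ⟨a, rfl⟩ := hzy
    have h1 := hasDerivAt_comp_curve (by rw [zero_smul, add_zero])
      (hf.hasFDerivWithinAt (bdryLift_mem_cone h0 hπ hz hz0))
      (hasDerivAt_bdryLift (θ := θ) (a • y) w 0 (by simpa using hz0)) (by
        have : ContinuousAt (fun s : ℝ => a • y + s • w) 0 := by fun_prop
        filter_upwards [this.eventually_ne (y := 0)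
          (by rw [zero_smul, add_zero]; exact hz0)] with s hs
        exact bdryLift_mem_cone h0 hπ (by simp [hy, hw]) hs)
    have h2 := h1.continuousAt.tendsto.mono_left (nhdsWithin_le_nhds (s := {0}ᶜ))
    simp only [zero_smul, add_zero] at h2
    refine ge_of_tendsto h2 ?_
    filter_upwards [self_mem_nhdsWithin] with s hs
    have hs0 : s ≠ 0 := hs
    refine (hf.pos_bdryLift_of_not_smul h0 hπ hpos hy hy0 (by simp [hy, hw]) (fun b hb => ?_)
      hzero hD).le
    refine hwy (s⁻¹ * (b - a)) ?_
    have h3 : s • w = (b - a) • y := by rw [sub_smul, ← hb]; module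
    rw [mul_smul, ← h3, smul_smul, inv_mul_cancel₀ hs0, one_smul]
  · push Not at hzy
    exact (hf.pos_bdryLift_of_not_smul h0 hπ hpos hy hy0 hz hzy hzero hD).le

lemma exists_tangent_at (hpos : HessPos θ f) {y w : Amb n} (hy : y (Fin.last n) = 0)
    (hy0 : y ≠ 0) (hw : w (Fin.last n) = 0) (hwy : ∀ a : ℝ, w ≠ a • y) :
    ∃ p : Amb n, p (Fin.last n) = 0 ∧ ∀ z : Amb n, z (Fin.last n) = 0 → z ≠ 0 →
      inner ℝ p (bdryLift θ z) ≤ f (bdryLift θ z) ∧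
      ((∀ a : ℝ, z ≠ a • y) → inner ℝ p (bdryLift θ z) < f (bdryLift θ z)) := by
  have hx := bdryLift_mem_cone h0 hπ hy hy0
  let p : Amb n := (InnerProductSpace.toDual ℝ (Amb n)).symm (coneDeriv θ f (bdryLift θ y))
  have hp : ∀ v, inner ℝ p v = coneDeriv θ f (bdryLift θ y) v := fun v =>
    InnerProductSpace.toDual_symm_apply
  have hpl : p (Fin.last n) = 0 := by
    rw [← inner_upVec, hp, hf.bdry _ hx (height_bdryLift h0 hπ hy)]
  have hF := hf.sub_inner h0 hπ hpl
  have hFpos := hf.hessPos_sub_inner h0 hπ hpos p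
  have hzero : f (bdryLift θ y) - inner ℝ p (bdryLift θ y) = 0 := by
    rw [hp, hf.deriv_self hx, sub_self]
  have hD : coneDeriv θ (fun y => f y - inner ℝ p y) (bdryLift θ y) = 0 := by
    rw [hf.coneDeriv_sub_inner h0 hπ p hx]
    ext v
    rw [sub_apply, innerSL_apply_apply, hp, sub_self]; rfl
  refine ⟨p, hpl, fun z hz hz0 => ⟨?_, fun h => ?_⟩⟩
  · exact sub_nonneg.1 (hF.nonneg_bdryLift h0 hπ hFpos hy hy0 hz hz0 hw hwy hzero hD)
  · exact sub_pos.1 (hF.pos_bdryLift_of_not_smul h0 hπ hFpos hy hy0 hz h hzero hD)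

lemma exists_pos_bdry (hn : 2 ≤ n) (hpos : HessPos θ f) :
    ∃ p : Amb n, p (Fin.last n) = 0 ∧ ∀ z : Amb n, z (Fin.last n) = 0 → z ≠ 0 →
      0 < f (bdryLift θ z) - inner ℝ p (bdryLift θ z) := by
  let i : Fin (n + 1) := ⟨0, by lia⟩
  let j : Fin (n + 1) := ⟨1, by lia⟩
  have hij : i ≠ j := by simp [i, j]
  have hi : Fin.last n ≠ i := by simp [i, Fin.ext_iff]; lia
  have hj : Fin.last n ≠ j := by simp [j, Fin.ext_iff]; lia
  have hne : ∀ k : Fin (n + 1), (stdVec k : Amb n) ≠ 0 := fun k h => by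
    have := norm_stdVec k; rw [h, norm_zero] at this; exact zero_ne_one this
  have happ : ∀ k l : Fin (n + 1), (stdVec k : Amb n) l = if l = k then 1 else 0 := fun k l => by
    simp [stdVec]
  have hns : ∀ k l : Fin (n + 1), k ≠ l → ∀ a : ℝ, (stdVec k : Amb n) ≠ a • stdVec l := by
    intro k l hkl a h
    have := congrArg (fun v : Amb n => v k) h
    simp [happ, hkl] at this
  obtain ⟨p, hp, hp'⟩ := hf.exists_tangent_at h0 hπ hpos (y := stdVec i) (w := stdVec j)
    (by simp [happ, hi]) (hne i) (by simp [happ, hj]) (hns j i hij.symm)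
  obtain ⟨q, hq, hq'⟩ := hf.exists_tangent_at h0 hπ hpos (y := stdVec j) (w := stdVec i)
    (by simp [happ, hj]) (hne j) (by simp [happ, hi]) (hns i j hij)
  refine ⟨(1 / 2 : ℝ) • (p + q), by simp [hp, hq], fun z hz hz0 => ?_⟩
  rw [inner_smul_left, inner_add_left]
  simp only [conj_trivial]
  obtain ⟨h1, h2⟩ := hp' z hz hz0
  obtain ⟨h3, h4⟩ := hq' z hz hz0
  by_cases h : ∃ a : ℝ, z = a • (stdVec i : Amb n)
  · obtain ⟨a, rfl⟩ := h
    have := h4 fun b hb => by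
      have h5 := congrArg (fun v : Amb n => v i) hb
      simp [happ, hij] at h5
      exact hz0 (by rw [h5, zero_smul])
    linarith
  · push Not at h
    have := h2 h
    linarith

lemma deriv_upVec_ray (hpos : HessPos θ f) {y : Amb n} (hy : y ∈ cone n θ) (hh : height θ y = 0)
    {s : ℝ} (hs : 0 ≤ s) :
    0 ≤ coneDeriv θ f (y + s • upVec n) (upVec n) ∧ f y ≤ f (y + s • upVec n) := by
  have hγ : ∀ r : ℝ, HasDerivAt (fun r : ℝ => y + r • upVec n) (upVec n) r := fun r => by
    simpa using ((hasDerivAt_id r).smul_const (upVec n)).const_add y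
  have hopen : ∀ r : ℝ, 0 < r → y + r • upVec n ∈ openCone n θ := fun r hr =>
    add_smul_upVec_mem_openCone h0 hπ hh.ge hr
  have hmem : ∀ r ∈ Set.Ici (0 : ℝ), y + r • upVec n ∈ cone n θ := by
    intro r hr
    rcases (Set.mem_Ici.1 hr).eq_or_lt with h | h
    · rw [← h, zero_smul, add_zero]; exact hy
    · exact openCone_subset_cone (hopen r h)
  have hev : ∀ r : ℝ, 0 < r → ∀ᶠ t in 𝓝 r, y + t • upVec n ∈ cone n θ := fun r hr =>
    eventually_of_mem (Ioi_mem_nhds hr) fun t ht => openCone_subset_cone (hopen t ht)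
  have hcγ : ContinuousOn (fun r : ℝ => y + r • upVec n) (Set.Ici 0) := by fun_prop
  have hmono : MonotoneOn (fun r : ℝ => coneDeriv θ f (y + r • upVec n) (upVec n))
      (Set.Ici 0) := by
    have hd : ∀ r : ℝ, 0 < r → HasDerivAt
        (fun r : ℝ => coneDeriv θ f (y + r • upVec n) (upVec n))
        (coneHess θ f (y + r • upVec n) (upVec n) (upVec n)) r := by
      intro r hr
      have := (hasDerivAt_comp_curve rfl (hf.hasFDerivWithinAt_deriv h0 hπ (hmem r hr.le))
        (hγ r) (hev r hr)).clm_apply (hasDerivAt_const r (upVec n))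
      simpa using this
    refine monotoneOn_of_deriv_nonneg (convex_Ici 0) ?_ ?_ ?_
    · exact (((hf.contDiffOn_deriv h0 hπ).continuousOn.comp hcγ hmem)).clm_apply
        continuousOn_const
    · intro r hr
      rw [interior_Ici] at hr
      exact (hd r hr).differentiableAt.differentiableWithinAt
    · intro r hr
      rw [interior_Ici] at hr
      rw [(hd r hr).deriv]
      exact hf.hess_nonneg h0 hπ hpos (hmem r (Set.mem_Ici.2 (le_of_lt (Set.mem_Ioi.1 hr)))) _
  have hnn : ∀ r ∈ Set.Ici (0 : ℝ), 0 ≤ coneDeriv θ f (y + r • upVec n) (upVec n) := by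
    intro r hr
    have := hmono (Set.mem_Ici.2 le_rfl) hr hr
    simpa [hf.bdry y hy hh] using this
  refine ⟨hnn s hs, ?_⟩
  have hd : ∀ r : ℝ, 0 < r → HasDerivAt (fun r : ℝ => f (y + r • upVec n))
      (coneDeriv θ f (y + r • upVec n) (upVec n)) r := fun r hr =>
    hasDerivAt_comp_curve rfl (hf.hasFDerivWithinAt (hmem r hr.le)) (hγ r) (hev r hr)
  have hmono2 : MonotoneOn (fun r : ℝ => f (y + r • upVec n)) (Set.Ici 0) := by
    refine monotoneOn_of_deriv_nonneg (convex_Ici 0) (hf.contDiffOn.continuousOn.comp hcγ hmem)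
      ?_ ?_
    · intro r hr
      rw [interior_Ici] at hr
      exact (hd r hr).differentiableAt.differentiableWithinAt
    · intro r hr
      rw [interior_Ici] at hr
      rw [(hd r hr).deriv]
      exact hnn r (Set.mem_Ici.2 (le_of_lt (Set.mem_Ioi.1 hr)))
  have := hmono2 (Set.mem_Ici.2 le_rfl) (Set.mem_Ici.2 hs) hs
  simpa using this

lemma pos_upVec (hn : 1 ≤ n) (hpos : HessPos θ f) : 0 < f (upVec n) := by
  let i : Fin (n + 1) := ⟨0, by lia⟩
  have hi : Fin.last n ≠ i := by simp [i, Fin.ext_iff]; lia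
  set ω : Amb n := stdVec i with hω
  have hωi : ω i = 1 := by simp [hω, stdVec]
  have hωl : ω (Fin.last n) = 0 := by simp [hω, stdVec, hi]
  have hui : upVec n i = 0 := by simp [upVec, stdVec, hi.symm]
  have hcont : Continuous fun s : ℝ => upVec n + s • ω := by fun_prop
  have hnhds : ∀ᶠ s in 𝓝 (0 : ℝ), upVec n + s • ω ∈ openCone n θ :=
    hcont.continuousAt.eventually_mem (isOpen_openCone.mem_nhds (by
      simpa using upVec_mem_openCone h0 hπ))
  obtain ⟨ε, hε, hball⟩ := Metric.eventually_nhds_iff.1 hnhds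
  have hopen : ∀ s : ℝ, |s| < ε → upVec n + s • ω ∈ openCone n θ := fun s hs =>
    hball (by simpa using hs)
  have hγ : ∀ r : ℝ, HasDerivAt (fun r : ℝ => upVec n + r • ω) ω r := fun r => by
    simpa using ((hasDerivAt_id r).smul_const ω).const_add (upVec n)
  have hd : ∀ r : ℝ, |r| < ε → HasDerivAt (fun r : ℝ => coneDeriv θ f (upVec n + r • ω) (upVec n))
      (coneHess θ f (upVec n + r • ω) ω (upVec n)) r := by
    intro r hr
    have := (hasDerivAt_comp_curve rfl
      (hf.hasFDerivWithinAt_deriv h0 hπ (openCone_subset_cone (hopen r hr))) (hγ r)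
      (eventually_of_mem ((continuous_abs.isOpen_preimage _ isOpen_Iio).mem_nhds hr) fun t ht =>
        openCone_subset_cone (hopen t ht))).clm_apply (hasDerivAt_const r (upVec n))
    simpa using this
  have habs : ∀ r ∈ Set.Icc (0 : ℝ) (ε / 2), |r| < ε := fun r hr => by
    rw [abs_of_nonneg hr.1]; linarith [hr.2]
  have hanti : StrictAntiOn (fun r : ℝ => coneDeriv θ f (upVec n + r • ω) (upVec n))
      (Set.Icc 0 (ε / 2)) := by
    refine strictAntiOn_of_deriv_neg (convex_Icc _ _)
      (fun r hr => (hd r (habs r hr)).continuousAt.continuousWithinAt) fun r hr => ?_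
    rw [interior_Icc] at hr
    have hr' := habs r ⟨hr.1.le, hr.2.le⟩
    have hx := openCone_subset_cone (hopen r hr')
    rw [(hd r hr').deriv]
    have h1 := hf.hess_right_self h0 hπ hx ω
    rw [map_add, map_smul, smul_eq_mul] at h1
    have h2 : 0 < coneHess θ f (upVec n + r • ω) ω ω := by
      refine hf.hess_pos h0 hπ hpos hx fun a ha => ?_
      have h3 := congrArg (fun v : Amb n => v (Fin.last n)) ha
      simp [hωl, upVec_apply_last] at h3
      rw [← h3, zero_smul] at ha
      rw [ha] at hωi
      simp at hωi
    have := mul_pos hr.1 h2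
    linarith
  have h1 := hanti ⟨le_rfl, by linarith⟩ ⟨by linarith, le_rfl⟩ (half_pos hε)
  simp only [zero_smul, add_zero] at h1
  rw [hf.deriv_self (openCone_subset_cone (upVec_mem_openCone h0 hπ))] at h1
  refine lt_of_le_of_lt ?_ h1
  have hx := openCone_subset_cone (hopen (ε / 2) (habs _ ⟨by linarith, le_rfl⟩))
  obtain ⟨t, ht0, -, ht⟩ := exists_descent h0 hπ (mem_cone_iff.1 hx).2
  have hne : upVec n + (ε / 2) • ω - t • upVec n ≠ 0 := fun h => by
    have h3 := congrArg (fun v : Amb n => v i) h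
    simp [hωi, hui] at h3
    exact hε.ne' h3
  have := (hf.deriv_upVec_ray h0 hπ hpos (mem_cone_iff.2 ⟨hne, ht.ge⟩) ht ht0).1
  rwa [sub_add_cancel] at this

/-- A strictly convex capillary support function is positive after a horizontal translation. -/
theorem exists_pos_sub_inner (hn : 2 ≤ n) (hpos : HessPos θ f) :
    ∃ p : Amb n, p (Fin.last n) = 0 ∧ ∀ x ∈ cone n θ, 0 < f x - inner ℝ p x := by
  obtain ⟨p, hp, hbd⟩ := hf.exists_pos_bdry h0 hπ hn hpos
  refine ⟨p, hp, fun x hx => ?_⟩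
  have hF := hf.sub_inner h0 hπ hp
  have hFpos := hf.hessPos_sub_inner h0 hπ hpos p
  obtain ⟨t, ht0, -, ht⟩ := exists_descent h0 hπ (mem_cone_iff.1 hx).2
  by_cases hy : x - t • upVec n = 0
  · rw [sub_eq_zero] at hy
    have htpos : 0 < t := lt_of_le_of_ne ht0 fun h =>
      (mem_cone_iff.1 hx).1 (by rw [hy, ← h, zero_smul])
    have h1 := hF.hom_smul _ (openCone_subset_cone (upVec_mem_openCone h0 hπ)) t htpos
    simp only [← hy] at h1
    rw [h1]
    exact mul_pos htpos (hF.pos_upVec h0 hπ (by lia) hFpos)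
  · have hyc := mem_cone_iff.2 ⟨hy, ht.ge⟩
    have h1 := (hF.deriv_upVec_ray h0 hπ hFpos hyc ht ht0).2
    rw [sub_add_cancel] at h1
    refine lt_of_lt_of_le ?_ h1
    have h2 := bdryLift_horiz h0 hπ ht
    have h3 := hbd (horiz (x - t • upVec n)) (horiz_last _) (fun h => hy (by
      rw [← h2, h]; simp [bdryLift]))
    rwa [h2] at h3

end IsCapillaryHomogeneous
end Positivity
end Capillary

namespace Capillary
open Filter Topology MeasureTheory

section Core
variable {n : ℕ} {θ : ℝ}

/-- The matrix of second derivatives of a function on the cone. -/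
noncomputable def hessMat {n : ℕ} (θ : ℝ) (f : Amb n → ℝ) (x : Amb n) :
    Matrix (Fin (n + 1)) (Fin (n + 1)) ℝ :=
  Matrix.of fun i j => coneHess θ f x (stdVec i) (stdVec j)

/-- A smooth radial function supported in the annulus `1 ≤ |x| ≤ 2`. -/
noncomputable def annulusBump {n : ℕ} (x : Amb n) : ℝ :=
  (⟨1, 3 / 2, one_pos, by norm_num⟩ : ContDiffBump (5 / 2 : ℝ)) (‖x‖ ^ 2)

lemma contDiff_annulusBump {r : ℕ∞} : ContDiff ℝ r (annulusBump : Amb n → ℝ) := by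
  unfold annulusBump
  exact (ContDiffBump.contDiff _).comp (contDiff_norm_sq ℝ)

lemma annulusBump_nonneg (x : Amb n) : 0 ≤ annulusBump x := ContDiffBump.nonneg _

lemma annulusBump_support {x : Amb n} (hx : annulusBump x ≠ 0) : 1 ≤ ‖x‖ ∧ ‖x‖ ≤ 2 := by
  have h : ‖x‖ ^ 2 ∈ Function.support
      (⟨1, 3 / 2, one_pos, by norm_num⟩ : ContDiffBump (5 / 2 : ℝ)) := hx
  rw [ContDiffBump.support_eq, Metric.mem_ball, Real.dist_eq, abs_lt] at h
  have := norm_nonneg x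
  constructor <;> nlinarith [h.1, h.2]

lemma annulusBump_pos {x : Amb n} (h1 : 1 < ‖x‖) (h2 : ‖x‖ < 2) : 0 < annulusBump x := by
  refine ContDiffBump.pos_of_mem_ball _ ?_
  rw [Metric.mem_ball, Real.dist_eq, abs_lt]
  constructor <;> simp only <;> nlinarith

lemma exists_fderiv_annulusBump (x : Amb n) :
    ∃ c : ℝ, ∀ v, fderiv ℝ (annulusBump : Amb n → ℝ) x v = c * inner ℝ x v := by
  let b : ContDiffBump (5 / 2 : ℝ) := ⟨1, 3 / 2, one_pos, by norm_num⟩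
  have h1 : HasDerivAt b (deriv b (‖x‖ ^ 2)) (‖x‖ ^ 2) :=
    ((b.contDiff (n := 1)).differentiable one_ne_zero _).hasDerivAt
  have h2 := h1.comp_hasFDerivAt x (hasStrictFDerivAt_norm_sq x).hasFDerivAt
  have h3 : fderiv ℝ (annulusBump : Amb n → ℝ) x = _ := h2.fderiv
  refine ⟨deriv b (‖x‖ ^ 2) * 2, fun v => ?_⟩
  rw [h3]
  simp
  ring

lemma sum_mul_adjugate_mulVec {ι : Type*} [Fintype ι] [DecidableEq ι] {M : Matrix ι ι ℝ}
    {u : ι → ℝ} {l : ℝ} (h : ∀ j, ∑ i, u i * M i j = l * u j) (y : ι → ℝ) :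
    l * ∑ i, u i * ∑ j, M.adjugate i j * y j = M.det * ∑ j, u j * y j := by
  have h1 : Matrix.vecMul u M = l • u := by
    ext j; exact h j
  have h2 : Matrix.vecMul (Matrix.vecMul u M) M.adjugate = M.det • u := by
    rw [Matrix.vecMul_vecMul, Matrix.mul_adjugate, Matrix.vecMul_smul, Matrix.vecMul_one]
  rw [h1, Matrix.smul_vecMul] at h2
  have h3 : ∑ i, u i * ∑ j, M.adjugate i j * y j = Matrix.vecMul u M.adjugate ⬝ᵥ y := by
    rw [← Matrix.dotProduct_mulVec]; rfl
  have h4 : ∑ j, u j * y j = u ⬝ᵥ y := rfl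
  rw [h3, h4, ← smul_eq_mul, ← smul_eq_mul, ← smul_dotProduct, ← smul_dotProduct, h2]

lemma sum_coord_mul {L : Amb n →L[ℝ] ℝ} (x : Amb n) : ∑ i, x i * L (stdVec i) = L x := by
  conv_rhs => rw [← sum_smul_stdVec x, map_sum]
  simp

namespace IsCapillaryHomogeneous
variable {f : Amb n → ℝ} (hf : IsCapillaryHomogeneous θ f) (h0 : 0 < θ) (hπ : θ < Real.pi)
include hf h0 hπ

lemma contDiffOn_hessMat (i j : Fin (n + 1)) :
    ContDiffOn ℝ 2 (fun x => hessMat θ f x i j) (cone n θ) :=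
  ((hf.contDiffOn_hess h0 hπ).clm_apply contDiffOn_const).clm_apply contDiffOn_const

lemma contDiffOn_deriv_apply (v : Amb n) :
    ContDiffOn ℝ 3 (fun x => coneDeriv θ f x v) (cone n θ) :=
  (hf.contDiffOn_deriv h0 hπ).clm_apply contDiffOn_const

lemma hessMat_symm {x : Amb n} (hx : x ∈ cone n θ) (i j : Fin (n + 1)) :
    hessMat θ f x i j = hessMat θ f x j i := hf.hess_symm h0 hπ hx _ _

lemma sum_coord_hessMat {x : Amb n} (hx : x ∈ cone n θ) (j : Fin (n + 1)) :
    ∑ i, x i * hessMat θ f x i j = 0 := by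
  have h := sum_coord_mul (L := (coneHess θ f x).flip (stdVec j)) x
  simp only [ContinuousLinearMap.flip_apply] at h
  rw [hf.hess_self h0 hπ hx] at h
  exact h

lemma exists_sum_heightGrad_hessMat {x : Amb n} (hx : x ∈ cone n θ) (hh : height θ x = 0) :
    ∃ l : ℝ, ∀ j, ∑ i, heightGrad θ x i * hessMat θ f x i j = l * heightGrad θ x j := by
  obtain ⟨l, hl⟩ := hf.hess_heightGrad h0 hπ hx hh
  refine ⟨l, fun j => ?_⟩
  have h := sum_coord_mul (L := (coneHess θ f x).flip (stdVec j)) (heightGrad θ x)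
  simp only [ContinuousLinearMap.flip_apply] at h
  rw [hf.hess_symm h0 hπ hx, hl, inner_stdVec] at h
  exact h

lemma fderiv_deriv_apply {x : Amb n} (hx : x ∈ openCone n θ) (v w : Amb n) :
    fderiv ℝ (fun y => coneDeriv θ f y v) x w = coneHess θ f x w v := by
  have h1 := (hf.hasFDerivWithinAt_deriv h0 hπ (openCone_subset_cone hx)).hasFDerivAt
    (cone_mem_nhds hx)
  have h2 := h1.clm_apply (hasFDerivAt_const v x)
  rw [h2.fderiv]
  simp

lemma fderiv_hessMat_symm {x : Amb n} (hx : x ∈ openCone n θ) (i j k : Fin (n + 1)) :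
    fderiv ℝ (fun y => hessMat θ f y j k) x (stdVec i) =
      fderiv ℝ (fun y => hessMat θ f y i k) x (stdVec j) := by
  have hsymm : IsSymmSndFDerivWithinAt ℝ (coneDeriv θ f) (cone n θ) x :=
    (hf.contDiffOn_deriv h0 hπ x (openCone_subset_cone hx)).isSymmSndFDerivWithinAt
      (by simp; norm_num) (uniqueDiffOn_cone h0 hπ)
      (mem_closure_interior_cone h0 hπ (openCone_subset_cone hx)) (openCone_subset_cone hx)
  have h1 := (((hf.contDiffOn_hess h0 hπ).differentiableOn (by norm_num) x
    (openCone_subset_cone hx)).hasFDerivWithinAt).hasFDerivAt (cone_mem_nhds hx)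
  have h2 : ∀ a b c : Fin (n + 1), fderiv ℝ (fun y => hessMat θ f y a b) x (stdVec c) =
      fderivWithin ℝ (coneHess θ f) (cone n θ) x (stdVec c) (stdVec a) (stdVec b) := by
    intro a b c
    have h3 := (h1.clm_apply (hasFDerivAt_const (stdVec a : Amb n) x)).clm_apply
      (hasFDerivAt_const (stdVec b : Amb n) x)
    have h4 : fderiv ℝ (fun y => hessMat θ f y a b) x = _ := h3.fderiv
    rw [h4]
    simp
  rw [h2, h2]
  exact congrArg (fun L : Amb n →L[ℝ] ℝ => L (stdVec k)) (hsymm (stdVec i) (stdVec j))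

end IsCapillaryHomogeneous

section Identity
variable {f v : Amb n → ℝ}

/-- The matrix `1 + t (D²f + s D²v)`. -/
noncomputable def pencil {n : ℕ} (θ : ℝ) (f v : Amb n → ℝ) (t s : ℝ) (x : Amb n) :
    Matrix (Fin (n + 1)) (Fin (n + 1)) ℝ :=
  1 + t • (hessMat θ f x + s • hessMat θ v x)

variable (hf : IsCapillaryHomogeneous θ f) (hv : IsCapillaryHomogeneous θ v)
  (h0 : 0 < θ) (hπ : θ < Real.pi)
include hf hv h0 hπ

lemma contDiffOn_pencil (t s : ℝ) (i j : Fin (n + 1)) :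
    ContDiffOn ℝ 2 (fun x => pencil θ f v t s x i j) (cone n θ) :=
  contDiffOn_const.add (contDiffOn_const.mul ((hf.contDiffOn_hessMat h0 hπ i j).add
    (contDiffOn_const.mul (hv.contDiffOn_hessMat h0 hπ i j))))

lemma pencil_symm (t s : ℝ) {x : Amb n} (hx : x ∈ cone n θ) :
    (pencil θ f v t s x).transpose = pencil θ f v t s x := by
  ext i j
  simp only [pencil, Matrix.transpose_apply, Matrix.add_apply, Matrix.smul_apply,
    hf.hessMat_symm h0 hπ hx j i, hv.hessMat_symm h0 hπ hx j i, Matrix.one_apply, eq_comm]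

omit hf hv h0 hπ in
lemma sum_mul_pencil (t s : ℝ) {x : Amb n} {u : Fin (n + 1) → ℝ} {a b : ℝ}
    (ha : ∀ j, ∑ i, u i * hessMat θ f x i j = a * u j)
    (hb : ∀ j, ∑ i, u i * hessMat θ v x i j = b * u j) (j : Fin (n + 1)) :
    ∑ i, u i * pencil θ f v t s x i j = (1 + t * (a + s * b)) * u j := by
  have h1 : ∀ i, u i * pencil θ f v t s x i j = u i * (1 : Matrix _ _ ℝ) i j +
      (t * (u i * hessMat θ f x i j) + t * s * (u i * hessMat θ v x i j)) := fun i => by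
    simp only [pencil, Matrix.add_apply, Matrix.smul_apply, smul_eq_mul]; ring
  simp only [h1, Finset.sum_add_distrib, ← Finset.mul_sum, ha, hb, Matrix.one_apply, mul_ite,
    mul_one, mul_zero, Finset.sum_ite_eq', Finset.mem_univ, if_true]
  ring

lemma sum_fderiv_adjugate_pencil {t s : ℝ} {x : Amb n} (hx : x ∈ openCone n θ)
    (hdet : (pencil θ f v t s x).det ≠ 0) (j : Fin (n + 1)) :
    ∑ i, fderiv ℝ (fun y => (pencil θ f v t s y).adjugate i j) x (stdVec i) = 0 := by
  have hC := contDiffOn_pencil hf hv h0 hπ t s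
  have hdA : ∀ {g : Amb n → ℝ} (hg : IsCapillaryHomogeneous θ g) (i j : Fin (n + 1)),
      DifferentiableAt ℝ (fun y => hessMat θ g y i j) x := fun hg i j =>
    ((hg.contDiffOn_hessMat h0 hπ i j).contDiffAt (cone_mem_nhds hx)).differentiableAt
      (by norm_num)
  have hfd : ∀ a b c : Fin (n + 1), fderiv ℝ (fun y => pencil θ f v t s y b c) x (stdVec a) =
      t * (fderiv ℝ (fun y => hessMat θ f y b c) x (stdVec a) +
        s * fderiv ℝ (fun y => hessMat θ v y b c) x (stdVec a)) := by
    intro a b c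
    have h1 := (((hdA hf b c).hasFDerivAt.add ((hdA hv b c).hasFDerivAt.const_mul s)).const_mul
      t).const_add ((1 : Matrix (Fin (n + 1)) (Fin (n + 1)) ℝ) b c)
    have h2 : fderiv ℝ (fun y => pencil θ f v t s y b c) x = _ := h1.fderiv
    rw [h2]
    simp only [smul_apply, add_apply, smul_eq_mul]
  refine sum_fderiv_adjugate_eq_zero (M := pencil θ f v t s) stdVec ?_ ?_ ?_ ?_ hdet j
  · exact fun i j => ((hC i j).contDiffAt (cone_mem_nhds hx)).differentiableAt (by norm_num)
  · exact fun i j => ((contDiffOn_adjugate hC i j).contDiffAt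
      (cone_mem_nhds hx)).differentiableAt (by norm_num)
  · intro a b c
    rw [hfd, hfd, hf.fderiv_hessMat_symm h0 hπ hx, hv.fderiv_hessMat_symm h0 hπ hx]
  · intro a b c
    have h3 : (fun y => pencil θ f v t s y b c) =ᶠ[𝓝 x] fun y => pencil θ f v t s y c b := by
      filter_upwards [isOpen_openCone.mem_nhds hx] with y hy
      exact congrFun (congrFun (pencil_symm hf hv h0 hπ t s (openCone_subset_cone hy)) c) b
    rw [h3.fderiv_eq]

/-- The vector field `φ adj(M) (f ∇v - v ∇f)`. -/
noncomputable def fluxField {n : ℕ} (θ : ℝ) (f v : Amb n → ℝ) (t s : ℝ) (i : Fin (n + 1))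
    (x : Amb n) : ℝ :=
  annulusBump x * ∑ j, (pencil θ f v t s x).adjugate i j *
    (f x * coneDeriv θ v x (stdVec j) - v x * coneDeriv θ f x (stdVec j))

omit hf hv h0 hπ in
lemma fluxField_support (t s : ℝ) (i : Fin (n + 1)) (x : Amb n) (h : fluxField θ f v t s i x ≠ 0) :
    1 ≤ ‖x‖ ∧ ‖x‖ ≤ 2 := annulusBump_support (left_ne_zero_of_mul h)

lemma contDiffOn_fluxField (t s : ℝ) (i : Fin (n + 1)) :
    ContDiffOn ℝ 1 (fluxField θ f v t s i) (cone n θ) := by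
  refine (contDiff_annulusBump (r := 1)).contDiffOn.mul (ContDiffOn.sum fun j _ => ContDiffOn.mul ?_
    (ContDiffOn.sub (ContDiffOn.mul ?_ ?_) (ContDiffOn.mul ?_ ?_)))
  · exact (contDiffOn_adjugate (contDiffOn_pencil hf hv h0 hπ t s) i j).of_le (by norm_num)
  · exact hf.contDiffOn.of_le (by norm_num)
  · exact (hv.contDiffOn_deriv_apply h0 hπ _).of_le (by norm_num)
  · exact hv.contDiffOn.of_le (by norm_num)
  · exact (hf.contDiffOn_deriv_apply h0 hπ _).of_le (by norm_num)

omit hf hv h0 hπ in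
lemma sum_mul_wronskian (x u : Amb n) :
    ∑ j, u j * (f x * coneDeriv θ v x (stdVec j) - v x * coneDeriv θ f x (stdVec j)) =
      f x * coneDeriv θ v x u - v x * coneDeriv θ f x u := by
  rw [← sum_coord_mul (L := coneDeriv θ v x) u, ← sum_coord_mul (L := coneDeriv θ f x) u,
    Finset.mul_sum, Finset.mul_sum, ← Finset.sum_sub_distrib]
  exact Finset.sum_congr rfl fun j _ => by ring

lemma sum_heightGrad_fluxField {t s : ℝ}
    (hdet : ∀ x ∈ cone n θ, 1 ≤ ‖x‖ → ‖x‖ ≤ 2 → (pencil θ f v t s x).det ≠ 0)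
    {x : Amb n} (hx : x ∈ cone n θ) (hh : height θ x = 0) :
    ∑ i, heightGrad θ x i * fluxField θ f v t s i x = 0 := by
  by_cases hφ : annulusBump x = 0
  · exact Finset.sum_eq_zero fun i _ => by rw [fluxField, hφ, zero_mul, mul_zero]
  obtain ⟨hn1, hn2⟩ := annulusBump_support hφ
  have hd := hdet x hx hn1 hn2
  obtain ⟨a, ha⟩ := hf.exists_sum_heightGrad_hessMat h0 hπ hx hh
  obtain ⟨b, hb⟩ := hv.exists_sum_heightGrad_hessMat h0 hπ hx hh
  have h1 := sum_mul_pencil (f := f) (v := v) t s ha hb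
  have h2 := sum_mul_adjugate_mulVec h1
    (fun j => f x * coneDeriv θ v x (stdVec j) - v x * coneDeriv θ f x (stdVec j))
  rw [sum_mul_wronskian, hf.deriv_heightGrad hx hh, hv.deriv_heightGrad hx hh] at h2
  have h3 : ∑ i, heightGrad θ x i * fluxField θ f v t s i x = annulusBump x *
      ∑ i, heightGrad θ x i * ∑ j, (pencil θ f v t s x).adjugate i j *
        (f x * coneDeriv θ v x (stdVec j) - v x * coneDeriv θ f x (stdVec j)) := by
    rw [Finset.mul_sum]
    exact Finset.sum_congr rfl fun i _ => by rw [fluxField]; ring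
  rw [h3]
  by_cases hl : 1 + t * (a + s * b) = 0
  · have h4 : Matrix.vecMul (heightGrad θ x) (pencil θ f v t s x) = 0 := by
      ext j
      have := h1 j
      rw [hl, zero_mul] at this
      exact this
    have h5 := Matrix.eq_zero_of_vecMul_eq_zero hd h4
    have h6 : ∀ i, heightGrad θ x i = 0 := fun i => congrFun h5 i
    simp [h6]
  · have h7 : f x * (-(Real.cos θ * ‖x‖⁻¹) * v x) - v x * (-(Real.cos θ * ‖x‖⁻¹) * f x) = 0 := by
      ring
    rw [h7, mul_zero] at h2
    rw [(mul_eq_zero.1 h2).resolve_left hl, mul_zero]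

/-- The density obtained by differentiating the determinant of the pencil. -/
noncomputable def fluxDensity {n : ℕ} (θ : ℝ) (f v : Amb n → ℝ) (t s : ℝ) (x : Amb n) : ℝ :=
  f x * (∑ i, ∑ j, (pencil θ f v t s x).adjugate i j * hessMat θ v x j i) -
    v x * (∑ i, ∑ j, (pencil θ f v t s x).adjugate i j * hessMat θ f x j i)

lemma continuousOn_fluxDensity (t s : ℝ) : ContinuousOn (fluxDensity θ f v t s) (cone n θ) := by
  have hadj := fun i j => (contDiffOn_adjugate (contDiffOn_pencil hf hv h0 hπ t s) i j).continuousOn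
  refine ContinuousOn.sub (hf.contDiffOn.continuousOn.mul ?_) (hv.contDiffOn.continuousOn.mul ?_)
  · exact continuousOn_finsetSum _ fun i _ => continuousOn_finsetSum _ fun j _ =>
      (hadj i j).mul (hv.contDiffOn_hessMat h0 hπ j i).continuousOn
  · exact continuousOn_finsetSum _ fun i _ => continuousOn_finsetSum _ fun j _ =>
      (hadj i j).mul (hf.contDiffOn_hessMat h0 hπ j i).continuousOn

lemma sum_fderiv_fluxField {t s : ℝ}
    (hdet : ∀ x ∈ cone n θ, 1 ≤ ‖x‖ → ‖x‖ ≤ 2 → (pencil θ f v t s x).det ≠ 0)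
    {x : Amb n} (hx : x ∈ openCone n θ) :
    ∑ i, fderiv ℝ (fluxField θ f v t s i) x (stdVec i) =
      annulusBump x * fluxDensity θ f v t s x := by
  by_cases hA : 1 ≤ ‖x‖ ∧ ‖x‖ ≤ 2
  swap
  · have hφ : annulusBump x = 0 := by by_contra h; exact hA (annulusBump_support h)
    rw [hφ, zero_mul]
    refine Finset.sum_eq_zero fun i _ => ?_
    rw [fderiv_eq_zero_of_support (fluxField_support t s i) hA]; rfl
  have hxc := openCone_subset_cone hx
  have hd := hdet x hxc hA.1 hA.2
  have hφd : DifferentiableAt ℝ (annulusBump : Amb n → ℝ) x :=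
    (contDiff_annulusBump (r := 1)).differentiable one_ne_zero x
  have hadj : ∀ i j, DifferentiableAt ℝ (fun y => (pencil θ f v t s y).adjugate i j) x :=
    fun i j => ((contDiffOn_adjugate (contDiffOn_pencil hf hv h0 hπ t s) i j).contDiffAt
      (cone_mem_nhds hx)).differentiableAt (by norm_num)
  have hfd : HasFDerivAt f (coneDeriv θ f x) x := (hf.hasFDerivWithinAt hxc).hasFDerivAt
    (cone_mem_nhds hx)
  have hvd : HasFDerivAt v (coneDeriv θ v x) x := (hv.hasFDerivWithinAt hxc).hasFDerivAt
    (cone_mem_nhds hx)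
  have hDd : ∀ {g : Amb n → ℝ} (hg : IsCapillaryHomogeneous θ g) (w : Amb n),
      DifferentiableAt ℝ (fun y => coneDeriv θ g y w) x := fun hg w =>
    ((hg.contDiffOn_deriv_apply h0 hπ w).contDiffAt (cone_mem_nhds hx)).differentiableAt
      (by norm_num)
  set Y : Fin (n + 1) → Amb n → ℝ := fun j y =>
    f y * coneDeriv θ v y (stdVec j) - v y * coneDeriv θ f y (stdVec j) with hY
  have hYd : ∀ j, HasFDerivAt (Y j)
      ((f x • fderiv ℝ (fun y => coneDeriv θ v y (stdVec j)) x +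
        coneDeriv θ v x (stdVec j) • coneDeriv θ f x) -
      (v x • fderiv ℝ (fun y => coneDeriv θ f y (stdVec j)) x +
        coneDeriv θ f x (stdVec j) • coneDeriv θ v x)) x := fun j =>
    (hfd.mul (hDd hv (stdVec j)).hasFDerivAt).sub (hvd.mul (hDd hf (stdVec j)).hasFDerivAt)
  have hYe : ∀ i j, fderiv ℝ (Y j) x (stdVec i) =
      f x * hessMat θ v x i j - v x * hessMat θ f x i j +
      (coneDeriv θ f x (stdVec i) * coneDeriv θ v x (stdVec j) -
        coneDeriv θ v x (stdVec i) * coneDeriv θ f x (stdVec j)) := by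
    intro i j
    rw [(hYd j).fderiv]
    simp only [sub_apply, add_apply, smul_apply, smul_eq_mul,
      hf.fderiv_deriv_apply h0 hπ hx, hv.fderiv_deriv_apply h0 hπ hx, hessMat, Matrix.of_apply]
    ring
  obtain ⟨c, hc⟩ := exists_fderiv_annulusBump x
  have hZ : ∀ i, fderiv ℝ (fluxField θ f v t s i) x (stdVec i) =
      c * (x i * ∑ j, (pencil θ f v t s x).adjugate i j * Y j x) +
      annulusBump x * ∑ j, (fderiv ℝ (fun y => (pencil θ f v t s y).adjugate i j) x (stdVec i) *
        Y j x + (pencil θ f v t s x).adjugate i j * fderiv ℝ (Y j) x (stdVec i)) := by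
    intro i
    have h1 : HasFDerivAt (fun y => ∑ j, (pencil θ f v t s y).adjugate i j * Y j y)
        (∑ j, ((pencil θ f v t s x).adjugate i j • fderiv ℝ (Y j) x +
          Y j x • fderiv ℝ (fun y => (pencil θ f v t s y).adjugate i j) x)) x :=
      HasFDerivAt.fun_sum fun j _ => (hadj i j).hasFDerivAt.mul
        ((hYd j).differentiableAt.hasFDerivAt)
    have h2 : fderiv ℝ (fluxField θ f v t s i) x = _ := (hφd.hasFDerivAt.mul h1).fderiv
    rw [h2]
    simp only [add_apply, smul_apply, sum_apply, smul_eq_mul, hc, inner_stdVec]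
    rw [add_comm]
    congr 1
    · ring
    · congr 1
      exact Finset.sum_congr rfl fun j _ => by ring
  have hadjs : ∀ i j, (pencil θ f v t s x).adjugate i j = (pencil θ f v t s x).adjugate j i := by
    intro i j
    conv_lhs => rw [← pencil_symm hf hv h0 hπ t s hxc, ← Matrix.adjugate_transpose]
    rfl
  have hxself : ∑ i, x i * ∑ j, (pencil θ f v t s x).adjugate i j * Y j x = 0 := by
    have h1 := sum_mul_pencil (f := f) (v := v) (θ := θ) t s (x := x) (u := x) (a := 0) (b := 0)
      (fun j => by rw [hf.sum_coord_hessMat h0 hπ hxc, zero_mul])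
      (fun j => by rw [hv.sum_coord_hessMat h0 hπ hxc, zero_mul])
    have h2 := sum_mul_adjugate_mulVec h1 (fun j => Y j x)
    simp only [hY, sum_mul_wronskian, hf.deriv_self hxc, hv.deriv_self hxc] at h2 ⊢
    linear_combination h2
  have hpiola : ∑ i, ∑ j, fderiv ℝ (fun y => (pencil θ f v t s y).adjugate i j) x (stdVec i) *
      Y j x = 0 := by
    rw [Finset.sum_comm]
    refine Finset.sum_eq_zero fun j _ => ?_
    rw [← Finset.sum_mul, sum_fderiv_adjugate_pencil hf hv h0 hπ hx hd j, zero_mul]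
  have hanti : ∑ i, ∑ j, (pencil θ f v t s x).adjugate i j *
      (coneDeriv θ f x (stdVec i) * coneDeriv θ v x (stdVec j) -
        coneDeriv θ v x (stdVec i) * coneDeriv θ f x (stdVec j)) = 0 := by
    simp only [mul_sub, Finset.sum_sub_distrib]
    rw [sub_eq_zero]
    conv_rhs => rw [Finset.sum_comm]
    refine Finset.sum_congr rfl fun i _ => Finset.sum_congr rfl fun j _ => ?_
    rw [hadjs j i]; ring
  simp only [hZ, Finset.sum_add_distrib, ← Finset.mul_sum, hxself, hpiola, hYe, mul_add, hanti]
  simp only [fluxDensity, hf.hessMat_symm h0 hπ hxc _ _, Finset.mul_sum, mul_sub,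
    Finset.sum_sub_distrib]
  simp only [mul_zero, zero_add, add_zero]
  congr 1 <;>
  · refine Finset.sum_congr rfl fun i _ => Finset.sum_congr rfl fun j _ => ?_
    first
    | rw [hv.hessMat_symm h0 hπ hxc i j]; ring
    | rw [hf.hessMat_symm h0 hπ hxc i j]; ring

lemma setIntegral_fluxDensity {t s : ℝ}
    (hdet : ∀ x ∈ cone n θ, 1 ≤ ‖x‖ → ‖x‖ ≤ 2 → (pencil θ f v t s x).det ≠ 0) :
    ∫ x in openCone n θ, annulusBump x * fluxDensity θ f v t s x = 0 := by
  rw [← setIntegral_divergence_eq_zero h0 hπ one_pos (contDiffOn_fluxField hf hv h0 hπ t s)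
    (fluxField_support t s) fun x hx hh => sum_heightGrad_fluxField hf hv h0 hπ hdet hx hh]
  exact setIntegral_congr_fun isOpen_openCone.measurableSet fun x hx =>
    (sum_fderiv_fluxField hf hv h0 hπ hdet hx).symm

lemma integrableOn_fluxDensity (t s : ℝ) :
    IntegrableOn (fun x => annulusBump x * fluxDensity θ f v t s x) (openCone n θ) := by
  have h1 : IntegrableOn (fun x => annulusBump x * fluxDensity θ f v t s x)
      (cone n θ ∩ {x | 1 ≤ ‖x‖ ∧ ‖x‖ ≤ 2}) :=
    (((contDiff_annulusBump (r := 0)).continuous.continuousOn.mul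
      (continuousOn_fluxDensity hf hv h0 hπ t s)).mono Set.inter_subset_left).integrableOn_compact
      (isCompact_cone_inter 1 2 one_pos)
  refine h1.of_forall_sdiff_eq_zero isOpen_openCone.measurableSet fun x hx => ?_
  by_contra h
  exact hx.2 ⟨openCone_subset_cone hx.1, annulusBump_support (left_ne_zero_of_mul h)⟩

end Identity
end Core
end Capillary

namespace Capillary
open Filter Topology MeasureTheory

section Extraction
open Polynomial

lemma integral_coeff_eq_zero {α : Type*} [MeasurableSpace α] {μ : Measure α} {Q : α → ℝ[X]}
    {d : ℕ} (hd : ∀ x, (Q x).natDegree ≤ d) {T : Set ℝ} (hT : T.Infinite)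
    (hint : ∀ t ∈ T, Integrable (fun x => (Q x).eval t) μ)
    (hzero : ∀ t ∈ T, ∫ x, (Q x).eval t ∂μ = 0) (j : ℕ) :
    Integrable (fun x => (Q x).coeff j) μ ∧ ∫ x, (Q x).coeff j ∂μ = 0 := by
  obtain ⟨S, hST, hS⟩ := hT.exists_subset_card_eq (d + 1)
  have hrep : ∀ x, (Q x).coeff j =
      ∑ t ∈ S, (Q x).eval t * (Lagrange.basis S (fun t : ℝ => t) t).coeff j := by
    intro x
    have hdeg : (Q x).degree < S.card := by
      rw [hS]
      exact lt_of_le_of_lt Polynomial.degree_le_natDegree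
        (by exact_mod_cast Nat.lt_succ_of_le (hd x))
    have h := Lagrange.eq_interpolate (s := S) (v := fun t : ℝ => t)
      (Function.injective_id.injOn) hdeg
    conv_lhs => rw [h, Lagrange.interpolate_apply, Polynomial.finsetSum_coeff]
    simp only [Polynomial.coeff_C_mul]
  simp only [hrep]
  refine ⟨integrable_finsetSum _ fun t ht => (hint t (hST ht)).mul_const _, ?_⟩
  rw [integral_finsetSum _ fun t ht => (hint t (hST ht)).mul_const _]
  refine Finset.sum_eq_zero fun t ht => ?_
  rw [integral_mul_const, hzero t (hST ht), zero_mul]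

lemma det_one_add_smul_line {m : ℕ} (A B : Matrix (Fin m) (Fin m) ℝ) (t s : ℝ) :
    (1 + t • (A + s • B)).det =
      ∑ k ∈ Finset.range (m + 1), (sigmaPoly k A B).eval s * t ^ k := by
  rw [det_one_add_smul_eq_sum]
  simp only [eval_sigmaPoly]

lemma mul_trace_adjugate_right {m : ℕ} (A B : Matrix (Fin m) (Fin m) ℝ) (t s : ℝ) :
    t * ∑ i, ∑ j, (1 + t • (A + s • B)).adjugate i j * B j i =
      ∑ k ∈ Finset.range (m + 1), (sigmaPoly k A B).derivative.eval s * t ^ k := by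
  have h1 := hasFDerivAt_det (E := ℝ) (M := fun r : ℝ => 1 + t • (A + r • B))
    (M' := fun i j => ContinuousLinearMap.toSpanSingleton ℝ (t * B i j)) (x := s) (fun i j => by
      have : HasDerivAt (fun r : ℝ => (1 : Matrix (Fin m) (Fin m) ℝ) i j +
          t * (A i j + r * B i j)) (t * B i j) s := by
        simpa using ((((hasDerivAt_id s).mul_const (B i j)).const_add (A i j)).const_mul
          t).const_add ((1 : Matrix (Fin m) (Fin m) ℝ) i j)
      exact this.hasFDerivAt)
  have h2 := h1.hasDerivAt
  simp only [det_one_add_smul_line] at h2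
  have h3 : HasDerivAt (fun r : ℝ => ∑ k ∈ Finset.range (m + 1),
      (sigmaPoly k A B).eval r * t ^ k)
      (∑ k ∈ Finset.range (m + 1), (sigmaPoly k A B).derivative.eval s * t ^ k) s :=
    HasDerivAt.fun_sum fun k _ => ((sigmaPoly k A B).hasDerivAt s).mul_const _
  rw [← h2.unique h3]
  simp only [sum_apply, smul_apply, ContinuousLinearMap.toSpanSingleton_apply, smul_eq_mul,
    Finset.mul_sum]
  refine Finset.sum_congr rfl fun i _ => Finset.sum_congr rfl fun j _ => by ring

lemma mul_trace_adjugate_self {m : ℕ} (A B : Matrix (Fin m) (Fin m) ℝ) (t s : ℝ) :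
    t * ∑ i, ∑ j, (1 + t • (A + s • B)).adjugate i j * (A + s • B) j i =
      ∑ k ∈ Finset.range (m + 1), k * (sigmaPoly k A B).eval s * t ^ k := by
  have h1 := hasFDerivAt_det (E := ℝ) (M := fun r : ℝ => 1 + r • (A + s • B))
    (M' := fun i j => ContinuousLinearMap.toSpanSingleton ℝ ((A + s • B) i j)) (x := t)
    (fun i j => by
      have : HasDerivAt (fun r : ℝ => (1 : Matrix (Fin m) (Fin m) ℝ) i j +
          r * (A + s • B) i j) ((A + s • B) i j) t := by
        simpa using ((hasDerivAt_id t).mul_const ((A + s • B) i j)).const_add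
          ((1 : Matrix (Fin m) (Fin m) ℝ) i j)
      exact this.hasFDerivAt)
  have h2 := h1.hasDerivAt
  simp only [det_one_add_smul_line] at h2
  have h3 : HasDerivAt (fun r : ℝ => ∑ k ∈ Finset.range (m + 1),
      (sigmaPoly k A B).eval s * r ^ k)
      (∑ k ∈ Finset.range (m + 1), (sigmaPoly k A B).eval s * (k * t ^ (k - 1))) t :=
    HasDerivAt.fun_sum fun k _ => (hasDerivAt_pow k t).const_mul _
  have h4 := h2.unique h3
  simp only [sum_apply, smul_apply, ContinuousLinearMap.toSpanSingleton_apply, smul_eq_mul,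
    one_mul] at h4
  rw [h4, Finset.mul_sum]
  refine Finset.sum_congr rfl fun k _ => ?_
  cases k with
  | zero => simp
  | succ k => simp only [Nat.add_sub_cancel]; ring

end Extraction

section Rigidity
variable {n : ℕ} {θ : ℝ} {f v : Amb n → ℝ}
open Polynomial

/-- The coefficient of `t ^ k` in `t` times the flux density, as a polynomial in `s`. -/
noncomputable def densityPoly {n : ℕ} (θ : ℝ) (f v : Amb n → ℝ) (k : ℕ) (x : Amb n) : ℝ[X] :=
  C (annulusBump x * f x) * (sigmaPoly k (hessMat θ f x) (hessMat θ v x)).derivative -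
    C (annulusBump x * v x) * (C (k : ℝ) * sigmaPoly k (hessMat θ f x) (hessMat θ v x) -
      X * (sigmaPoly k (hessMat θ f x) (hessMat θ v x)).derivative)

lemma natDegree_densityPoly_le (k : ℕ) (x : Amb n) : (densityPoly θ f v k x).natDegree ≤ k + 1 := by
  set P := sigmaPoly k (hessMat θ f x) (hessMat θ v x) with hP
  have h1 : P.natDegree ≤ k := natDegree_sigmaPoly_le _ _ _
  have h2 : P.derivative.natDegree ≤ k := (natDegree_derivative_le P).trans (by lia)
  refine (natDegree_sub_le _ _).trans (max_le ?_ ?_)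
  · exact (natDegree_C_mul_le _ _).trans (by lia)
  · refine (natDegree_C_mul_le _ _).trans ((natDegree_sub_le _ _).trans (max_le ?_ ?_))
    · exact (natDegree_C_mul_le _ _).trans (by lia)
    · exact natDegree_mul_le.trans (by rw [natDegree_X]; lia)

lemma mul_fluxDensity (t s : ℝ) (x : Amb n) :
    t * (annulusBump x * fluxDensity θ f v t s x) =
      ∑ k ∈ Finset.range (n + 2), (densityPoly θ f v k x).eval s * t ^ k := by
  have h1 := mul_trace_adjugate_right (hessMat θ f x) (hessMat θ v x) t s
  have h2 := mul_trace_adjugate_self (hessMat θ f x) (hessMat θ v x) t s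
  have h3 : ∑ i, ∑ j, (1 + t • (hessMat θ f x + s • hessMat θ v x)).adjugate i j *
      (hessMat θ f x + s • hessMat θ v x) j i =
      ∑ i, ∑ j, (pencil θ f v t s x).adjugate i j * hessMat θ f x j i +
      s * ∑ i, ∑ j, (pencil θ f v t s x).adjugate i j * hessMat θ v x j i := by
    simp only [Matrix.add_apply, Matrix.smul_apply, smul_eq_mul, mul_add, Finset.sum_add_distrib,
      Finset.mul_sum, pencil]
    congr 1
    exact Finset.sum_congr rfl fun i _ => Finset.sum_congr rfl fun j _ => by ring
  rw [h3] at h2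
  have h4 : ∑ k ∈ Finset.range (n + 2), (densityPoly θ f v k x).eval s * t ^ k =
      annulusBump x * f x * (∑ k ∈ Finset.range (n + 1 + 1),
        (sigmaPoly k (hessMat θ f x) (hessMat θ v x)).derivative.eval s * t ^ k) -
      annulusBump x * v x * ((∑ k ∈ Finset.range (n + 1 + 1),
        k * (sigmaPoly k (hessMat θ f x) (hessMat θ v x)).eval s * t ^ k) -
        s * ∑ k ∈ Finset.range (n + 1 + 1),
        (sigmaPoly k (hessMat θ f x) (hessMat θ v x)).derivative.eval s * t ^ k) := by
    simp only [Finset.mul_sum, ← Finset.sum_sub_distrib]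
    refine Finset.sum_congr rfl fun k _ => ?_
    simp only [densityPoly, eval_sub, eval_mul, eval_C, eval_X]
    ring
  rw [h4, ← h1, ← h2]
  change _ = annulusBump x * f x * (t * ∑ i, ∑ j, (pencil θ f v t s x).adjugate i j * _) -
    annulusBump x * v x * (_ - s * (t * ∑ i, ∑ j, (pencil θ f v t s x).adjugate i j * _))
  rw [fluxDensity]
  ring

variable (hf : IsCapillaryHomogeneous θ f) (hv : IsCapillaryHomogeneous θ v)
  (h0 : 0 < θ) (hπ : θ < Real.pi)
include hf hv h0 hπ

lemma eventually_det_pencil_ne_zero (s : ℝ) :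
    ∀ᶠ t in 𝓝 (0 : ℝ), ∀ x ∈ cone n θ, 1 ≤ ‖x‖ → ‖x‖ ≤ 2 → (pencil θ f v t s x).det ≠ 0 := by
  set K := cone n θ ∩ {x | 1 ≤ ‖x‖ ∧ ‖x‖ ≤ 2}
  have hK : IsCompact K := isCompact_cone_inter 1 2 one_pos
  have : CompactSpace K := isCompact_iff_compactSpace.1 hK
  have hA : ∀ {g : Amb n → ℝ} (hg : IsCapillaryHomogeneous θ g) (i j : Fin (n + 1)),
      Continuous fun x : K => hessMat θ g x i j := fun hg i j =>
    continuousOn_iff_continuous_domRestrict.1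
      ((hg.contDiffOn_hessMat h0 hπ i j).continuousOn.mono Set.inter_subset_left)
  have hcont : Continuous fun p : ℝ × K => (pencil θ f v p.1 s p.2).det := by
    refine Continuous.matrix_det (continuous_matrix fun i j => ?_)
    have h1 := (hA hf i j).comp (continuous_snd (X := ℝ))
    have h2 := (hA hv i j).comp (continuous_snd (X := ℝ))
    exact continuous_const.add (continuous_fst.mul (h1.add (continuous_const.mul h2)))
  have h1 : ∀ᶠ t in 𝓝 (0 : ℝ), ∀ x ∈ (Set.univ : Set K), (pencil θ f v t s x).det ≠ 0 := by
    refine isCompact_univ.eventually_forall_of_forall_eventually fun x _ => ?_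
    refine hcont.continuousAt.eventually_ne ?_
    simp [pencil]
  filter_upwards [h1] with t ht x hx hx1 hx2
  exact ht ⟨x, hx, hx1, hx2⟩ (Set.mem_univ _)

lemma setIntegral_densityPoly (k : ℕ) (hk : k ≤ n) (s : ℝ) :
    IntegrableOn (fun x => (densityPoly θ f v k x).eval s) (openCone n θ) ∧
      ∫ x in openCone n θ, (densityPoly θ f v k x).eval s = 0 := by
  let Q : Amb n → ℝ[X] := fun x =>
    ∑ k ∈ Finset.range (n + 2), C ((densityPoly θ f v k x).eval s) * X ^ k
  have hQe : ∀ x t, (Q x).eval t = t * (annulusBump x * fluxDensity θ f v t s x) := by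
    intro x t
    rw [mul_fluxDensity, eval_finsetSum]
    simp
  have hQc : ∀ x, (Q x).coeff k = (densityPoly θ f v k x).eval s := by
    intro x
    simp only [Q, finsetSum_coeff, coeff_C_mul_X_pow, Finset.sum_ite_eq, Finset.mem_range]
    rw [if_pos (by lia)]
  have hQd : ∀ x, (Q x).natDegree ≤ n + 1 := fun x =>
    natDegree_sum_le_of_forall_le _ _ fun k hk => (natDegree_C_mul_X_pow_le _ _).trans (by
      have := Finset.mem_range.1 hk; lia)
  have hev := eventually_det_pencil_ne_zero hf hv h0 hπ s
  have hT := infinite_of_mem_nhds (0 : ℝ) hev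
  have := integral_coeff_eq_zero (μ := volume.restrict (openCone n θ)) hQd hT
    (fun t _ => by
      simp only [hQe]
      exact (integrableOn_fluxDensity hf hv h0 hπ t s).const_mul t)
    (fun t ht => by
      simp only [hQe]
      rw [integral_const_mul, setIntegral_fluxDensity hf hv h0 hπ ht, mul_zero]) k
  simp only [hQc] at this
  exact this

lemma setIntegral_coeff_two {k : ℕ} (hk : k ≤ n)
    (h1 : ∀ x ∈ openCone n θ, (sigmaPoly k (hessMat θ f x) (hessMat θ v x)).coeff 1 = 0) :
    IntegrableOn (fun x => annulusBump x * f x *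
      (sigmaPoly k (hessMat θ f x) (hessMat θ v x)).coeff 2) (openCone n θ) ∧
    ∫ x in openCone n θ, annulusBump x * f x *
      (sigmaPoly k (hessMat θ f x) (hessMat θ v x)).coeff 2 = 0 := by
  have h := integral_coeff_eq_zero (μ := volume.restrict (openCone n θ))
    (Q := fun x => densityPoly θ f v k x) (natDegree_densityPoly_le k) Set.infinite_univ
    (fun s _ => (setIntegral_densityPoly hf hv h0 hπ k hk s).1)
    (fun s _ => (setIntegral_densityPoly hf hv h0 hπ k hk s).2) 1
  have hc : ∀ x ∈ openCone n θ, (densityPoly θ f v k x).coeff 1 = 2 * (annulusBump x * f x *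
      (sigmaPoly k (hessMat θ f x) (hessMat θ v x)).coeff 2) := by
    intro x hx
    have h2 := h1 x hx
    simp only [densityPoly, coeff_sub, coeff_C_mul, coeff_derivative, coeff_X_mul, h2]
    norm_num [h2]
    ring
  have hint : IntegrableOn (fun x => 2 * (annulusBump x * f x *
      (sigmaPoly k (hessMat θ f x) (hessMat θ v x)).coeff 2)) (openCone n θ) :=
    IntegrableOn.congr_fun h.1 hc isOpen_openCone.measurableSet
  have hval := h.2
  rw [setIntegral_congr_fun isOpen_openCone.measurableSet hc, integral_const_mul] at hval
  refine ⟨?_, by simpa using hval⟩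
  have hh : IntegrableOn (fun x => 1 / 2 * (2 * (annulusBump x * f x *
      (sigmaPoly k (hessMat θ f x) (hessMat θ v x)).coeff 2))) (openCone n θ) :=
    hint.const_mul (1 / 2 : ℝ)
  exact hh.congr_fun (fun x _ => by ring) isOpen_openCone.measurableSet

/-- Rigidity: in the kernel of the linearized operator the second derivative vanishes. -/
theorem coneHess_eq_zero {k : ℕ} (hk : k ≤ n) (hpos : ∀ x ∈ openCone n θ, 0 < f x)
    (h1 : ∀ x ∈ openCone n θ, (sigmaPoly k (hessMat θ f x) (hessMat θ v x)).coeff 1 = 0)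
    (h2 : ∀ x ∈ openCone n θ, (sigmaPoly k (hessMat θ f x) (hessMat θ v x)).coeff 2 ≤ 0 ∧
      ((sigmaPoly k (hessMat θ f x) (hessMat θ v x)).coeff 2 = 0 → coneHess θ v x = 0)) :
    ∀ x ∈ openCone n θ, coneHess θ v x = 0 := by
  obtain ⟨hint, hzero⟩ := setIntegral_coeff_two hf hv h0 hπ hk h1
  set g : Amb n → ℝ := fun x => annulusBump x * f x *
      (sigmaPoly k (hessMat θ f x) (hessMat θ v x)).coeff 2 with hg
  have hnn : 0 ≤ᵐ[volume.restrict (openCone n θ)] fun x => -g x := by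
    filter_upwards [ae_restrict_mem isOpen_openCone.measurableSet] with x hx
    have := mul_nonneg (mul_nonneg (annulusBump_nonneg x) (hpos x hx).le)
      (neg_nonneg.2 (h2 x hx).1)
    simp only [hg, Pi.zero_apply]
    linarith
  have hae := (setIntegral_eq_zero_iff_of_nonneg_ae hnn hint.neg).1
    (by rw [integral_neg, hzero, neg_zero])
  set U : Set (Amb n) := openCone n θ ∩ {x | 1 < ‖x‖ ∧ ‖x‖ < 2}
  have hU : IsOpen U := isOpen_openCone.inter
    ((isOpen_lt continuous_const continuous_norm).inter
      (isOpen_lt continuous_norm continuous_const))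
  have hUae : coneHess θ v =ᵐ[volume.restrict U] fun _ => 0 := by
    filter_upwards [ae_restrict_of_ae_restrict_of_subset Set.inter_subset_left hae,
      ae_restrict_mem hU.measurableSet] with x hx hxU
    have h3 : g x = 0 := by simpa using hx
    have h4 : annulusBump x * f x ≠ 0 :=
      (mul_pos (annulusBump_pos hxU.2.1 hxU.2.2) (hpos x hxU.1)).ne'
    exact (h2 x hxU.1).2 ((mul_eq_zero.1 h3).resolve_left h4)
  have hEq : Set.EqOn (coneHess θ v) (fun _ => 0) U :=
    Measure.eqOn_open_of_ae_eq hUae hU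
      ((hv.contDiffOn_hess h0 hπ).continuousOn.mono
        (Set.inter_subset_left.trans openCone_subset_cone)) continuousOn_const
  intro x hx
  have hx0 : 0 < ‖x‖ := norm_pos_iff.2 (ne_zero_of_mem_openCone hx)
  have hc : 0 < 3 / 2 / ‖x‖ := by positivity
  have hn : ‖(3 / 2 / ‖x‖) • x‖ = 3 / 2 := by
    rw [norm_smul, Real.norm_of_nonneg hc.le]; field_simp
  have hmem : (3 / 2 / ‖x‖) • x ∈ U := by
    refine ⟨?_, ?_⟩
    · rw [mem_openCone, height_smul hc.le]
      exact mul_pos hc hx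
    · constructor <;> rw [hn] <;> norm_num
  have h5 : coneHess θ v ((3 / 2 / ‖x‖) • x) = 0 := hEq hmem
  rw [← hv.hess_smul h0 hπ (openCone_subset_cone hx) hc, h5]
  ext; simp

end Rigidity

section Linear
variable {n : ℕ} {θ : ℝ} {v : Amb n → ℝ}

/-- A capillary function with vanishing second derivative is a horizontal linear function. -/
theorem exists_eq_inner_of_coneHess_eq_zero (hv : IsCapillaryHomogeneous θ v) (h0 : 0 < θ)
    (hπ : θ < Real.pi) (h : ∀ x ∈ openCone n θ, coneHess θ v x = 0) (hn : 1 ≤ n) :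
    ∃ p : Amb n, p (Fin.last n) = 0 ∧ ∀ x ∈ cone n θ, v x = inner ℝ p x := by
  have hstar : IsPreconnected (openCone n θ) := by
    have hs : StarConvex ℝ (upVec n) (openCone n θ) := by
      rw [starConvex_iff_segment_subset]
      intro x hx y hy
      rw [segment_eq_image] at hy
      obtain ⟨t, ⟨ht0, ht1⟩, rfl⟩ := hy
      change (1 - t) • upVec n + t • x ∈ openCone n θ
      rw [add_comm ((1 - t) • upVec n) (t • x)]
      rcases ht0.eq_or_lt with rfl | ht
      · simpa using upVec_mem_openCone h0 hπ
      · have h1 := height_add_smul_upVec (θ := θ) (t • x) (sub_nonneg.2 ht1)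
        rw [height_smul ht.le] at h1
        have h2 := mul_pos ht hx
        have h3 := mul_nonneg (sub_nonneg.2 ht1) (sub_pos.2 (abs_cos_lt_one h0 hπ)).le
        rw [mem_openCone]
        linarith
    exact (StarConvex.isPathConnected hs (upVec_mem_openCone h0 hπ)).isConnected.isPreconnected
  have hd : ∀ x ∈ openCone n θ, HasFDerivAt (coneDeriv θ v) (coneHess θ v x) x := fun x hx =>
    (hv.hasFDerivWithinAt_deriv h0 hπ (openCone_subset_cone hx)).hasFDerivAt (cone_mem_nhds hx)
  have hu := upVec_mem_openCone (n := n) h0 hπ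
  have hconst : ∀ x ∈ openCone n θ, coneDeriv θ v x = coneDeriv θ v (upVec n) := fun x hx =>
    isOpen_openCone.is_const_of_fderiv_eq_zero hstar
      (fun y hy => (hd y hy).differentiableAt.differentiableWithinAt)
      (fun y hy => by rw [(hd y hy).fderiv, h y hy]; rfl) hx hu
  have hcl : ∀ x ∈ cone n θ, coneDeriv θ v x = coneDeriv θ v (upVec n) := by
    intro x hx
    have hlim : Tendsto (fun t : ℝ => x + t • upVec n) (𝓝[>] 0) (𝓝[cone n θ] x) := by
      refine tendsto_nhdsWithin_iff.2 ⟨?_, ?_⟩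
      · have : Continuous fun t : ℝ => x + t • upVec n := by fun_prop
        simpa using (this.tendsto 0).mono_left (nhdsWithin_le_nhds (s := Set.Ioi 0))
      · filter_upwards [self_mem_nhdsWithin] with t ht
        exact openCone_subset_cone
          (add_smul_upVec_mem_openCone h0 hπ (mem_cone_iff.1 hx).2 ht)
    have h1 := ((hv.contDiffOn_deriv h0 hπ).continuousOn x hx).tendsto.comp hlim
    refine tendsto_nhds_unique h1 (tendsto_const_nhds.congr' ?_)
    filter_upwards [self_mem_nhdsWithin] with t ht
    exact (hconst _ (add_smul_upVec_mem_openCone h0 hπ (mem_cone_iff.1 hx).2 ht)).symm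
  let p : Amb n := (InnerProductSpace.toDual ℝ (Amb n)).symm (coneDeriv θ v (upVec n))
  have hp : ∀ w, inner ℝ p w = coneDeriv θ v (upVec n) w := fun w =>
    InnerProductSpace.toDual_symm_apply
  refine ⟨p, ?_, fun x hx => ?_⟩
  · let i : Fin (n + 1) := ⟨0, by lia⟩
    have hi : Fin.last n ≠ i := by simp [i, Fin.ext_iff]; lia
    have hy : (stdVec i : Amb n) (Fin.last n) = 0 := by simp [stdVec, hi]
    have hy0 : (stdVec i : Amb n) ≠ 0 := fun h => by
      have := norm_stdVec i; rw [h, norm_zero] at this; exact zero_ne_one this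
    have hx := bdryLift_mem_cone h0 hπ hy hy0
    rw [← inner_upVec, hp, ← hcl _ hx]
    exact hv.bdry _ hx (height_bdryLift h0 hπ hy)
  · rw [hp, ← hcl x hx, hv.deriv_self hx]

end Linear
end Capillary

namespace Capillary
open Filter Topology

section Extension
variable {n : ℕ} {θ : ℝ} {u : Amb n → ℝ}

/-- The extension of a function on the cap that is homogeneous of degree one. -/
noncomputable def homExt {n : ℕ} (θ : ℝ) (u : Amb n → ℝ) (x : Amb n) : ℝ := ‖x‖ * radialExt θ u x

lemma norm_normal {ξ : Amb n} (hξ : ξ ∈ cap n θ) : ‖normal θ ξ‖ = 1 := hξ.2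

lemma radialProj_normal {ξ : Amb n} (hξ : ξ ∈ cap n θ) : radialProj θ (normal θ ξ) = ξ := by
  rw [radialProj, norm_normal hξ, inv_one, one_smul, normal, sub_add_cancel]

lemma normal_ne_zero {ξ : Amb n} (hξ : ξ ∈ cap n θ) : normal θ ξ ≠ 0 :=
  norm_ne_zero_iff.1 (by rw [norm_normal hξ]; exact one_ne_zero)

lemma normal_mem_cone {ξ : Amb n} (hξ : ξ ∈ cap n θ) : normal θ ξ ∈ cone n θ :=
  ⟨normal_ne_zero hξ, by rwa [radialProj_normal hξ]⟩

lemma normal_radialProj (x : Amb n) : normal θ (radialProj θ x) = ‖x‖⁻¹ • x :=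
  add_sub_cancel_right _ _

lemma radialProj_smul {c : ℝ} (hc : 0 < c) (x : Amb n) :
    radialProj θ (c • x) = radialProj θ x := by
  rw [radialProj, radialProj, norm_smul, Real.norm_of_nonneg hc.le, smul_smul, mul_inv]
  congr 2
  field_simp

lemma homExt_normal {ξ : Amb n} (hξ : ξ ∈ cap n θ) : homExt θ u (normal θ ξ) = u ξ := by
  rw [homExt, radialExt, norm_normal hξ, radialProj_normal hξ, one_mul]

variable (hu : CapContDiff θ 4 u) (h0 : 0 < θ) (hπ : θ < Real.pi)
include hu

lemma hasFDerivWithinAt_radialExt {x : Amb n} (hx : x ∈ cone n θ) :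
    HasFDerivWithinAt (radialExt θ u) (fderivWithin ℝ (radialExt θ u) (cone n θ) x)
      (cone n θ) x :=
  (ContDiffOn.differentiableOn hu (by norm_num) x hx).hasFDerivWithinAt

lemma fderivWithin_radialExt_self {x : Amb n} (hx : x ∈ cone n θ) :
    fderivWithin ℝ (radialExt θ u) (cone n θ) x x = 0 := by
  have h3 := hasDerivAt_comp_curve (one_smul ℝ x) (hasFDerivWithinAt_radialExt hu hx)
    (hasDerivAt_smul_const_one x)
    (eventually_of_mem (Ioi_mem_nhds one_pos) fun c hc => smul_mem_cone hc hx)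
  refine h3.unique ((hasDerivAt_const (1 : ℝ) (radialExt θ u x)).congr_of_eventuallyEq ?_)
  filter_upwards [Ioi_mem_nhds one_pos] with c hc
  rw [radialExt, radialProj_smul hc, radialExt]

include h0 hπ

lemma fderivWithin_radialExt_smul {x : Amb n} (hx : x ∈ cone n θ) {c : ℝ} (hc : 0 < c) :
    c • fderivWithin ℝ (radialExt θ u) (cone n θ) (c • x) =
      fderivWithin ℝ (radialExt θ u) (cone n θ) x := by
  have h1 : HasFDerivWithinAt (fun y : Amb n => c • y) (c • ContinuousLinearMap.id ℝ (Amb n))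
      (cone n θ) x := ((hasFDerivAt_id x).const_smul c).hasFDerivWithinAt
  have h2 := (hasFDerivWithinAt_radialExt hu (smul_mem_cone hc hx)).comp x h1
    (fun y hy => smul_mem_cone hc hy)
  have he : ∀ y, (radialExt θ u ∘ fun y : Amb n => c • y) y = radialExt θ u y := fun y => by
    rw [Function.comp_apply, radialExt, radialProj_smul hc, radialExt]
  have h3 := (hasFDerivWithinAt_radialExt hu hx).congr (fun y _ => he y) (he x)
  rw [← (uniqueDiffOn_cone h0 hπ x hx).eq h2 h3]
  ext w
  simp

lemma coneDeriv_homExt {x : Amb n} (hx : x ∈ cone n θ) :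
    coneDeriv θ (homExt θ u) x = ‖x‖ • fderivWithin ℝ (radialExt θ u) (cone n θ) x +
      radialExt θ u x • (‖x‖⁻¹ • innerSL ℝ x) :=
  ((hasFDerivAt_norm_of_ne_zero (mem_cone_iff.1 hx).1).hasFDerivWithinAt.mul
    (hasFDerivWithinAt_radialExt hu hx)).fderivWithin (uniqueDiffOn_cone h0 hπ x hx)

/-- The homogeneous extension of a `C⁴` function satisfying the Robin condition. -/
theorem isCapillaryHomogeneous_homExt (hr : Robin θ u) :
    IsCapillaryHomogeneous θ (homExt θ u) where
  contDiffOn := ContDiffOn.mul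
    (fun x hx => (contDiffAt_norm ℝ (mem_cone_iff.1 hx).1).contDiffWithinAt) hu
  hom_smul x _ c hc := by
    rw [homExt, homExt, radialExt, radialProj_smul hc, radialExt, norm_smul,
      Real.norm_of_nonneg hc.le, mul_assoc]
  bdry x hx hh := by
    have hs := (Real.sin_pos_of_pos_of_lt_pi h0 hπ).ne'
    have hx0 : 0 < ‖x‖ := norm_pos_iff.2 (mem_cone_iff.1 hx).1
    have hl : x (Fin.last n) = Real.cos θ * ‖x‖ := by rw [height] at hh; linarith
    have hb : radialProj θ x ∈ capBoundary n θ := by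
      refine ⟨hx.2, ?_⟩
      simp only [radialProj, downVec_eq, PiLp.add_apply, PiLp.smul_apply, PiLp.neg_apply,
        upVec_apply_last, smul_eq_mul, hl]
      field_simp
      ring
    have h1 := hr _ hb
    have h2 := fderivWithin_radialExt_smul hu h0 hπ hx (inv_pos.2 hx0)
    have h3 := fderivWithin_radialExt_self hu hx
    rw [capDeriv, conormal, normal_radialProj, downVec_eq, map_smul, map_add, map_smul, map_smul,
      map_neg, smul_eq_mul, smul_eq_mul, smul_eq_mul, Real.cot_eq_cos_div_sin] at h1
    rw [coneDeriv_homExt hu h0 hπ hx]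
    rw [← h2] at h3 ⊢
    simp only [add_apply, smul_apply, smul_eq_mul, innerSL_apply_apply, inner_upVec, hl,
      radialExt] at h3 ⊢
    set D := fderivWithin ℝ (radialExt θ u) (cone n θ) (‖x‖⁻¹ • x)
    field_simp at h1 h3 ⊢
    rw [h3] at h1
    refine mul_left_cancel₀ hx0.ne' ?_
    linear_combination -h1

omit hu h0 hπ in
lemma hasFDerivAt_inner_div_norm {x : Amb n} (hx : x ≠ 0) (Y : Amb n) :
    HasFDerivAt (fun y : Amb n => ‖y‖⁻¹ * inner ℝ y Y)
      (‖x‖⁻¹ • innerSL ℝ Y - ((‖x‖ ^ 2)⁻¹ * ‖x‖⁻¹ * inner ℝ x Y) • innerSL ℝ x) x := by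
  have h1 := (hasDerivAt_inv (norm_ne_zero_iff.2 hx)).comp_hasFDerivAt x
    (hasFDerivAt_norm_of_ne_zero hx)
  have h2 : HasFDerivAt (fun y : Amb n => inner ℝ y Y) (innerSL ℝ Y) x := by
    have : (fun y : Amb n => inner ℝ y Y) = innerSL ℝ Y := by
      ext y; rw [innerSL_apply_apply, real_inner_comm]
    rw [this]; exact ContinuousLinearMap.hasFDerivAt _
  refine (h1.mul h2).congr_fderiv ?_
  ext w
  simp
  ring

/-- On tangent vectors the second derivative of the homogeneous extension is `∇²u + uσ`. -/
theorem coneHess_homExt (hr : Robin θ u) {ξ : Amb n} (hξ : ξ ∈ cap n θ) {X Y : Amb n}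
    (hX : inner ℝ X (normal θ ξ) = 0) (hY : inner ℝ Y (normal θ ξ) = 0) :
    coneHess θ (homExt θ u) (normal θ ξ) X Y = capW θ u ξ X Y := by
  have hν := normal_mem_cone hξ
  have hν0 := normal_ne_zero hξ
  have hn := norm_normal hξ
  have hg : radialExt θ u (normal θ ξ) = u ξ := by rw [radialExt, radialProj_normal hξ]
  set ν := normal θ ξ with hνdef
  have h1 := ((isCapillaryHomogeneous_homExt hu h0 hπ hr).hasFDerivWithinAt_deriv h0 hπ hν).clm_apply
    (hasFDerivWithinAt_const Y ν (cone n θ))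
  have h2 : HasFDerivWithinAt (fderivWithin ℝ (radialExt θ u) (cone n θ)) (capHess θ u ξ)
      (cone n θ) ν :=
    ((ContDiffOn.fderivWithin hu (m := 3) (uniqueDiffOn_cone h0 hπ)
      (by norm_num)).differentiableOn (by norm_num) ν hν).hasFDerivWithinAt
  have h3 := ((hasFDerivAt_norm_of_ne_zero hν0).hasFDerivWithinAt.mul (h2.clm_apply
    (hasFDerivWithinAt_const Y ν (cone n θ)))).add ((hasFDerivWithinAt_radialExt hu hν).mul
    (hasFDerivAt_inner_div_norm hν0 Y).hasFDerivWithinAt)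
  have h4 := h3.congr (f₁ := fun x => coneDeriv θ (homExt θ u) x Y)
    (fun x hx => by beta_reduce; rw [coneDeriv_homExt hu h0 hπ hx]; simp)
    (by rw [coneDeriv_homExt hu h0 hπ hν]; simp)
  have h5 := congrArg (fun L : Amb n →L[ℝ] ℝ => L X) ((uniqueDiffOn_cone h0 hπ ν hν).eq h1 h4)
  have hX' : inner ℝ ν X = 0 := by rw [real_inner_comm]; exact hX
  have hY' : inner ℝ ν Y = 0 := by rw [real_inner_comm]; exact hY
  simp [hn, hX', hY', hg] at h5
  rw [h5, capW, real_inner_comm]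

/-- Strict convexity of a function on the cap, in terms of its homogeneous extension. -/
theorem hessPos_homExt (hr : Robin θ u) (hW : StrictlyConvex θ u) : HessPos θ (homExt θ u) := by
  intro x hx X hX hX0
  have hx0 : 0 < ‖x‖ := norm_pos_iff.2 (mem_cone_iff.1 hx).1
  have hX' : inner ℝ X (normal θ (radialProj θ x)) = 0 := by
    rw [normal_radialProj, inner_smul_right, hX, mul_zero]
  have h1 := hW _ hx.2 X hX' hX0
  rw [← coneHess_homExt hu h0 hπ hr hx.2 hX' hX', normal_radialProj] at h1
  rw [← (isCapillaryHomogeneous_homExt hu h0 hπ hr).hess_smul h0 hπ hx (inv_pos.2 hx0)]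
  exact mul_pos (inv_pos.2 hx0) h1

end Extension

section Model
variable {n : ℕ} {θ : ℝ}

/-- The support function of the cap itself, as a homogeneous function. -/
noncomputable def capSupport {n : ℕ} (θ : ℝ) (x : Amb n) : ℝ :=
  ‖x‖ - Real.cos θ * inner ℝ x (upVec n)

lemma capSupport_pos (h0 : 0 < θ) (hπ : θ < Real.pi) {x : Amb n} (hx : x ≠ 0) :
    0 < capSupport θ x := by
  have h1 := abs_cos_lt_one h0 hπ
  have h2 := abs_real_inner_le_norm x (upVec n)
  rw [norm_upVec, mul_one] at h2
  have h3 : |Real.cos θ * inner ℝ x (upVec n)| ≤ |Real.cos θ| * ‖x‖ := by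
    rw [abs_mul]; gcongr
  have h4 := mul_lt_mul_of_pos_right h1 (norm_pos_iff.2 hx)
  have h5 := le_abs_self (Real.cos θ * inner ℝ x (upVec n))
  rw [capSupport]
  linarith

variable (h0 : 0 < θ) (hπ : θ < Real.pi)
include h0 hπ

lemma coneDeriv_capSupport {x : Amb n} (hx : x ∈ cone n θ) :
    coneDeriv θ (capSupport θ) x = ‖x‖⁻¹ • innerSL ℝ x - Real.cos θ • innerSL ℝ (upVec n) := by
  have h2 : HasFDerivAt (fun y : Amb n => inner ℝ y (upVec n)) (innerSL ℝ (upVec n)) x := by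
    have : (fun y : Amb n => inner ℝ y (upVec n)) = innerSL ℝ (upVec n) := by
      ext y; rw [innerSL_apply_apply, real_inner_comm]
    rw [this]; exact ContinuousLinearMap.hasFDerivAt _
  exact ((hasFDerivAt_norm_of_ne_zero (mem_cone_iff.1 hx).1).sub
    (h2.const_mul _)).hasFDerivWithinAt.fderivWithin (uniqueDiffOn_cone h0 hπ x hx)

lemma isCapillaryHomogeneous_capSupport :
    IsCapillaryHomogeneous θ (capSupport θ : Amb n → ℝ) where
  contDiffOn := ContDiffOn.sub
    (fun x hx => (contDiffAt_norm ℝ (mem_cone_iff.1 hx).1).contDiffWithinAt)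
    (contDiff_const.mul (contDiff_id.inner ℝ contDiff_const)).contDiffOn
  hom_smul x _ c hc := by
    rw [capSupport, capSupport, norm_smul, Real.norm_of_nonneg hc.le, inner_smul_left,
      conj_trivial]
    ring
  bdry x hx hh := by
    have hx0 : 0 < ‖x‖ := norm_pos_iff.2 (mem_cone_iff.1 hx).1
    have hl : x (Fin.last n) = Real.cos θ * ‖x‖ := by rw [height] at hh; linarith
    rw [coneDeriv_capSupport h0 hπ hx]
    simp only [sub_apply, smul_apply, smul_eq_mul, innerSL_apply_apply, inner_upVec, hl,
      upVec_apply_last]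
    field_simp
    ring

lemma coneHess_capSupport {ν : Amb n} (hν : ν ∈ cone n θ) (hn : ‖ν‖ = 1) {X : Amb n} (Y : Amb n)
    (hX : inner ℝ X ν = 0) : coneHess θ (capSupport θ) ν X Y = inner ℝ X Y := by
  have h1 := ((isCapillaryHomogeneous_capSupport h0 hπ).hasFDerivWithinAt_deriv h0 hπ hν).clm_apply
    (hasFDerivWithinAt_const Y ν (cone n θ))
  have h3 := ((hasFDerivAt_inner_div_norm (mem_cone_iff.1 hν).1 Y).sub_const
    (Real.cos θ * inner ℝ (upVec n) Y)).hasFDerivWithinAt (s := cone n θ)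
  have h4 := h3.congr (f₁ := fun x => coneDeriv θ (capSupport θ) x Y)
    (fun x hx => by beta_reduce; rw [coneDeriv_capSupport h0 hπ hx]; simp)
    (by rw [coneDeriv_capSupport h0 hπ hν]; simp)
  have h5 := congrArg (fun L : Amb n →L[ℝ] ℝ => L X) ((uniqueDiffOn_cone h0 hπ ν hν).eq h1 h4)
  have hX' : inner ℝ ν X = 0 := by rw [real_inner_comm]; exact hX
  simp [hn, hX'] at h5
  rw [h5, real_inner_comm]

end Model
end Capillary

namespace Capillary
open Polynomial

section Frame
variable {n : ℕ} {θ : ℝ}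

/-- The matrix of a bilinear form with respect to a family of vectors. -/
noncomputable def formMatrix {ι : Type*} {n : ℕ} (L : Amb n →L[ℝ] Amb n →L[ℝ] ℝ) (e : ι → Amb n) :
    Matrix ι ι ℝ := Matrix.of fun i j => L (e i) (e j)

lemma formMatrix_add_smul {ι : Type*} (L M : Amb n →L[ℝ] Amb n →L[ℝ] ℝ) (s : ℝ) (e : ι → Amb n) :
    formMatrix (L + s • M) e = formMatrix L e + s • formMatrix M e := by
  ext i j
  simp [formMatrix]

lemma formMatrix_smul {ι : Type*} (c : ℝ) (L : Amb n →L[ℝ] Amb n →L[ℝ] ℝ) (e : ι → Amb n) :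
    formMatrix (c • L) e = c • formMatrix L e := by
  ext i j
  simp [formMatrix]

lemma formMatrix_eq_conj {ι : Type*} (L : Amb n →L[ℝ] Amb n →L[ℝ] ℝ) (e : ι → Amb n) :
    formMatrix L e = (Matrix.of fun i j => e j i).transpose * formMatrix L stdVec *
      Matrix.of fun i j => e j i := by
  ext i j
  simp only [Matrix.mul_apply, Matrix.transpose_apply, Matrix.of_apply, formMatrix]
  rw [← sum_coord_mul (L := L (e i)) (e j)]
  refine Finset.sum_congr rfl fun l _ => ?_
  rw [mul_comm]
  congr 1
  exact (sum_coord_mul (L := L.flip (stdVec l)) (e i)).symm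

variable {b : Fin n → Amb n} {ν : Amb n} (hb : Orthonormal ℝ b) (hν : ‖ν‖ = 1)
  (hbν : ∀ i, inner ℝ (b i) ν = 0)
include hb hν hbν

lemma orthonormal_snoc : Orthonormal ℝ (Fin.snoc (α := fun _ => Amb n) b ν) := by
  refine ⟨fun i => ?_, fun i j hij => ?_⟩
  · induction i using Fin.lastCases with
    | last => simpa using hν
    | cast i => simpa using hb.1 i
  · induction i using Fin.lastCases with
    | last =>
      induction j using Fin.lastCases with
      | last => exact absurd rfl hij
      | cast j => simpa [real_inner_comm] using hbν j
    | cast i =>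
      induction j using Fin.lastCases with
      | last => simpa using hbν i
      | cast j => simpa using hb.2 fun h => hij (by rw [h])

/-- The elementary symmetric functions of a form annihilating `ν` are computed on the orthogonal
complement of `ν`. -/
lemma sigmaK_formMatrix (k : ℕ) {L : Amb n →L[ℝ] Amb n →L[ℝ] ℝ} (h1 : L ν = 0) :
    sigmaK k (formMatrix L stdVec) = sigmaK k (formMatrix L b) := by
  have ho := orthonormal_snoc hb hν hbν
  set e : Fin (n + 1) → Amb n := Fin.snoc (α := fun _ => Amb n) b ν
  refine sigmaK_congr_of_det (fun t => ?_) k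
  have hU : (Matrix.of fun i j => e j i : Matrix (Fin (n + 1)) (Fin (n + 1)) ℝ).transpose *
      (Matrix.of fun i j => e j i) = 1 := by
    ext i j
    have h := orthonormal_iff_ite.1 ho i j
    rw [Matrix.one_apply, ← h, Matrix.mul_apply, PiLp.inner_apply]
    exact Finset.sum_congr rfl fun l _ => by simp [mul_comm]
  rw [← det_one_add_smul_conj hU, ← formMatrix_eq_conj, Matrix.det_succ_row _ (Fin.last n),
    Fin.sum_univ_castSucc]
  have hlast : ∀ j, formMatrix L e (Fin.last n) j = 0 := fun j => by
    simp [formMatrix, e, h1]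
  have hz : ∀ j : Fin n, (1 + t • formMatrix L e) (Fin.last n) j.castSucc = 0 := fun j => by
    rw [Matrix.add_apply, Matrix.smul_apply, hlast, Matrix.one_apply_ne (Fin.castSucc_lt_last j).ne']
    simp
  have ho : (1 + t • formMatrix L e) (Fin.last n) (Fin.last n) = 1 := by
    rw [Matrix.add_apply, Matrix.smul_apply, hlast, Matrix.one_apply_eq]
    simp
  rw [Finset.sum_eq_zero fun j _ => by rw [hz, mul_zero, zero_mul], ho]
  simp only [Fin.val_last, ← two_mul, pow_mul, even_two, Even.neg_pow, one_pow, mul_one, zero_add,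
    one_mul]
  congr 1
  ext i j
  simp [formMatrix, e, Fin.succAbove_last, Matrix.one_apply]

lemma eq_zero_of_formMatrix_eq_zero {L : Amb n →L[ℝ] Amb n →L[ℝ] ℝ} (h1 : L ν = 0)
    (h2 : ∀ X, L X ν = 0) (h : formMatrix L b = 0) : L = 0 := by
  have ho := orthonormal_snoc hb hν hbν
  let B := basisOfOrthonormalOfCardEqFinrank ho (by simp)
  have hB : ∀ i, B i = Fin.snoc (α := fun _ => Amb n) b ν i := fun i => by
    simp [B, coe_basisOfOrthonormalOfCardEqFinrank]
  have key : ∀ i j, L (B i) (B j) = 0 := by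
    intro i j
    rw [hB, hB]
    induction i using Fin.lastCases with
    | last => simp [h1]
    | cast i =>
      induction j using Fin.lastCases with
      | last => simp [h2]
      | cast j => simpa [formMatrix] using congrFun (congrFun h i) j
  have h3 : ∀ i, L (B i) = 0 := fun i =>
    ContinuousLinearMap.coe_injective (B.ext fun j => by simpa using key i j)
  exact ContinuousLinearMap.coe_injective (B.ext fun i => by simpa using h3 i)

end Frame

section Single
variable {n : ℕ} {θ : ℝ} {f v : Amb n → ℝ} (hv : IsCapillaryHomogeneous θ v) (h0 : 0 < θ)
  (hπ : θ < Real.pi)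
include hv h0 hπ

lemma coneHess_eq_zero_of_formMatrix {x : Amb n} (hx : x ∈ cone n θ) {b : Fin n → Amb n}
    (hb : IsTangentFrame θ (radialProj θ x) b)
    (h : formMatrix (coneHess θ v (‖x‖⁻¹ • x)) b = 0) : coneHess θ v x = 0 := by
  have hx0 : 0 < ‖x‖⁻¹ := inv_pos.2 (norm_pos_iff.2 (mem_cone_iff.1 hx).1)
  have hxc := smul_mem_cone hx0 hx
  have hn : ‖‖x‖⁻¹ • x‖ = 1 := by
    rw [norm_smul, norm_inv, norm_norm]; exact inv_mul_cancel₀ (inv_pos.1 hx0).ne'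
  have hbν : ∀ i, inner ℝ (b i) (‖x‖⁻¹ • x) = 0 := fun i => by
    rw [← normal_radialProj (θ := θ)]; exact hb.2 i
  rw [← hv.hess_smul h0 hπ hx hx0, eq_zero_of_formMatrix_eq_zero hb.1 hn hbν
    (hv.hess_self h0 hπ hxc) (hv.hess_right_self h0 hπ hxc) h]
  ext
  simp

lemma isHermitian_formMatrix_coneHess {x : Amb n} (hx : x ∈ cone n θ) (b : Fin n → Amb n) :
    (formMatrix (coneHess θ v x) b).IsHermitian := by
  ext i j
  simp [formMatrix, hv.hess_symm h0 hπ hx (b i)]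

lemma posDef_formMatrix_coneHess (hpos : HessPos θ v) {x : Amb n} (hx : x ∈ cone n θ)
    {b : Fin n → Amb n} (hb : Orthonormal ℝ b) (hbx : ∀ i, inner ℝ (b i) x = 0) :
    (formMatrix (coneHess θ v x) b).PosDef := by
  refine Matrix.PosDef.of_dotProduct_mulVec_pos (isHermitian_formMatrix_coneHess hv h0 hπ hx b)
    fun y hy => ?_
  have h1 : coneHess θ v x (∑ i, y i • b i) (∑ i, y i • b i) =
      star y ⬝ᵥ (formMatrix (coneHess θ v x) b).mulVec y := by
    simp only [dotProduct, Matrix.mulVec, map_sum, map_smul, sum_apply, smul_apply, smul_eq_mul,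
      formMatrix, Matrix.of_apply, star_trivial, Finset.mul_sum]
    rw [Finset.sum_comm]
    exact Finset.sum_congr rfl fun i _ => Finset.sum_congr rfl fun j _ => by ring
  rw [← h1]
  refine hpos x hx _ ?_ fun h => hy ?_
  · rw [sum_inner]
    exact Finset.sum_eq_zero fun i _ => by rw [inner_smul_left, hbx, mul_zero]
  · exact funext fun i => Fintype.linearIndependent_iff.1 hb.linearIndependent y h i

end Single

section Link
variable {n : ℕ} {θ : ℝ} {f v : Amb n → ℝ} (hf : IsCapillaryHomogeneous θ f)
  (hv : IsCapillaryHomogeneous θ v) (h0 : 0 < θ) (hπ : θ < Real.pi)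
include hf hv h0 hπ

lemma sigmaPoly_hessMat (k : ℕ) {x : Amb n} (hx : x ∈ cone n θ) {b : Fin n → Amb n}
    (hb : IsTangentFrame θ (radialProj θ x) b) :
    sigmaPoly k (hessMat θ f x) (hessMat θ v x) = C (‖x‖⁻¹ ^ k) *
      sigmaPoly k (formMatrix (coneHess θ f (‖x‖⁻¹ • x)) b)
        (formMatrix (coneHess θ v (‖x‖⁻¹ • x)) b) := by
  have hx0 : 0 < ‖x‖⁻¹ := inv_pos.2 (norm_pos_iff.2 (mem_cone_iff.1 hx).1)
  have hxc := smul_mem_cone hx0 hx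
  have hn : ‖‖x‖⁻¹ • x‖ = 1 := by
    rw [norm_smul, norm_inv, norm_norm]; exact inv_mul_cancel₀ (inv_pos.1 hx0).ne'
  have hbν : ∀ i, inner ℝ (b i) (‖x‖⁻¹ • x) = 0 := fun i => by
    rw [← normal_radialProj (θ := θ)]; exact hb.2 i
  refine (eq_sigmaPoly fun s => ?_).symm
  rw [eval_mul, eval_C, eval_sigmaPoly, ← formMatrix_add_smul,
    ← sigmaK_formMatrix hb.1 hn hbν, ← sigmaK_smul, formMatrix_add_smul, smul_add, smul_comm _ s,
    ← formMatrix_smul, ← formMatrix_smul, hf.hess_smul h0 hπ hx hx0, hv.hess_smul h0 hπ hx hx0]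
  · rfl
  · rw [add_apply, smul_apply, hf.hess_self h0 hπ hxc, hv.hess_self h0 hπ hxc]
    simp

/-- Rigidity of the linearized operator, in orthonormal frames of the cap. -/
theorem coneHess_eq_zero_of_frame {k : ℕ} (hk : 2 ≤ k) (hkn : k ≤ n) {b : Amb n → Fin n → Amb n}
    (hb : ∀ ξ ∈ cap n θ, IsTangentFrame θ ξ (b ξ)) (hpos : ∀ x ∈ openCone n θ, 0 < f x)
    (hW : HessPos θ f)
    (h1 : ∀ ξ ∈ cap n θ, (sigmaPoly k (formMatrix (coneHess θ f (normal θ ξ)) (b ξ))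
      (formMatrix (coneHess θ v (normal θ ξ)) (b ξ))).coeff 1 = 0) :
    ∀ x ∈ openCone n θ, coneHess θ v x = 0 := by
  have hc : ∀ x ∈ openCone n θ, (sigmaPoly k (formMatrix (coneHess θ f (‖x‖⁻¹ • x))
      (b (radialProj θ x))) (formMatrix (coneHess θ v (‖x‖⁻¹ • x)) (b (radialProj θ x)))).coeff 1
      = 0 := fun x hx => by
    have := h1 _ (openCone_subset_cone hx).2
    rwa [normal_radialProj] at this
  refine coneHess_eq_zero hf hv h0 hπ hkn hpos (fun x hx => ?_) fun x hx => ?_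
  · have hxc := openCone_subset_cone hx
    rw [sigmaPoly_hessMat hf hv h0 hπ k hxc (hb _ hxc.2), coeff_C_mul, hc x hx, mul_zero]
  · have hxc := openCone_subset_cone hx
    have hx0 : 0 < ‖x‖⁻¹ := inv_pos.2 (norm_pos_iff.2 (mem_cone_iff.1 hxc).1)
    have hsc := smul_mem_cone hx0 hxc
    have hbx := hb _ hxc.2
    have hbν : ∀ i, inner ℝ (b (radialProj θ x) i) (‖x‖⁻¹ • x) = 0 := fun i => by
      rw [← normal_radialProj (θ := θ)]; exact hbx.2 i
    have h2 := coeff_two_sigmaPoly_posDef hk hkn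
      (posDef_formMatrix_coneHess hf h0 hπ hW hsc hbx.1 hbν)
      (isHermitian_formMatrix_coneHess hv h0 hπ hsc _) (hc x hx)
    have hp : 0 < ‖x‖⁻¹ ^ k := pow_pos hx0 k
    rw [sigmaPoly_hessMat hf hv h0 hπ k hxc hbx, coeff_C_mul]
    refine ⟨mul_nonpos_of_nonneg_of_nonpos hp.le h2.1, fun h3 => ?_⟩
    exact coneHess_eq_zero_of_formMatrix hv h0 hπ hxc hbx
      (h2.2 ((mul_eq_zero.1 h3).resolve_left hp.ne'))

end Link

section LowDegree
variable {n : ℕ}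

lemma sigmaK_one (A : Matrix (Fin n) (Fin n) ℝ) : sigmaK 1 A = A.trace := by
  rw [sigmaK, Finset.powersetCard_one, Finset.sum_map]
  exact Finset.sum_congr rfl fun i _ => det_submatrix_singleton A i

lemma coeff_one_sigmaPoly_one (W V : Matrix (Fin n) (Fin n) ℝ) :
    (sigmaPoly 1 W V).coeff 1 = V.trace := by
  have : C W.trace + C V.trace * X = sigmaPoly 1 W V := eq_sigmaPoly fun s => by
    rw [sigmaK_one, Matrix.trace_add, Matrix.trace_smul, smul_eq_mul, eval_add, eval_C_mul, eval_C,
      eval_X, mul_comm]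
  rw [← this]
  simp

lemma coeff_one_sigmaPoly_two (V : Matrix (Fin n) (Fin n) ℝ) (h : V.trace = 0) :
    (sigmaPoly 2 1 V).coeff 1 = 0 := by
  rw [← Matrix.diagonal_one, coeff_one_sigmaPoly_diagonal (by norm_num)]
  have : ∀ i : Fin n, elemSymm {i}ᶜ (2 - 1) (fun _ : Fin n => (1 : ℝ)) = n - 1 := fun i => by
    have hn := i.pos
    rw [show 2 - 1 = 1 from rfl, elemSymm_one, Finset.sum_const, Finset.card_compl,
      Finset.card_singleton, Fintype.card_fin, nsmul_one, Nat.cast_sub hn, Nat.cast_one]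
  simp_rw [this]
  rw [← Finset.mul_sum]
  change _ * V.trace = 0
  rw [h, mul_zero]

end LowDegree
section Conclusion
variable {n : ℕ} {θ : ℝ} (h0 : 0 < θ) (hπ : θ < Real.pi)
include h0 hπ

lemma hessPos_capSupport : HessPos θ (capSupport θ : Amb n → ℝ) := by
  intro x hx X hX hX0
  have hx0 : 0 < ‖x‖⁻¹ := inv_pos.2 (norm_pos_iff.2 (mem_cone_iff.1 hx).1)
  have hn : ‖‖x‖⁻¹ • x‖ = 1 := by
    rw [norm_smul, norm_inv, norm_norm]; exact inv_mul_cancel₀ (inv_pos.1 hx0).ne'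
  rw [← (isCapillaryHomogeneous_capSupport h0 hπ).hess_smul h0 hπ hx hx0, smul_apply, smul_apply,
    smul_eq_mul, coneHess_capSupport h0 hπ (smul_mem_cone hx0 hx) hn X
      (by rw [inner_smul_right, hX, mul_zero])]
  exact mul_pos hx0 (real_inner_self_pos.2 hX0)

lemma formMatrix_capSupport {ξ : Amb n} (hξ : ξ ∈ cap n θ) {b : Fin n → Amb n}
    (hb : IsTangentFrame θ ξ b) :
    formMatrix (coneHess θ (capSupport θ) (normal θ ξ)) b = 1 := by
  ext i j
  rw [formMatrix, Matrix.of_apply, coneHess_capSupport h0 hπ (normal_mem_cone hξ) (norm_normal hξ)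
    (b j) (hb.2 i), Matrix.one_apply, orthonormal_iff_ite.1 hb.1]

lemma formMatrix_homExt {u : Amb n → ℝ} (hu : u ∈ C4Robin n θ) {ξ : Amb n} (hξ : ξ ∈ cap n θ)
    {b : Fin n → Amb n} (hb : IsTangentFrame θ ξ b) :
    formMatrix (coneHess θ (homExt θ u) (normal θ ξ)) b = capWMatrix θ u ξ b := by
  ext i j
  exact coneHess_homExt hu.1 h0 hπ hu.2 hξ (hb.2 i) (hb.2 j)

theorem coneHess_homExt_eq_zero {k : ℕ} (hk : 1 ≤ k) (hkn : k ≤ n) {b : Amb n → Fin n → Amb n}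
    (hb : ∀ ξ ∈ cap n θ, IsTangentFrame θ ξ (b ξ)) {h v : Amb n → ℝ} (hh : h ∈ C4Robin n θ)
    (hv : v ∈ C4Robin n θ) (hW : StrictlyConvex θ h)
    (hL : ∀ ξ ∈ cap n θ, linearized θ k h v ξ (b ξ) = 0) :
    ∀ x ∈ openCone n θ, coneHess θ (homExt θ v) x = 0 := by
  have hF := isCapillaryHomogeneous_homExt hh.1 h0 hπ hh.2
  have hG := isCapillaryHomogeneous_homExt hv.1 h0 hπ hv.2
  have hFpos := hessPos_homExt hh.1 h0 hπ hh.2 hW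
  have hc : ∀ ξ ∈ cap n θ, (sigmaPoly k (formMatrix (coneHess θ (homExt θ h) (normal θ ξ)) (b ξ))
      (formMatrix (coneHess θ (homExt θ v) (normal θ ξ)) (b ξ))).coeff 1 = 0 := fun ξ hξ => by
    rw [formMatrix_homExt h0 hπ hh hξ (hb ξ hξ), formMatrix_homExt h0 hπ hv hξ (hb ξ hξ),
      coeff_one_sigmaPoly]
    exact hL ξ hξ
  obtain hk2 | rfl := hk.lt_or_eq
  · obtain ⟨p, hp, hpos⟩ := hF.exists_pos_sub_inner h0 hπ (by lia) hFpos
    refine coneHess_eq_zero_of_frame (hF.sub_inner h0 hπ hp) hG h0 hπ hk2 hkn hb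
      (fun x hx => hpos x (openCone_subset_cone hx)) (hF.hessPos_sub_inner h0 hπ hFpos p)
      fun ξ hξ => ?_
    rw [hF.coneHess_sub_inner h0 hπ p (normal_mem_cone hξ)]
    exact hc ξ hξ
  · have htr : ∀ ξ ∈ cap n θ,
        (formMatrix (coneHess θ (homExt θ v) (normal θ ξ)) (b ξ)).trace = 0 := fun ξ hξ => by
      rw [← hc ξ hξ, coeff_one_sigmaPoly_one]
    obtain hn | rfl := hkn.lt_or_eq
    · refine coneHess_eq_zero_of_frame (isCapillaryHomogeneous_capSupport h0 hπ) hG h0 hπ le_rfl hn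
        hb (fun x hx => capSupport_pos h0 hπ (ne_zero_of_mem_openCone hx))
        (hessPos_capSupport h0 hπ) fun ξ hξ => ?_
      rw [formMatrix_capSupport h0 hπ hξ (hb ξ hξ)]
      exact coeff_one_sigmaPoly_two _ (htr ξ hξ)
    · intro x hx
      have hxc := openCone_subset_cone hx
      refine coneHess_eq_zero_of_formMatrix hG h0 hπ hxc (hb _ hxc.2) ?_
      have := htr _ hxc.2
      rw [normal_radialProj, Matrix.trace_fin_one] at this
      ext i j
      rw [Subsingleton.elim i 0, Subsingleton.elim j 0, this]
      rfl

end Conclusion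
end Capillary

theorem lemma5p4 (n k m : ℕ) (hk : 1 ≤ k) (hkn : k ≤ n) (θ : ℝ) (hθ : 0 < θ) (hθπ : θ < Real.pi)
    (hm : Capillary.SobolevRobin n θ m ⊆ Capillary.C4Robin n θ)
    (b : Capillary.Amb n → Fin n → Capillary.Amb n)
    (hb : ∀ ξ ∈ Capillary.cap n θ, Capillary.IsTangentFrame θ ξ (b ξ))
    (h v : Capillary.Amb n → ℝ)
    (hh : h ∈ Capillary.SobolevRobin n θ m) (hv : v ∈ Capillary.SobolevRobin n θ m)
    (hW : Capillary.StrictlyConvex θ h)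
    (hL : ∀ ξ ∈ Capillary.cap n θ, Capillary.linearized θ k h v ξ (b ξ) = 0) :
    ∃ a : Fin n → ℝ, ∀ ξ ∈ Capillary.cap n θ,
      v ξ = ∑ α : Fin n, a α * inner ℝ ξ (Capillary.stdVec α.castSucc) := by
  have hz := Capillary.coneHess_homExt_eq_zero hθ hθπ hk hkn hb (hm hh) (hm hv) hW hL
  obtain ⟨p, hp, hpv⟩ := Capillary.exists_eq_inner_of_coneHess_eq_zero
    (Capillary.isCapillaryHomogeneous_homExt (hm hv).1 hθ hθπ (hm hv).2) hθ hθπ hz (hk.trans hkn)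
  refine ⟨fun α => p α.castSucc, fun ξ hξ => ?_⟩
  rw [← Capillary.homExt_normal (u := v) hξ, hpv _ (Capillary.normal_mem_cone hξ), Capillary.normal,
    Capillary.downVec_eq, smul_neg, sub_neg_eq_add, inner_add_right, inner_smul_right,
    Capillary.inner_upVec, hp, mul_zero, add_zero, PiLp.inner_apply, Fin.sum_univ_castSucc, hp]
  simp [Capillary.inner_stdVec, mul_comm]
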